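/- Let $m\ge 1$ and $n=2m$. Let $W_n$ be the Weyl group of type $B_n$, realised as the group of signed permutations of the standard basis $e_1,\dots,e_n$, with generators $t$ ($e_1\mapsto -e_1$) and $s_1,\dots,s_{n-1}$ ($s_i$ interchanges $e_i$ and $e_{i+1}$). Let $W_n'\subseteq W_n$ be the Weyl group of type $D_n$ (an even number of sign changes), with simple generators $S=\{u,s_1,\dots,s_{n-1}\}$, $u=ts_1t$, and length function $\ell$; let $\theta$ be the automorphism $w\mapsto twt$ of $W_n'$. *The involution characters.* For a conjugacy class $\mathcal C$ of involutions in $W_n'$, let $V_{\mathcal C}$ be the real vector space with basis $\{a_w\mid w\in\mathcal C\}$. Let $\rho_{\mathcal C}$ be the character of the linear action of $W_n'$ on $V_{\mathcal C}$ determined by $$s.a_w=\begin{cases}-a_w&\text{if } sw=ws \text{ and } \ell(sw)<\ell(w),\\ a_{sws}&\text{otherwise,}\end{cases}\qquad s\in S,\ w\in\mathcal C .$$ Let $\mathcal C_0'$ be the conjugacy class of $s_1s_3\cdots s_{n-1}$ in $W_n'$. *The characters $\chi^{\alpha,\pm1}$.* For an irreducible complex character $\chi$ of $W_n'$, let $b_\chi$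 be the smallest $d$ such that $\chi$ occurs in the $d$-th symmetric power of the ($n$-dimensional) reflection representation. For a partition $\alpha\vdash m$, let $\alpha^*$ be the conjugate partition, let $H_{2\alpha^*}\subseteq\langle s_1,\dots,s_{n-1}\rangle\cong\mathfrak S_n$ be the Young subgroup for the partition $2\alpha^*$ of $n$ (all parts of $\alpha^*$ doubled), let $w_{2\alpha^*}$ be its longest element and $\varepsilon_{2\alpha^*}$ its sign character. Let $\chi^{\alpha,+1}$ be the irreducible character of $W_n'$ with $b_{\chi^{\alpha,+1}}=\ell(w_{2\alpha^*})$ and $$\mathrm{Ind}_{H_{2\alpha^*}}^{W_n'}(\varepsilon_{2\alpha^*})=\chi^{\alpha,+1}+\text{a sum of irreducible characters } \psi \text{ with } b_\psi>\ell(w_{2\alpha^*}),$$ and let $\chi^{\alpha,-1}=\chi^{\alpha,+1}\circ\theta$. **Proposition.** The actions on $V_{\mathcal C_0'}$ and $V_{\theta(\mathcal C_0')}$ exist and are unique, for every $\alpha\vdash m$ the character $\chi^{\alpha,+1}$ exists and is unique, $\theta(\mathcal C_0')\ne\mathcal C_0'$, and $$\rho_{\mathcal C_0'}=\sum_{\alpha\vdash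 m}\chi^{\alpha,+1},\qquad \rho_{\theta(\mathcal C_0')}=\sum_{\alpha\vdash m}\chi^{\alpha,-1}.$$ In particular, if $\rho_{\mathcal C_0'}=\sum_{\alpha\vdash m}\chi^{\alpha,\nu_\alpha}$ with signs $\nu_\alpha\in\{\pm1\}$, then $\nu_\alpha=+1$ for all $\alpha\vdash m$. -/

import Mathlib

namespace TypeD

/-! ### The groups of type `B_n` and `D_n` -/

/-- The Weyl group of type `B_n` as the group of signed permutations. The element `⟨ε, σ⟩` acts on
the standard basis of the reflection representation by `e_j ↦ ε (σ j) • e_{σ j}`. -/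
abbrev WB (n : ℕ) : Type :=
  SemidirectProduct (Fin n → ℤˣ) (Equiv.Perm (Fin n)) mulAutArrow

/-- The product of all the signs of a signed permutation. -/
def signProd (n : ℕ) : WB n →* ℤˣ where
  toFun w := ∏ i, w.left i
  map_one' := by simp
  map_mul' a b := by
    simp only [SemidirectProduct.mul_left, Pi.mul_apply, Finset.prod_mul_distrib]
    congr 1
    exact Fintype.prod_equiv a.right⁻¹ _ _ (fun i => rfl)

/-- The Weyl group of type `D_n`: the signed permutations with an even number of sign changes. -/
abbrev WD (n : ℕ) : Subgroup (WB n) := (signProd n).ker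

instance (n : ℕ) : Finite (WB n) := Finite.of_equiv _ SemidirectProduct.equivProd.symm

noncomputable instance (n : ℕ) : Fintype (WD n) := Fintype.ofFinite _

/-- The generator `t` of `WB n`, i.e. `e_1 ↦ -e_1` (indices in `Fin n` start at `0`). -/
def t (n : ℕ) : WB n := ⟨fun i => if i.val = 0 then -1 else 1, 1⟩

/-- The generator `s_{i+1}` of `WD n`: it interchanges the basis vectors with (zero-based) indices
`i` and `i + 1`. -/
def s {n : ℕ} (i : ℕ) (h : i + 1 < n) : WD n :=
  ⟨⟨1, Equiv.swap ⟨i, by omega⟩ ⟨i + 1, h⟩⟩, by simp [MonoidHom.mem_ker, signProd]⟩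

/-- The automorphism `θ` of `WD n` given by conjugation with `t`. -/
def theta (n : ℕ) : WD n ≃* WD n := MulAut.conjNormal (t n)

/-- The generator `u = t s_1 t` of `WD n`. -/
def u {n : ℕ} (h : 1 < n) : WD n := theta n (s 0 h)

/-- The set of simple generators `u, s_1, …, s_{n-1}` of `WD n`. -/
def simple (n : ℕ) : Set (WD n) :=
  {w | (∃ h : 1 < n, w = u h) ∨ ∃ (i : ℕ) (h : i + 1 < n), w = s i h}

/-- The length of `w` with respect to the simple generators. -/
noncomputable def len {n : ℕ} (w : WD n) : ℕ :=
  sInf {k | ∃ l : List (WD n), (∀ x ∈ l, x ∈ simple n) ∧ l.prod = w ∧ l.length = k}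

/-! ### The representation attached to a union of conjugacy classes of involutions -/

open Classical in
/-- `ρ` is the linear action of `WD n` on the real vector space with basis `{a_w | w ∈ C}` such
that, for every simple generator `r` and every `w ∈ C`, one has `r.a_w = - a_w` if `r w = w r` and
`ℓ(r w) < ℓ(w)`, and `r.a_w = a_{r w r}` otherwise. -/
def IsInvolutionRep {n : ℕ} (C : Set (WD n)) (ρ : Representation ℝ (WD n) (C →₀ ℝ)) : Prop :=
  ∀ r ∈ simple n, ∀ w w' : C, w'.val = r * w.val * r →
    ρ r (Finsupp.single w 1) =
      if r * w.val = w.val * r ∧ len (r * w.val) < len w.val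
      then - Finsupp.single w 1 else Finsupp.single w' 1

/-- The element `s_1 s_3 ⋯ s_{n-1}` for `n = 2 m`. -/
def sigma (m : ℕ) : WD (2 * m) :=
  ((List.finRange m).map fun k => s (2 * k.val) (by omega)).prod

/-- The conjugacy class of `s_1 s_3 ⋯ s_{n-1}` in `WD n`, where `n = 2 m`. -/
def C₀ (m : ℕ) : Set (WD (2 * m)) := {w | IsConj (sigma m) w}

/-! ### Irreducible characters, induction, and the invariant `b` -/

/-- `χ` is the character of an irreducible complex representation of `G`. -/
def IsIrr {G : Type} [Group G] (χ : G → ℂ) : Prop :=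
  ∃ (V : Type) (_ : AddCommGroup V) (_ : Module ℂ V) (_ : FiniteDimensional ℂ V)
    (ρ : Representation ℂ G V), ρ.IsIrreducible ∧ ρ.character = χ

open Classical in
/-- The class function of `G` induced from the class function `ψ` of the subgroup `H`. -/
noncomputable def ind {G : Type} [Group G] [Fintype G] (H : Subgroup G) (ψ : H → ℂ) (g : G) : ℂ :=
  (Nat.card H : ℂ)⁻¹ * ∑ x : G, if h : x⁻¹ * g * x ∈ H then ψ ⟨x⁻¹ * g * x, h⟩ else 0

/-- The action of `WB n` on polynomials in `n` variables, i.e. on the symmetric algebra of the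
(complexified) reflection representation. -/
noncomputable def polyRepB (n : ℕ) : Representation ℂ (WB n) (MvPolynomial (Fin n) ℂ) where
  toFun w := (MvPolynomial.aeval fun j =>
    MvPolynomial.C (((w.left (w.right j) : ℤˣ) : ℤ) : ℂ) *
      MvPolynomial.X (w.right j) : MvPolynomial (Fin n) ℂ →ₐ[ℂ] MvPolynomial (Fin n) ℂ).toLinearMap
  map_one' := by
    rw [Module.End.one_eq_id, ← AlgHom.toLinearMap_id]
    congr 1
    ext j : 1
    simp
  map_mul' a b := by
    rw [Module.End.mul_eq_comp, ← AlgHom.comp_toLinearMap]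
    congr 1
    ext j : 1
    have h : mulAutArrow a.right b.left (a.right (b.right j)) = b.left (b.right j) := by
      change b.left (a.right⁻¹ (a.right (b.right j))) = _
      simp
    simp [mul_assoc, mul_left_comm, -mulAutArrow_apply_apply, h]

/-- The action of `WD n` on the symmetric algebra of its reflection representation. -/
noncomputable def polyRep (n : ℕ) : Representation ℂ (WD n) (MvPolynomial (Fin n) ℂ) :=
  (polyRepB n).comp (WD n).subtype

/-- The invariant `b_χ`: the smallest `d` such that `χ` occurs in the `d`-th symmetric power of the
reflection representation. -/
noncomputable def b {n : ℕ} (χ : WD n → ℂ) : ℕ :=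
  sInf {d | ∃ U : Subrepresentation (polyRep n),
    U.toSubmodule ≤ MvPolynomial.homogeneousSubmodule (Fin n) ℂ d ∧
      U.toRepresentation.character = χ}

/-! ### The characters `χ^{α,+1}` and `χ^{α,-1}` -/

/-- The part with (zero-based) index `j` of the conjugate partition `α*`: the number of parts of
`α` that are larger than `j`. -/
def conjPart {m : ℕ} (α : m.Partition) (j : ℕ) : ℕ := (α.parts.filter (j < ·)).card

/-- The sum of the first `k` parts of the partition `2 α*`. -/
def partialSum {m : ℕ} (α : m.Partition) (k : ℕ) : ℕ := ∑ j ∈ Finset.range k, 2 * conjPart α j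

/-- The Young subgroup `H_{2α*} ⊆ ⟨s_1, …, s_{n-1}⟩ ≅ 𝔖_n` of `WD n`: permutations (without sign
changes) that preserve every one of the consecutive blocks of sizes `2α*_1, 2α*_2, …`. -/
def young {m : ℕ} (α : m.Partition) : Subgroup (WD (2 * m)) where
  carrier := {w | w.val.left = 1 ∧ ∀ (k : ℕ) (i : Fin (2 * m)),
    (w.val.right i).val ∈ Set.Ico (partialSum α k) (partialSum α (k + 1)) ↔
      i.val ∈ Set.Ico (partialSum α k) (partialSum α (k + 1))}
  one_mem' := by simp
  mul_mem' := by
    rintro a b ⟨ha, ha'⟩ ⟨hb, hb'⟩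
    refine ⟨by simp [ha, hb], fun k i => ?_⟩
    rw [← hb' k i, ← ha' k (b.val.right i)]
    rfl
  inv_mem' := by
    rintro a ⟨ha, ha'⟩
    refine ⟨by simp [ha], fun k i => ?_⟩
    rw [← ha' k ((a⁻¹).val.right i)]
    simp

/-- The sign character of the Young subgroup `H_{2α*}`. -/
def youngSign {m : ℕ} (α : m.Partition) (w : young α) : ℂ :=
  ((Equiv.Perm.sign w.val.val.right : ℤ) : ℂ)

/-- `χ` is the character `χ^{α,+1}`: it is irreducible, `b_χ = ℓ(w_{2α*})`, where `w_{2α*}` is the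
longest element of `H_{2α*}`, and the character of `WD n` induced from the sign character of
`H_{2α*}` is the sum of `χ` and of irreducible characters `ψ` with `b_ψ > ℓ(w_{2α*})`. -/
def IsChiPlus {m : ℕ} (α : m.Partition) (χ : WD (2 * m) → ℂ) : Prop :=
  ∃ w₀ ∈ young α, (∀ w ∈ young α, len w ≤ len w₀) ∧
    IsIrr χ ∧ b χ = len w₀ ∧
    ∃ M : Multiset (WD (2 * m) → ℂ), (∀ ψ ∈ M, IsIrr ψ ∧ len w₀ < b ψ) ∧
      ind (young α) (youngSign α) = χ + M.sum

/-- Given `χ = χ^{α,+1}`, the character `χ^{α,ν}` for a sign `ν`: `χ^{α,-1}` is the conjugate of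
`χ^{α,+1}` under `θ`. -/
def signed {n : ℕ} (χ : WD n → ℂ) (ν : ℤˣ) : WD n → ℂ := if ν = 1 then χ else χ ∘ theta n

end TypeD

/-! Both sides are compared inside the polynomial ring, the symmetric algebra of the reflection
representation.

The character of `α`. A polynomial on which the Young subgroup acts by its sign has exponents that
are pairwise distinct on each block. Its degree is therefore at least `posSum α`, the number of
pairs lying in a common block, which is also the length of the longest element. In that degree such
polynomials form the line spanned by `anti α`, a product of Vandermonde determinants up to sign.
Hence `anti α` generates an irreducible representation `antiRep α`, with character `chiPlus α`,
which occurs once in the induced sign character. Any other constituent has larger `b`, since a copy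
in degree `posSum α` would contain `anti α`. This gives existence and uniqueness
(`isChiPlus_chiPlus`, `IsChiPlus.eq_chiPlus`).

The involution representation. For an involution `w` and a simple reflection with root `a`, the two
descent conditions together say that `w a = -a` (`commute_and_len_lt_iff`). The action is therefore
the monomial one in which `g` sends `a_w` to `a_{g w g⁻¹}` up to the sign `kap g w`, the parity of
the number of positive roots negated by `w` that `g` makes negative. This sign is a cocycle
(`kap_mul`).

Upper bound. Elements of the class of `σ = s_1 s_3 ⋯ s_{n-1}` are perfect matchings with signed
edges, the product of the signs being `1`. The sum of all `a_w` with the edges of `σ` generates the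
representation and is semi-invariant under the group preserving these edges and the parity of
vertices. Vectors with the same semi-invariance depend on at most one coefficient for each conjugacy
class of `𝔖_m`, so the commutant has dimension at most the number of partitions of `m`
(`finrank_commutant_le`).

Lower bound. A monomial pairs to a sign with every matching whose edges join exponents `2k` and `2k
+ 1`, and to zero with all others; this `pairing` is equivariant (`pairing_conj`). In the pairing of
`anti α` with `σ` every nonzero term is `1`, so each `chiPlus α` occurs. These characters are
distinct, and the bound forces the representation to be their sum (`sigmaRep_character`).

The signs. On `θ(C₀)` the product of edge signs is `-1`, and the terms of the pairing with `anti α`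
cancel under right multiplication by `σ` (`pairing_anti_eq_zero`). Consequently no `chiPlus α ∘ θ`
equals a `chiPlus β` (`comp_theta_ne`), which fixes every sign. -/

namespace TypeD

set_option linter.unusedSectionVars false

/-! ### Characters of finite groups: orthogonality and decomposition into irreducibles -/

section Characters

open Representation

variable {G : Type} [Group G] [Fintype G]

/-- The standard pairing of functions on a finite group. -/
noncomputable def ip (f g : G → ℂ) : ℂ := (Nat.card G : ℂ)⁻¹ * ∑ x : G, f x * g x⁻¹

lemma ip_comm (f g : G → ℂ) : ip f g = ip g f := by
  unfold ip
  congr 1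
  exact Fintype.sum_equiv (Equiv.inv G) _ _ fun x => by simp [mul_comm]

lemma ip_add_left (f g h : G → ℂ) : ip (f + g) h = ip f h + ip g h := by
  simp [ip, add_mul, Finset.sum_add_distrib, mul_add]

lemma ip_zero_left (h : G → ℂ) : ip 0 h = 0 := by
  simp [ip]

lemma card_ne_zero : (Nat.card G : ℂ) ≠ 0 := by
  simp [Nat.card_eq_fintype_card]

section Hom

variable {V W : Type*} [AddCommGroup V] [Module ℂ V] [FiniteDimensional ℂ V]
  [AddCommGroup W] [Module ℂ W] [FiniteDimensional ℂ W]
  (ρ : Representation ℂ G V) (σ : Representation ℂ G W)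

lemma ip_character :
    ip σ.character ρ.character = Module.finrank ℂ (IntertwiningMap ρ σ) := by
  have : Invertible (Nat.card G : ℂ) := invertibleOfNonzero card_ne_zero
  exact card_inv_mul_sum_char_mul_char_eq_finrank ρ σ

lemma exists_hom_of_ip_ne_zero (h : ip σ.character ρ.character ≠ 0) :
    ∃ f : IntertwiningMap ρ σ, f ≠ 0 := by
  by_contra! hf
  apply h
  have : Subsingleton (IntertwiningMap ρ σ) := ⟨fun a b => by rw [hf a, hf b]⟩
  rw [ip_character, Module.finrank_zero_of_subsingleton, Nat.cast_zero]

lemma ip_ne_zero_of_hom (f : IntertwiningMap ρ σ) (hf : f ≠ 0) :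
    ip σ.character ρ.character ≠ 0 := by
  rw [ip_character, Nat.cast_ne_zero]
  intro h
  have := Module.finrank_zero_iff.mp h
  exact hf (Subsingleton.elim _ _)

end Hom

open Classical in
lemma IsIrr.ip_eq {χ ψ : G → ℂ} (hχ : IsIrr χ) (hψ : IsIrr ψ) :
    ip χ ψ = if χ = ψ then 1 else 0 := by
  have : Invertible (Nat.card G : ℂ) := invertibleOfNonzero card_ne_zero
  obtain ⟨V, _, _, _, ρ, hρ, rfl⟩ := hχ
  obtain ⟨W, _, _, _, σ, hσ, rfl⟩ := hψ
  split_ifs with h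
  · rw [← h, ip_character, IsIrreducible.finrank_intertwiningMap_self, Nat.cast_one]
  · have := char_orthonormal ρ σ
    rw [if_neg] at this
    · exact this
    · rintro ⟨e⟩
      exact h (char_iso e).symm

open Classical in
lemma ip_multiset_sum (M : Multiset (G → ℂ)) (hM : ∀ ψ ∈ M, IsIrr ψ) {χ : G → ℂ} (hχ : IsIrr χ) :
    ip M.sum χ = M.count χ := by
  induction M using Multiset.induction_on with
  | empty => simp [ip_zero_left]
  | cons ψ M ih =>
    rw [Multiset.sum_cons, ip_add_left, ih fun φ hφ => hM φ (Multiset.mem_cons_of_mem hφ),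
      (hM ψ (Multiset.mem_cons_self _ _)).ip_eq hχ, Multiset.count_cons]
    by_cases h : ψ = χ
    · simp [h, add_comm]
    · simp [h, Ne.symm h]

/-- Orthogonality recovers multiplicities. This turns equalities of characters into equalities of
multisets, both for the uniqueness of `χ^{α,+1}` and for the signs. -/
lemma eq_of_multiset_sum_eq {M N : Multiset (G → ℂ)} (hM : ∀ ψ ∈ M, IsIrr ψ)
    (hN : ∀ ψ ∈ N, IsIrr ψ) (h : M.sum = N.sum) : M = N := by
  classical
  ext χ
  by_cases hχ : IsIrr χ
  · have h1 := ip_multiset_sum M hM hχ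
    rw [h, ip_multiset_sum N hN hχ] at h1
    exact_mod_cast h1.symm
  · rw [Multiset.count_eq_zero_of_notMem fun h' => hχ (hM _ h'),
      Multiset.count_eq_zero_of_notMem fun h' => hχ (hN _ h')]

lemma character_eq_add_of_isCompl {V : Type*} [AddCommGroup V] [Module ℂ V]
    [FiniteDimensional ℂ V] (ρ : Representation ℂ G V) (U U' : Subrepresentation ρ)
    (h : IsCompl U.toSubmodule U'.toSubmodule) :
    ρ.character = U.toRepresentation.character + U'.toRepresentation.character := by
  ext g
  simp only [Pi.add_apply, Representation.character]
  rw [← LinearMap.trace_prodMap',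
    ← LinearMap.trace_conj' _ (Submodule.prodEquivOfIsCompl _ _ h)]
  congr 1
  ext v
  obtain ⟨p, rfl⟩ := (Submodule.prodEquivOfIsCompl _ _ h).surjective v
  rw [LinearEquiv.conj_apply]
  simp [Subrepresentation.toRepresentation]

lemma isCompl_toSubmodule {V : Type*} [AddCommGroup V] [Module ℂ V]
    {ρ : Representation ℂ G V} {U U' : Subrepresentation ρ} (h : IsCompl U U') :
    IsCompl U.toSubmodule U'.toSubmodule := by
  constructor
  · rw [disjoint_iff]
    exact congrArg Subrepresentation.toSubmodule (disjoint_iff.mp h.1)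
  · rw [codisjoint_iff]
    exact congrArg Subrepresentation.toSubmodule (codisjoint_iff.mp h.2)

/-- Maschke's theorem, by induction on the dimension. -/
lemma exists_multiset_character (n : ℕ) : ∀ (V : Type) [AddCommGroup V] [Module ℂ V]
    [FiniteDimensional ℂ V] (ρ : Representation ℂ G V), Module.finrank ℂ V = n →
    ∃ M : Multiset (G → ℂ), (∀ ψ ∈ M, IsIrr ψ) ∧ M.sum = ρ.character := by
  induction n using Nat.strong_induction_on with
  | _ n ih =>
  intro V _ _ _ ρ hn
  have : NeZero (Nat.card G : ℂ) := ⟨card_ne_zero⟩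
  by_cases hirr : ρ.IsIrreducible
  · exact ⟨{ρ.character}, by simpa using ⟨V, _, _, inferInstance, ρ, hirr, rfl⟩, by simp⟩
  by_cases hV : Subsingleton V
  · refine ⟨0, by simp, ?_⟩
    ext g
    rw [Representation.character, Subsingleton.elim (ρ g) 0]
    simp
  · have hnt : Nontrivial (Subrepresentation ρ) := by
      refine ⟨⊥, ⊤, fun h => hV ?_⟩
      have h' : (⊥ : Submodule ℂ V) = ⊤ := congrArg Subrepresentation.toSubmodule h
      exact (Submodule.subsingleton_iff ℂ).mp (subsingleton_of_bot_eq_top h')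
    obtain ⟨U, hU0, hU1⟩ : ∃ U : Subrepresentation ρ, U ≠ ⊥ ∧ U ≠ ⊤ := by
      by_contra! h
      exact hirr ⟨fun U => or_iff_not_imp_left.mpr (h U)⟩
    obtain ⟨U', hU'⟩ := exists_isCompl U
    have hc := isCompl_toSubmodule hU'
    have hlt : ∀ X : Subrepresentation ρ, X ≠ ⊤ → Module.finrank ℂ X.toSubmodule < n := by
      intro X hX
      rw [← hn]
      refine Submodule.finrank_lt fun h => hX ?_
      exact Subrepresentation.toSubmodule_injective h
    have hU'1 : U' ≠ ⊤ := by
      rintro rfl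
      exact hU0 (by simpa using hU'.1.eq_bot)
    obtain ⟨M, hM, hMs⟩ := ih _ (hlt U hU1) U.toSubmodule U.toRepresentation rfl
    obtain ⟨M', hM', hMs'⟩ := ih _ (hlt U' hU'1) U'.toSubmodule U'.toRepresentation rfl
    refine ⟨M + M', fun ψ hψ => ?_, ?_⟩
    · rcases Multiset.mem_add.mp hψ with h | h
      exacts [hM _ h, hM' _ h]
    · rw [Multiset.sum_add, hMs, hMs', character_eq_add_of_isCompl ρ U U' hc]

/-- A representation whose commutant has dimension at most the number of given distinct
irreducible constituents is the sum of these constituents. -/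
lemma character_eq_sum_of_finrank_le {V : Type} [AddCommGroup V] [Module ℂ V]
    [FiniteDimensional ℂ V] (ρ : Representation ℂ G V) {ι : Type*} [Fintype ι]
    (χ : ι → G → ℂ) (hχ : ∀ i, IsIrr (χ i)) (hinj : Function.Injective χ)
    (hne : ∀ i, ip ρ.character (χ i) ≠ 0)
    (hle : Module.finrank ℂ (IntertwiningMap ρ ρ) ≤ Fintype.card ι) :
    ρ.character = ∑ i, χ i := by
  classical
  obtain ⟨M, hM, hMs⟩ := exists_multiset_character _ V ρ rfl
  -- A constituent of multiplicity `k` appears `k` times in `M` and contributes `k` each time, so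
  -- the sum is that of the squared multiplicities, the dimension of the commutant.
  have h1 : (M.map fun ψ => M.count ψ).sum ≤ Fintype.card ι := by
    have : ((M.map fun ψ => M.count ψ).sum : ℂ) = ip ρ.character ρ.character := by
      conv_rhs => rw [ip_comm, ← hMs]
      have key : ∀ N : Multiset (G → ℂ), (∀ ψ ∈ N, IsIrr ψ) →
          (((N.map fun ψ => M.count ψ).sum : ℕ) : ℂ) = ip N.sum M.sum := by
        intro N
        induction N using Multiset.induction_on with
        | empty => simp [ip_zero_left]
        | cons ψ N ih =>
          intro hN
          rw [Multiset.map_cons, Multiset.sum_cons, Multiset.sum_cons, ip_add_left, Nat.cast_add,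
            ih fun φ hφ => hN φ (Multiset.mem_cons_of_mem hφ), ip_comm ψ,
            ip_multiset_sum M hM (hN ψ (Multiset.mem_cons_self _ _))]
      exact_mod_cast key M hM
    rw [ip_character] at this
    have h2 : (M.map fun ψ => M.count ψ).sum = Module.finrank ℂ (IntertwiningMap ρ ρ) := by
      exact_mod_cast this
    omega
  have h2 : M.card ≤ (M.map fun ψ => M.count ψ).sum := by
    have : (M.map fun _ => 1).sum ≤ (M.map fun ψ => M.count ψ).sum :=
      Multiset.sum_map_le_sum_map _ _ fun ψ hψ => Multiset.one_le_count_iff_mem.mpr hψ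
    simpa using this
  have h3 : (Finset.univ.val.map χ) ≤ M := by
    refine (Multiset.le_iff_subset (Multiset.Nodup.map hinj Finset.univ.nodup)).mpr fun ψ hψ => ?_
    obtain ⟨i, -, rfl⟩ := Multiset.mem_map.mp hψ
    by_contra h
    apply hne i
    rw [← hMs, ip_multiset_sum M hM (hχ i), Multiset.count_eq_zero_of_notMem h, Nat.cast_zero]
  -- The given constituents form a submultiset of `M`, and `M` has at most as many members as there
  -- are indices.
  have h4 : Finset.univ.val.map χ = M := by
    refine Multiset.eq_of_le_of_card_le h3 ?_
    simpa using h2.trans h1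
  rw [← hMs, ← h4]
  rfl

end Characters

/-! ### Semi-invariant vectors, induced linear characters and Frobenius reciprocity -/

section Induction

open Representation

variable {G : Type} [Group G] [Fintype G] (H : Subgroup G) (lam : H →* ℂˣ)

/-- The one-dimensional representation attached to a linear character. -/
noncomputable def linRep : Representation ℂ H ℂ where
  toFun h := (lam h : ℂ) • LinearMap.id
  map_one' := by simp; rfl
  map_mul' a b := by ext; simp [mul_comm]

lemma linRep_character : (linRep H lam).character = fun h => (lam h : ℂ) := by
  ext h
  simp [Representation.character, linRep]

/-- Restriction of a representation to a subgroup. -/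
abbrev resRep {V : Type*} [AddCommGroup V] [Module ℂ V] (ρ : Representation ℂ G V) :
    Representation ℂ H V := ρ.comp H.subtype

variable {V : Type*} [AddCommGroup V] [Module ℂ V] (ρ : Representation ℂ G V)

/-- A vector of a representation of `G` on which the subgroup `H` acts through `lam`. -/
def IsSemiInv (v : V) : Prop := ∀ h : H, ρ h v = (lam h : ℂ) • v

variable {H lam ρ} in
lemma IsSemiInv.map {W : Type*} [AddCommGroup W] [Module ℂ W] {σ : Representation ℂ G W}
    {v : V} (hv : IsSemiInv H lam ρ v) (f : IntertwiningMap ρ σ) : IsSemiInv H lam σ (f v) := by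
  intro h
  rw [← f.isIntertwining, hv h, map_smul]

/-- The intertwining map from a linear character given by a semi-invariant vector. -/
noncomputable def semiInvHom (v : V) (hv : IsSemiInv H lam ρ v) :
    IntertwiningMap (linRep H lam) (resRep H ρ) where
  toLinearMap := LinearMap.toSpanSingleton ℂ V v
  isIntertwining' h := by
    ext
    simpa [linRep] using (hv h).symm

lemma isSemiInv_hom (f : IntertwiningMap (linRep H lam) (resRep H ρ)) :
    IsSemiInv H lam ρ (f 1) := by
  intro h
  have := LinearMap.congr_fun (f.isIntertwining' h) 1
  simp only [linRep, MonoidHom.coe_mk, OneHom.coe_mk, LinearMap.smul_apply, LinearMap.id_apply,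
    LinearMap.comp_apply, map_smul] at this
  exact this.symm

variable [Fintype H]

/-- The pairing is the dimension of the space of maps from the linear character, and such a map is
determined by the image of `1`, a semi-invariant vector. -/
lemma ip_lam_ne_zero_iff [FiniteDimensional ℂ V] :
    ip (fun h : H => ρ.character h) (fun h => (lam h : ℂ)) ≠ 0 ↔
      ∃ v, v ≠ 0 ∧ IsSemiInv H lam ρ v := by
  have hc : (fun h : H => ρ.character h) = (resRep H ρ).character := rfl
  rw [hc, ← linRep_character]
  constructor
  · intro h
    obtain ⟨f, hf⟩ := exists_hom_of_ip_ne_zero _ _ h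
    refine ⟨f 1, fun h0 => hf ?_, isSemiInv_hom H lam ρ f⟩
    ext
    simpa using h0
  · rintro ⟨v, hv0, hv⟩
    refine ip_ne_zero_of_hom _ _ (semiInvHom H lam ρ v hv) fun h => hv0 ?_
    have : semiInvHom H lam ρ v hv 1 = 0 := by rw [h]; rfl
    simpa [semiInvHom] using this

lemma ip_lam_eq_one [FiniteDimensional ℂ V] (v : V) (hv0 : v ≠ 0) (hv : IsSemiInv H lam ρ v)
    (huniq : ∀ w, IsSemiInv H lam ρ w → ∃ c : ℂ, w = c • v) :
    ip (fun h : H => ρ.character h) (fun h => (lam h : ℂ)) = 1 := by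
  have hc : (fun h : H => ρ.character h) = (resRep H ρ).character := rfl
  rw [hc, ← linRep_character, ip_character]
  rw [finrank_eq_one (semiInvHom H lam ρ v hv), Nat.cast_one]
  · intro h
    have : semiInvHom H lam ρ v hv 1 = 0 := by rw [h]; rfl
    exact hv0 (by simpa [semiInvHom] using this)
  · intro f
    obtain ⟨c, hc⟩ := huniq _ (isSemiInv_hom H lam ρ f)
    refine ⟨c, ?_⟩
    ext
    simpa [semiInvHom] using hc.symm

/-- Frobenius reciprocity for class functions. -/
lemma ip_ind (ψ : H → ℂ) (χ : G → ℂ) (hχ : ∀ g h, χ (h * g * h⁻¹) = χ g) :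
    ip (ind H ψ) χ = ip (fun h : H => χ h) ψ := by
  classical
  rw [ip_comm (fun h : H => χ h)]
  have key : ∀ x : G, ∑ g : G,
      (if h : x⁻¹ * g * x ∈ H then ψ ⟨x⁻¹ * g * x, h⟩ else 0) * χ g⁻¹ = ∑ h : H, ψ h * χ h⁻¹ := by
    intro x
    have h1 : ∀ g : G, (if h : x⁻¹ * g * x ∈ H then ψ ⟨x⁻¹ * g * x, h⟩ else 0) * χ g⁻¹ =
        (fun g' => (if h : g' ∈ H then ψ ⟨g', h⟩ else 0) * χ g'⁻¹)
          ((MulAut.conj x⁻¹).toEquiv g) := by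
      intro g
      have : χ (x⁻¹ * g * x)⁻¹ = χ g⁻¹ := by
        rw [← hχ g⁻¹ x⁻¹]; congr 1; group
      simp only [MulEquiv.toEquiv_eq_coe, EquivLike.coe_coe, MulAut.conj_apply, inv_inv, this]
    rw [Finset.sum_congr rfl fun g _ => h1 g, Equiv.sum_comp (MulAut.conj x⁻¹).toEquiv
      (fun g' => (if h : g' ∈ H then ψ ⟨g', h⟩ else 0) * χ g'⁻¹)]
    rw [← Finset.sum_subset (Finset.subset_univ (Finset.univ.filter (· ∈ H))),
      Finset.sum_subtype _ (p := (· ∈ H)) (by simp)]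
    · refine Finset.sum_congr rfl fun h _ => ?_
      simp
    · intro g _ hg
      rw [dif_neg (by simpa using hg), zero_mul]
  simp only [ip, ind]
  rw [Finset.sum_congr rfl fun g _ => by rw [mul_assoc, Finset.sum_mul], ← Finset.mul_sum, Finset.sum_comm, Finset.sum_congr rfl fun x _ => key x]
  simp only [Finset.sum_const, Finset.card_univ, nsmul_eq_mul, Nat.card_eq_fintype_card]
  have : (Fintype.card G : ℂ) ≠ 0 := by simp
  field_simp
  push_cast
  rfl

/-- Replaces a trace on an invariant subspace by one on the whole space, where a basis is available;
it computes the induced character through the averaging projection. -/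
lemma trace_restrict_eq {W : Type*} [AddCommGroup W] [Module ℂ W] [FiniteDimensional ℂ W]
    {U : Submodule ℂ W} {E f : W →ₗ[ℂ] W} (hE : LinearMap.IsProj U E)
    (hf : ∀ x ∈ U, f x ∈ U) :
    LinearMap.trace ℂ U (f.restrict hf) = LinearMap.trace ℂ W (f ∘ₗ E) := by
  have h1 : f ∘ₗ E = (f ∘ₗ U.subtype) ∘ₗ (E.codRestrict U hE.map_mem) := by
    ext; simp
  rw [h1, LinearMap.trace_comp_comm']
  congr 1
  ext x
  simp [hE.map_id _ (hf x x.2)]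

/-- The left regular representation on functions. -/
noncomputable def leftFun : Representation ℂ G (G → ℂ) where
  toFun g := LinearMap.funLeft ℂ ℂ fun x => g⁻¹ * x
  map_one' := by ext; simp
  map_mul' a b := by ext; simp [LinearMap.funLeft_apply, mul_assoc]

/-- The right regular representation on functions of a subgroup, twisted by a linear character. -/
noncomputable def rightFun : Representation ℂ H (G → ℂ) where
  toFun h := (lam h : ℂ) • LinearMap.funLeft ℂ ℂ fun x : G => x * (h : G)
  map_one' := by ext; simp
  map_mul' a b := by
    ext f x
    simp [LinearMap.funLeft_apply, mul_assoc, mul_left_comm]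

/-- The representation induced from a linear character. -/
noncomputable def indSub : Subrepresentation (leftFun (G := G)) where
  toSubmodule := (rightFun H lam).invariants
  apply_mem_toSubmodule g f hf h := by
    have := hf h
    ext x
    simpa [leftFun, rightFun, LinearMap.funLeft_apply, mul_assoc] using congrFun this (g⁻¹ * x)

open Classical in
lemma indSub_character :
    (indSub H lam).toRepresentation.character = ind H (fun h => (lam h : ℂ)) := by
  ext g
  have : Invertible (Fintype.card H : ℂ) := invertibleOfNonzero (by simp)
  refine (trace_restrict_eq (isProj_averageMap (rightFun H lam))
    ((indSub H lam).apply_mem_toSubmodule g)).trans ?_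
  rw [LinearMap.trace_eq_matrix_trace ℂ (Pi.basisFun ℂ G), Matrix.trace, ind, Finset.mul_sum]
  refine Finset.sum_congr rfl fun x _ => ?_
  rw [Matrix.diag_apply, LinearMap.toMatrix_apply]
  simp only [Pi.basisFun_apply, Pi.basisFun_repr, LinearMap.comp_apply, averageMap,
    GroupAlgebra.average, map_smul, map_sum]
  simp [leftFun, rightFun, LinearMap.funLeft_apply, Nat.card_eq_fintype_card, Finset.sum_apply,
    LinearMap.sum_apply]
  by_cases h : x⁻¹ * g * x ∈ H
  -- The diagonal entry at `x` receives only the `h` with `g⁻¹ x h = x`.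
  · rw [dif_pos h, Finset.sum_eq_single ⟨x⁻¹ * g * x, h⟩]
    · simp [mul_assoc]
    · intro c _ hc
      rw [Pi.single_eq_of_ne, mul_zero]
      intro h'
      apply hc
      ext
      calc (c : G) = x⁻¹ * g * (g⁻¹ * x * c) := by group
        _ = x⁻¹ * g * x := by rw [h']
    · simp
  · rw [dif_neg h, Finset.sum_eq_zero, mul_zero]
    intro c _
    rw [Pi.single_eq_of_ne, mul_zero]
    intro h'
    apply h
    have : x⁻¹ * g * x = c := by
      calc x⁻¹ * g * x = x⁻¹ * g * (g⁻¹ * x * c) := by rw [h']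
        _ = c := by group
    rw [this]
    exact c.2

lemma IsIrr.conj {χ : G → ℂ} (hχ : IsIrr χ) (g h : G) : χ (h * g * h⁻¹) = χ g := by
  obtain ⟨V, _, _, _, ρ, -, rfl⟩ := hχ
  exact char_conj ρ g h

/-- If an irreducible character occurs exactly once in an induced linear character, the latter is
the sum of this character and of other irreducible characters with semi-invariant vectors. -/
lemma exists_ind_eq_add {χ : G → ℂ} (hχ : IsIrr χ)
    (h1 : ip (fun h : H => χ h) (fun h => (lam h : ℂ)) = 1) :
    ∃ M : Multiset (G → ℂ), (∀ ψ ∈ M, IsIrr ψ ∧ ψ ≠ χ ∧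
      ip (fun h : H => ψ h) (fun h => (lam h : ℂ)) ≠ 0) ∧
      ind H (fun h => (lam h : ℂ)) = χ + M.sum := by
  classical
  obtain ⟨M, hM, hMs⟩ := exists_multiset_character _ _ (indSub H lam).toRepresentation rfl
  rw [indSub_character] at hMs
  have hcount : ∀ ψ, IsIrr ψ →
      (M.count ψ : ℂ) = ip (fun h : H => ψ h) (fun h => (lam h : ℂ)) := by
    intro ψ hψ
    rw [← ip_multiset_sum M hM hψ, hMs, ip_ind _ _ _ hψ.conj]
  have hc1 : M.count χ = 1 := by
    have := hcount χ hχ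
    rw [h1] at this
    exact_mod_cast this
  have hmem : χ ∈ M := Multiset.count_pos.mp (by omega)
  refine ⟨M.erase χ, fun ψ hψ => ?_, ?_⟩
  · have hψM := Multiset.mem_of_mem_erase hψ
    refine ⟨hM _ hψM, ?_, ?_⟩
    · rintro rfl
      have := Multiset.count_pos.mpr hψ
      rw [Multiset.count_erase_self] at this
      omega
    · rw [← hcount ψ (hM _ hψM), Nat.cast_ne_zero]
      exact (Multiset.count_pos.mpr hψM).ne'
  · rw [← hMs, ← Multiset.sum_cons, Multiset.cons_erase hmem]

end Induction

/-! ### Roots of type `D`, inversions and the length function -/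

section Roots

variable {n : ℕ}

/-- The reflection representation over the integers. -/
def act : WB n →* Module.End ℤ (Fin n → ℤ) where
  toFun g :=
    { toFun := fun v i => (g.left i : ℤ) * v (g.right⁻¹ i)
      map_add' := fun v w => by ext i; simp [mul_add]
      map_smul' := fun c v => by ext i; simp [mul_left_comm] }
  map_one' := by
    ext v i
    simp
  map_mul' a b := by
    refine LinearMap.ext fun v => funext fun i => ?_
    have h : mulAutArrow a.right b.left i = b.left (a.right⁻¹ i) := rfl
    simp [-mulAutArrow_apply_apply, h, mul_assoc]

lemma act_apply (g : WB n) (v : Fin n → ℤ) (i : Fin n) :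
    act g v i = (g.left i : ℤ) * v (g.right⁻¹ i) := rfl

lemma act_mul (g h : WB n) (v : Fin n → ℤ) : act (g * h) v = act g (act h v) := by
  rw [map_mul]; rfl

lemma act_one (v : Fin n → ℤ) : act (1 : WB n) v = v := by
  rw [map_one]; rfl

lemma act_inv_act (g : WB n) (v : Fin n → ℤ) : act g⁻¹ (act g v) = v := by
  rw [← act_mul, inv_mul_cancel, act_one]

lemma act_act_inv (g : WB n) (v : Fin n → ℤ) : act g (act g⁻¹ v) = v := by
  rw [← act_mul, mul_inv_cancel, act_one]

/-- The standard basis vectors. -/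
def ee (j : Fin n) : Fin n → ℤ := Pi.single j 1

lemma act_ee (g : WB n) (j : Fin n) :
    act g (ee j) = (g.left (g.right j) : ℤ) • ee (g.right j) := by
  ext i
  rw [act_apply, Pi.smul_apply, ee, ee, Pi.single_apply, Pi.single_apply]
  by_cases h : i = g.right j
  · subst h; simp
  · have : g.right⁻¹ i ≠ j := by
      rintro rfl; simp at h
    rw [if_neg this, if_neg h, mul_zero, smul_zero]

lemma act_injective : Function.Injective (act : WB n → Module.End ℤ (Fin n → ℤ)) := by
  intro g h hgh
  have key : ∀ j i, act g (ee j) i = act h (ee j) i := by simp [hgh]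
  have hr : g.right = h.right := by
    ext j : 1
    have := key j (g.right j)
    rw [act_ee, act_ee] at this
    by_contra hne
    simp [ee, hne] at this
  have hl : g.left = h.left := by
    ext i : 1
    have := key (g.right⁻¹ i) i
    rw [act_ee, act_ee, ← hr] at this
    exact Units.ext (by simpa [ee] using this)
  exact SemidirectProduct.ext hl hr

/-- The height function defining the positive system. -/
def ht : (Fin n → ℤ) →ₗ[ℤ] ℤ := ∑ i : Fin n, (i.val : ℤ) • LinearMap.proj i

lemma ht_apply (v : Fin n → ℤ) : ht v = ∑ i : Fin n, (i.val : ℤ) * v i := by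
  simp [ht]

lemma ht_ee (j : Fin n) : ht (ee j) = j.val := by
  simp [ht_apply, ee, Pi.single_apply]

/-- The roots of type `D_n`. -/
def IsRoot (v : Fin n → ℤ) : Prop :=
  ∃ i j : Fin n, i ≠ j ∧ ∃ a b : ℤˣ, v = (a : ℤ) • ee i + (b : ℤ) • ee j

lemma IsRoot.act {v : Fin n → ℤ} (hv : IsRoot v) (g : WB n) : IsRoot (act g v) := by
  obtain ⟨i, j, hij, a, b, rfl⟩ := hv
  refine ⟨g.right i, g.right j, by simpa using hij, a * g.left (g.right i),
    b * g.left (g.right j), ?_⟩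
  rw [map_add, map_smul, map_smul, act_ee, act_ee, smul_smul, smul_smul, Units.val_mul,
    Units.val_mul]

lemma IsRoot.neg {v : Fin n → ℤ} (hv : IsRoot v) : IsRoot (-v) := by
  obtain ⟨i, j, hij, a, b, rfl⟩ := hv
  refine ⟨i, j, hij, -a, -b, ?_⟩
  simp [add_comm]

lemma IsRoot.unit_smul {v : Fin n → ℤ} (hv : IsRoot v) (a : ℤˣ) : IsRoot ((a : ℤ) • v) := by
  rcases Int.units_eq_one_or a with rfl | rfl
  · simpa using hv
  · simpa using hv.neg

lemma IsRoot.ht_ne {v : Fin n → ℤ} (hv : IsRoot v) : ht v ≠ 0 := by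
  obtain ⟨i, j, hij, a, b, rfl⟩ := hv
  have : (i : ℕ) ≠ j := fun h => hij (Fin.ext h)
  rcases Int.units_eq_one_or a with rfl | rfl <;> rcases Int.units_eq_one_or b with rfl | rfl <;>
    simp [ht_ee] <;> omega

lemma ee_dot (i : Fin n) (v : Fin n → ℤ) : ee i ⬝ᵥ v = v i := by
  simp [ee]

lemma dot_ee (i : Fin n) (v : Fin n → ℤ) : v ⬝ᵥ ee i = v i := by
  simp [ee]

lemma IsRoot.dot_self {v : Fin n → ℤ} (hv : IsRoot v) : v ⬝ᵥ v = 2 := by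
  obtain ⟨i, j, hij, a, b, rfl⟩ := hv
  have ha : (a : ℤ) * a = 1 := by simp [← Units.val_mul]
  have hb : (b : ℤ) * b = 1 := by simp [← Units.val_mul]
  simp only [add_dotProduct, smul_dotProduct, ee_dot]
  simp [ee, hij, hij.symm, ha, hb]

/-- Roots have squared length `2`, so positivity of the squared length of `v - w` reads `4 - 2 (v ⬝ᵥ
w) > 0`. -/
lemma IsRoot.dot_le {v w : Fin n → ℤ} (hv : IsRoot v) (hw : IsRoot w) (h : v ≠ w) :
    v ⬝ᵥ w ≤ 1 := by
  have h1 : 0 < (v - w) ⬝ᵥ (v - w) := by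
    refine lt_of_le_of_ne (Finset.sum_nonneg fun i _ => mul_self_nonneg _) fun h0 => h ?_
    exact sub_eq_zero.mp (dotProduct_self_eq_zero.mp h0.symm)
  simp only [sub_dotProduct, dotProduct_sub, hv.dot_self, hw.dot_self, dotProduct_comm w v] at h1
  omega

lemma act_dot (g : WB n) (v w : Fin n → ℤ) : act g v ⬝ᵥ act g w = v ⬝ᵥ w := by
  simp only [dotProduct, act_apply]
  refine Fintype.sum_equiv g.right⁻¹ _ _ fun i => ?_
  have : (g.left i : ℤ) * g.left i = 1 := by simp [← Units.val_mul]
  linear_combination (v (g.right⁻¹ i) * w (g.right⁻¹ i)) * this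

lemma finite_isRoot : {v : Fin n → ℤ | IsRoot v}.Finite := by
  refine (Set.finite_range fun x : (Fin n × Fin n) × (ℤˣ × ℤˣ) =>
    (x.2.1 : ℤ) • ee x.1.1 + (x.2.2 : ℤ) • ee x.1.2).subset ?_
  rintro v ⟨i, j, -, a, b, rfl⟩
  exact ⟨((i, j), (a, b)), rfl⟩

/-- The positive roots. -/
noncomputable def posRoots (n : ℕ) : Finset (Fin n → ℤ) :=
  (finite_isRoot (n := n)).toFinset.filter (0 < ht ·)

lemma mem_posRoots {v : Fin n → ℤ} : v ∈ posRoots n ↔ IsRoot v ∧ 0 < ht v := by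
  simp [posRoots]

/-- The sign of a root. -/
def sg (v : Fin n → ℤ) : ℤˣ := if 0 < ht v then 1 else -1

lemma sg_of_pos {v : Fin n → ℤ} (h : 0 < ht v) : sg v = 1 := if_pos h

lemma sg_of_neg {v : Fin n → ℤ} (h : ht v < 0) : sg v = -1 := if_neg (by omega)

lemma IsRoot.sg_smul {v : Fin n → ℤ} (hv : IsRoot v) (a : ℤˣ) : sg ((a : ℤ) • v) = a * sg v := by
  rcases Int.units_eq_one_or a with rfl | rfl
  · simp
  · rcases lt_or_gt_of_ne hv.ht_ne with h | h
    · rw [sg_of_neg h, sg_of_pos (by simpa using h)]; simp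
    · rw [sg_of_pos h, sg_of_neg (by simpa using h)]; simp

lemma IsRoot.sg_smul_mem {v : Fin n → ℤ} (hv : IsRoot v) : (sg v : ℤ) • v ∈ posRoots n := by
  rw [mem_posRoots]
  refine ⟨hv.unit_smul _, ?_⟩
  rcases lt_or_gt_of_ne hv.ht_ne with h | h
  · rw [sg_of_neg h]; simpa using h
  · rw [sg_of_pos h]; simpa using h

/-- `r` is the reflection in the simple root `a`. -/
def IsSimpleRefl (r : WB n) (a : Fin n → ℤ) : Prop :=
  IsRoot a ∧ ht a = 1 ∧ ∀ v, act r v = v - (v ⬝ᵥ a) • a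

namespace IsSimpleRefl

variable {r : WB n} {a : Fin n → ℤ} (h : IsSimpleRefl r a)
include h

lemma act_self : act r a = -a := by
  rw [h.2.2, h.1.dot_self, two_smul]; abel

lemma mul_self : r * r = 1 := by
  apply act_injective
  refine LinearMap.ext fun v => ?_
  rw [act_mul, h.2.2 v, map_sub, map_smul, h.act_self, h.2.2 v, act_one]
  simp

lemma inv_eq : r⁻¹ = r := inv_eq_of_mul_eq_one_left h.mul_self

lemma mem_posRoots : a ∈ posRoots n := TypeD.mem_posRoots.mpr ⟨h.1, by rw [h.2.1]; norm_num⟩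

/-- As `ht a = 1`, the reflection lowers the height of `v` by `v ⬝ᵥ a ≤ 1`. The new height is
nonnegative, and roots never have height zero. -/
lemma act_mem {v : Fin n → ℤ} (hv : v ∈ (posRoots n).erase a) :
    act r v ∈ (posRoots n).erase a := by
  rw [Finset.mem_erase, TypeD.mem_posRoots] at hv ⊢
  obtain ⟨hne, hr, hpos⟩ := hv
  refine ⟨?_, hr.act r, ?_⟩
  · intro h'
    have : v = -a := by
      rw [← h.act_self, ← h', ← act_mul, h.mul_self, act_one]
    rw [this, map_neg, h.2.1] at hpos
    omega
  · have h1 := hr.dot_le h.1 hne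
    have h2 := (hr.act r).ht_ne
    rw [h.2.2, map_sub, map_smul, h.2.1, smul_eq_mul] at h2 ⊢
    omega

end IsSimpleRefl

/-- The number of inversions of `g⁻¹`. -/
noncomputable def invCount (g : WB n) : ℕ := ((posRoots n).filter (fun v => ht (act g⁻¹ v) < 0)).card

/-- The reflection permutes the positive roots other than `a`, so only the contribution of `a`
changes. -/
lemma invCount_mul {r : WB n} {a : Fin n → ℤ} (h : IsSimpleRefl r a) (g : WB n) :
    (0 < ht (act g⁻¹ a) → invCount (r * g) = invCount g + 1) ∧
    (ht (act g⁻¹ a) < 0 → invCount (r * g) + 1 = invCount g) := by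
  classical
  have hP : posRoots n = insert a ((posRoots n).erase a) :=
    (Finset.insert_erase h.mem_posRoots).symm
  have key : (((posRoots n).erase a).filter (fun v => ht (act (r * g)⁻¹ v) < 0)).card =
      (((posRoots n).erase a).filter (fun v => ht (act g⁻¹ v) < 0)).card := by
    refine Finset.card_nbij' (act r) (act r) ?_ ?_ ?_ ?_
    · intro v hv
      rw [Finset.mem_coe, Finset.mem_filter] at hv ⊢
      refine ⟨h.act_mem hv.1, ?_⟩
      have := hv.2
      rwa [mul_inv_rev, h.inv_eq, act_mul] at this
    · intro v hv
      rw [Finset.mem_coe, Finset.mem_filter] at hv ⊢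
      refine ⟨h.act_mem hv.1, ?_⟩
      rw [mul_inv_rev, h.inv_eq, act_mul, ← act_mul r, h.mul_self, act_one]
      exact hv.2
    · intro v _
      rw [← act_mul, h.mul_self, act_one]
    · intro v _
      rw [← act_mul, h.mul_self, act_one]
  have hra : ht (act (r * g)⁻¹ a) = - ht (act g⁻¹ a) := by
    rw [mul_inv_rev, h.inv_eq, act_mul, h.act_self, map_neg, map_neg]
  have hna : ∀ x : WB n, a ∉ ((posRoots n).erase a).filter (fun v => ht (act x⁻¹ v) < 0) := by
    intro x; simp
  unfold invCount
  rw [hP, Finset.filter_insert, Finset.filter_insert, hra]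
  constructor
  · intro h0
    rw [if_pos (by omega), if_neg (by omega), Finset.card_insert_of_notMem (hna (r * g)), key]
  · intro h0
    rw [if_neg (by omega), if_pos (by omega), Finset.card_insert_of_notMem (hna g), key]

/-- The coordinate whose sign `t` changes has weight `0`. Hence `t` preserves positivity, and
everything defined through `ht` is compatible with `theta`. -/
lemma ht_act_t (v : Fin n → ℤ) : ht (act (t n) v) = ht v := by
  simp only [ht_apply, act_apply]
  refine Finset.sum_congr rfl fun i _ => ?_
  by_cases h : i.val = 0 <;> simp [t, h]

lemma isSimpleRefl_s (i : ℕ) (h : i + 1 < n) :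
    IsSimpleRefl (s i h : WB n) (ee ⟨i + 1, h⟩ - ee ⟨i, by omega⟩) := by
  have hne : (⟨i + 1, h⟩ : Fin n) ≠ ⟨i, by omega⟩ := by simp
  refine ⟨⟨⟨i + 1, h⟩, ⟨i, by omega⟩, hne, 1, -1, by simp [sub_eq_add_neg]⟩, ?_, fun v => ?_⟩
  · rw [map_sub, ht_ee, ht_ee]; simp
  · ext k
    rw [act_apply, dotProduct_sub, dot_ee, dot_ee]
    simp only [s, Pi.one_apply, Units.val_one, one_mul, Equiv.swap_inv, Pi.sub_apply,
      Pi.smul_apply, ee, Pi.single_apply, smul_eq_mul]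
    by_cases h1 : k = ⟨i, by omega⟩
    · subst h1; simp
    · by_cases h2 : k = ⟨i + 1, h⟩
      · subst h2; simp
      · rw [Equiv.swap_apply_of_ne_of_ne h1 h2]; simp [h1, h2]

lemma IsSimpleRefl.conj_t {r : WB n} {a : Fin n → ℤ} (h : IsSimpleRefl r a) :
    IsSimpleRefl (t n * r * (t n)⁻¹) (act (t n) a) := by
  refine ⟨h.1.act _, by rw [ht_act_t, h.2.1], fun v => ?_⟩
  rw [act_mul, act_mul, h.2.2, map_sub, act_act_inv, map_smul]
  congr 2
  rw [← act_dot (t n), act_act_inv]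

lemma coe_theta (w : WD n) : (theta n w : WB n) = t n * w * (t n)⁻¹ := rfl

lemma exists_isSimpleRefl {r : WD n} (hr : r ∈ simple n) :
    ∃ a, IsSimpleRefl (r : WB n) a := by
  rcases hr with ⟨h, rfl⟩ | ⟨i, h, rfl⟩
  · exact ⟨_, (isSimpleRefl_s 0 h).conj_t⟩
  · exact ⟨_, isSimpleRefl_s i h⟩

lemma simple_mul_self {r : WD n} (hr : r ∈ simple n) : r * r = 1 := by
  obtain ⟨a, ha⟩ := exists_isSimpleRefl hr
  exact Subtype.ext ha.mul_self

/-- Only the identity keeps all simple roots positive. The roots `e_{i+1} - e_i` make the heights of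
the `g e_i` strictly increasing, and `e_0 + e_1` bounds the start of the chain. -/
lemma eq_one_of_ht_pos (hn : 1 < n) (g : WD n)
    (h : ∀ r ∈ simple n, ∀ a, IsSimpleRefl (r : WB n) a → 0 < ht (act (g : WB n) a)) : g = 1 := by
  set w : WB n := (g : WB n) with hw
  have h1 : ∀ i (hi : i + 1 < n),
      ht (act w (ee ⟨i, by omega⟩)) < ht (act w (ee ⟨i + 1, hi⟩)) := by
    intro i hi
    have := h _ (Or.inr ⟨i, hi, rfl⟩) _ (isSimpleRefl_s i hi)
    rw [map_sub, map_sub] at this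
    omega
  have h0 : 0 < ht (act w (ee ⟨0, by omega⟩)) + ht (act w (ee ⟨1, hn⟩)) := by
    have := h _ (Or.inl ⟨hn, rfl⟩) _ (isSimpleRefl_s 0 hn).conj_t
    have e0 : act (t n) (ee ⟨0, by omega⟩) = - ee ⟨0, by omega⟩ := by
      rw [act_ee]; simp [t]
    have e1 : act (t n) (ee ⟨0 + 1, hn⟩) = ee ⟨1, hn⟩ := by
      rw [act_ee]; simp [t]
    rw [map_sub, e0, e1, map_sub, map_neg, sub_neg_eq_add, map_add] at this
    omega
  -- For `i = 0`: of two integers with positive sum the larger one is at least `1`.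
  have h2 : ∀ i (hi : i + 1 < n), (i : ℤ) + 1 ≤ ht (act w (ee ⟨i + 1, hi⟩)) := by
    intro i
    induction i with
    | zero =>
      intro hi
      have := h1 0 hi
      simp only [zero_add, Nat.cast_zero] at this ⊢
      omega
    | succ i ih =>
      intro hi
      have := ih (by omega)
      have := h1 (i + 1) hi
      push_cast
      omega
  have h3 : ∀ i : Fin n, ht (act w (ee i)) = (w.left (w.right i) : ℤ) * (w.right i).val := by
    intro i
    rw [act_ee, map_smul, ht_ee, smul_eq_mul]
  have h4 : ∀ i : Fin n, i.val ≤ (w.right i).val ∧ (i.val ≠ 0 → w.left (w.right i) = 1) := by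
    rintro ⟨i, hi⟩
    cases i with
    | zero => simp
    | succ i =>
      have := h2 i hi
      rw [h3] at this
      rcases Int.units_eq_one_or (w.left (w.right ⟨i + 1, hi⟩)) with h' | h'
      · rw [h'] at this ⊢
        simp only [Units.val_one, one_mul] at this
        exact ⟨by simpa using (by omega : i + 1 ≤ (w.right ⟨i + 1, hi⟩).val), fun _ => rfl⟩
      · rw [h'] at this
        simp only [Units.val_neg, Units.val_one] at this
        omega
  have hr : w.right = 1 := by
    ext i
    -- A permutation that lowers no index is the identity, by comparing sums.
    have hs : ∑ i : Fin n, (i : ℕ) = ∑ i : Fin n, (w.right i : ℕ) :=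
      (Equiv.sum_comp w.right fun i : Fin n => (i : ℕ)).symm
    exact ((Finset.sum_eq_sum_iff_of_le fun i _ => (h4 i).1).mp hs i (Finset.mem_univ _)).symm
  have hl : ∀ i : Fin n, i.val ≠ 0 → w.left i = 1 := by
    intro i hi
    have := (h4 i).2 hi
    rwa [hr] at this
  -- Heights do not see coordinate `0`; its sign is forced by the even number of sign changes.
  have hl0 : w.left ⟨0, by omega⟩ = 1 := by
    have : signProd n w = 1 := g.2
    change ∏ i, w.left i = 1 at this
    rwa [Finset.prod_eq_single ⟨0, by omega⟩ (fun i _ hi => hl i fun h' => hi (Fin.ext h'))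
      (by simp)] at this
  apply Subtype.ext
  rw [← hw]
  refine SemidirectProduct.ext ?_ hr
  ext i : 1
  by_cases hi : i.val = 0
  · have : i = ⟨0, by omega⟩ := Fin.ext hi
    rw [this, hl0]; rfl
  · rw [hl i hi]; rfl

lemma invCount_one : invCount (1 : WB n) = 0 := by
  unfold invCount
  rw [Finset.card_eq_zero, Finset.filter_eq_empty_iff]
  intro v hv
  rw [inv_one, act_one]
  have := (mem_posRoots.mp hv).2
  omega

lemma exists_reduced (hn : 1 < n) (w : WD n) :
    ∃ l : List (WD n), (∀ x ∈ l, x ∈ simple n) ∧ l.prod = w ∧ l.length = invCount (w : WB n) := by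
  obtain ⟨k, hk⟩ : ∃ k, invCount (w : WB n) = k := ⟨_, rfl⟩
  induction k using Nat.strong_induction_on generalizing w with
  | _ k ih =>
  by_cases hw : w = 1
  · subst hw
    exact ⟨[], by simp, by simp, by simp [invCount_one]⟩
  · have : ∃ r ∈ simple n, ∃ a, IsSimpleRefl (r : WB n) a ∧ ht (act (w : WB n)⁻¹ a) < 0 := by
      by_contra! hcon
      apply hw
      have := eq_one_of_ht_pos hn w⁻¹ fun r hr a ha =>
        lt_of_le_of_ne (hcon r hr a ha) (ha.1.act _).ht_ne.symm
      exact inv_eq_one.mp this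
    obtain ⟨r, hr, a, ha, hneg⟩ := this
    have h1 := (invCount_mul ha (w : WB n)).2 hneg
    obtain ⟨l, hl, hlp, hll⟩ := ih (invCount ((r * w : WD n) : WB n))
      (by rw [Subgroup.coe_mul]; omega) (r * w) rfl
    refine ⟨r :: l, ?_, ?_, ?_⟩
    · intro x hx
      rcases List.mem_cons.mp hx with rfl | hx
      exacts [hr, hl x hx]
    · rw [List.prod_cons, hlp, ← mul_assoc, simple_mul_self hr, one_mul]
    · rw [List.length_cons, hll, Subgroup.coe_mul, h1]

lemma invCount_list_prod_le (l : List (WD n)) (hl : ∀ x ∈ l, x ∈ simple n) :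
    invCount (l.prod : WB n) ≤ l.length := by
  induction l with
  | nil => simp [invCount_one]
  | cons r l ih =>
    have := ih fun x hx => hl x (List.mem_cons_of_mem _ hx)
    obtain ⟨a, ha⟩ := exists_isSimpleRefl (hl r List.mem_cons_self)
    have h1 := invCount_mul ha (l.prod : WB n)
    rw [List.prod_cons, List.length_cons, Subgroup.coe_mul]
    rcases lt_or_gt_of_ne (ha.1.act (l.prod : WB n)⁻¹).ht_ne with h | h
    · have := h1.2 h; omega
    · have := h1.1 h; omega

/-- The length of an element is its number of inversions. -/
lemma len_eq (hn : 1 < n) (w : WD n) : len w = invCount (w : WB n) := by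
  apply le_antisymm
  · exact Nat.sInf_le (exists_reduced hn w)
  · obtain ⟨l, hl, hp, hlen⟩ := Nat.sInf_mem (s := {k | ∃ l : List (WD n),
      (∀ x ∈ l, x ∈ simple n) ∧ l.prod = w ∧ l.length = k}) ⟨_, exists_reduced hn w⟩
    have := invCount_list_prod_le l hl
    rw [hp] at this
    unfold len
    omega

lemma closure_simple (hn : 1 < n) : Subgroup.closure (simple n) = ⊤ := by
  rw [eq_top_iff]
  intro w _
  obtain ⟨l, hl, rfl, -⟩ := exists_reduced hn w
  exact Subgroup.list_prod_mem _ fun x hx => Subgroup.subset_closure (hl x hx)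

lemma len_mul_lt_iff (hn : 1 < n) {r : WD n} {a : Fin n → ℤ} (h : IsSimpleRefl (r : WB n) a)
    (w : WD n) : len (r * w) < len w ↔ ht (act (w : WB n)⁻¹ a) < 0 := by
  rw [len_eq hn, len_eq hn, Subgroup.coe_mul]
  have h1 := invCount_mul h (w : WB n)
  rcases lt_or_gt_of_ne (h.1.act (w : WB n)⁻¹).ht_ne with h' | h'
  · have := h1.2 h'; simp only [h', iff_true]; omega
  · have := h1.1 h'; constructor <;> intro <;> omega

/-- The descent condition in the definition of the involution representation. -/
lemma commute_and_len_lt_iff (hn : 1 < n) {r : WD n} {a : Fin n → ℤ}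
    (h : IsSimpleRefl (r : WB n) a) (w : WD n) (hw : w * w = 1) :
    (r * w = w * r ∧ len (r * w) < len w) ↔ act (w : WB n) a = -a := by
  have hinv : (w : WB n)⁻¹ = w := by
    rw [← Subgroup.coe_inv, inv_eq_of_mul_eq_one_left hw]
  rw [len_mul_lt_iff hn h, hinv]
  constructor
  · rintro ⟨hc, hneg⟩
    set x := act (w : WB n) a with hx
    -- If `w a` were neither `a` nor `-a`, then `|x ⬝ᵥ a| ≤ 1`. But `r x = -x` paired with `x` gives
    -- `(x ⬝ᵥ a)² = 4`.
    have h1 : act (r : WB n) x = -x := by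
      rw [hx, ← act_mul, ← Subgroup.coe_mul, hc, Subgroup.coe_mul, act_mul, h.act_self, map_neg]
    have hxr : IsRoot x := h.1.act _
    by_contra hne
    have h2 := hxr.neg.dot_le h.1 fun h' => hne (by rw [← h', neg_neg])
    have h3 : x ≠ a := by
      rintro h'
      rw [h', h.2.1] at hneg
      omega
    have h4 := hxr.dot_le h.1 h3
    rw [neg_dotProduct] at h2
    rw [h.2.2] at h1
    have h5 := congrArg (x ⬝ᵥ ·) h1
    simp only [dotProduct_sub, dotProduct_smul, dotProduct_neg, hxr.dot_self, smul_eq_mul] at h5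
    nlinarith
  · intro hx
    refine ⟨?_, by rw [hx, map_neg, h.2.1]; norm_num⟩
    apply Subtype.ext
    rw [Subgroup.coe_mul, Subgroup.coe_mul]
    apply act_injective
    refine LinearMap.ext fun v => ?_
    rw [act_mul, act_mul, h.2.2, h.2.2, map_sub, map_smul, hx, ← act_dot (w : WB n) v, hx]
    simp

end Roots

/-! ### The sign cocycle and the involution representation -/

section InvolutionRep

variable {n : ℕ}

/-- The positive roots negated by `w`. -/
noncomputable def negRoots (w : WB n) : Finset (Fin n → ℤ) :=
  (posRoots n).filter fun v => act w v = -v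

lemma mem_negRoots {w : WB n} {v : Fin n → ℤ} :
    v ∈ negRoots w ↔ IsRoot v ∧ 0 < ht v ∧ act w v = -v := by
  rw [negRoots, Finset.mem_filter, mem_posRoots, and_assoc]

/-- The sign by which `g` acts on the positive roots negated by `w`. -/
noncomputable def kap (g w : WB n) : ℤˣ := ∏ v ∈ negRoots w, sg (act g v)

lemma kap_one (w : WB n) : kap 1 w = 1 :=
  Finset.prod_eq_one fun v hv => by rw [act_one, sg_of_pos (mem_negRoots.mp hv).2.1]

/-- The positive multiple of `act h v`. -/
noncomputable def posAct (h : WB n) (v : Fin n → ℤ) : Fin n → ℤ := (sg (act h v) : ℤ) • act h v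

lemma posAct_mem {h w : WB n} {v : Fin n → ℤ} (hv : v ∈ negRoots w) :
    posAct h v ∈ negRoots (h * w * h⁻¹) := by
  rw [mem_negRoots] at hv
  have h1 := mem_posRoots.mp (hv.1.act h).sg_smul_mem
  refine mem_negRoots.mpr ⟨h1.1, h1.2, ?_⟩
  rw [posAct, map_smul, act_mul, act_mul, act_inv_act, hv.2.2, map_neg, smul_neg]

lemma posAct_posAct {g h : WB n} {v : Fin n → ℤ} (hgh : g * h = 1) (hv : IsRoot v)
    (hpos : 0 < ht v) : posAct g (posAct h v) = v := by
  have hsq : ∀ a : ℤˣ, (a : ℤ) * a = 1 := fun a => by rw [← Units.val_mul]; simp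
  have h1 : act g (act h v) = v := by rw [← act_mul, hgh, act_one]
  unfold posAct
  rw [map_smul, h1, hv.sg_smul, sg_of_pos hpos, mul_one, smul_smul, hsq, one_smul]

/-- Up to sign, `h` carries the positive roots negated by `w` bijectively onto those negated by `h w
h⁻¹`. The sign of `g h v` is the sign of `h v` times that of `g` on the positive multiple of `h v`.
-/
lemma kap_mul (g h w : WB n) : kap (g * h) w = kap g (h * w * h⁻¹) * kap h w := by
  have h1 : kap g (h * w * h⁻¹) = ∏ v ∈ negRoots w, sg (act g (posAct h v)) := by
    refine (Finset.prod_nbij' (posAct h) (posAct h⁻¹) (fun v hv => posAct_mem hv) ?_ ?_ ?_ ?_).symm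
    · intro v hv
      have := posAct_mem (h := h⁻¹) hv
      rwa [show h⁻¹ * (h * w * h⁻¹) * h⁻¹⁻¹ = w by group] at this
    · intro v hv
      rw [mem_negRoots] at hv
      exact posAct_posAct (inv_mul_cancel h) hv.1 hv.2.1
    · intro v hv
      rw [mem_negRoots] at hv
      exact posAct_posAct (mul_inv_cancel h) hv.1 hv.2.1
    · intro v _; rfl
  rw [h1, kap, kap, ← Finset.prod_mul_distrib]
  refine Finset.prod_congr rfl fun v hv => ?_
  rw [posAct, map_smul, (((mem_negRoots.mp hv).1.act h).act g).sg_smul, act_mul, mul_right_comm,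
    Int.units_mul_self, one_mul]

/-- A simple reflection makes only its own root negative, so the sign records whether that root is
among those negated by `w`. -/
lemma kap_simple {r : WB n} {a : Fin n → ℤ} (h : IsSimpleRefl r a) (w : WB n) :
    kap r w = if act w a = -a then -1 else 1 := by
  have h1 : ∀ v ∈ negRoots w, v ≠ a → sg (act r v) = 1 := by
    intro v hv hva
    have := h.act_mem (Finset.mem_erase.mpr ⟨hva, (Finset.mem_filter.mp hv).1⟩)
    exact sg_of_pos (mem_posRoots.mp (Finset.mem_erase.mp this).2).2
  split_ifs with hw
  · rw [kap, Finset.prod_eq_single a h1]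
    · rw [h.act_self, sg_of_neg]
      rw [map_neg, h.2.1]; norm_num
    · intro ha
      exact absurd (mem_negRoots.mpr ⟨h.1, by rw [h.2.1]; norm_num, hw⟩) ha
  · refine Finset.prod_eq_one fun v hv => h1 v hv ?_
    rintro rfl
    exact hw (mem_negRoots.mp hv).2.2

lemma kap_conj_t (g w : WB n) : kap (t n * g * (t n)⁻¹) (t n * w * (t n)⁻¹) = kap g w := by
  have h1 : ∀ x : WB n, kap (t n) x = 1 := fun x =>
    Finset.prod_eq_one fun v hv => sg_of_pos (by rw [ht_act_t]; exact (mem_negRoots.mp hv).2.1)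
  have h2 : ∀ x : WB n, kap (t n)⁻¹ x = 1 := fun x =>
    Finset.prod_eq_one fun v hv => sg_of_pos (by
      rw [← ht_act_t, act_act_inv]; exact (mem_negRoots.mp hv).2.1)
  rw [kap_mul, h2, kap_mul, h1, one_mul, mul_one]
  congr 1
  group

variable (k : Type) [CommRing k] (C : Set (WD n)) (hC : ∀ g w, w ∈ C → g * w * g⁻¹ ∈ C)

/-- The involution representation attached to a union of conjugacy classes. -/
noncomputable def invRep : Representation k (WD n) (C →₀ k) where
  toFun g := Finsupp.linearCombination k fun w : C =>
    (((kap (g : WB n) (w.1 : WB n) : ℤˣ) : ℤ) : k) •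
      Finsupp.single (⟨g * w.1 * g⁻¹, hC g w.1 w.2⟩ : C) (1 : k)
  map_one' := by
    ext w : 2
    simp [kap_one]
  map_mul' a b := by
    ext w : 2
    simp only [LinearMap.comp_apply, Finsupp.lsingle_apply, Module.End.mul_apply,
      Finsupp.linearCombination_single, map_smul, smul_smul]
    have : (kap ((a * b : WD n) : WB n) (w.1 : WB n)) =
        kap (a : WB n) ((b * w.1 * b⁻¹ : WD n) : WB n) * kap (b : WB n) (w.1 : WB n) := by
      rw [Subgroup.coe_mul, kap_mul]; rfl
    rw [this]
    congr 1
    · push_cast; ring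
    · congr 2; group

lemma invRep_single (g : WD n) (w : C) :
    invRep k C hC g (Finsupp.single w 1) = (((kap (g : WB n) (w.1 : WB n) : ℤˣ) : ℤ) : k) •
      Finsupp.single (⟨g * w.1 * g⁻¹, hC g w.1 w.2⟩ : C) (1 : k) := by
  simp [invRep]

/-- The coefficientwise form of the action; every equation for semi-invariant vectors below is read
off from it. -/
lemma invRep_apply (g : WD n) (v : C →₀ k) (w : C) :
    invRep k C hC g v ⟨g * w.1 * g⁻¹, hC g w.1 w.2⟩ =
      (((kap (g : WB n) (w.1 : WB n) : ℤˣ) : ℤ) : k) * v w := by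
  classical
  induction v using Finsupp.induction_linear with
  | zero => simp
  | add a b ha hb => rw [map_add, Finsupp.add_apply, ha, hb, Finsupp.add_apply, mul_add]
  | single x c =>
    have : Finsupp.single x c = c • Finsupp.single x (1 : k) := by simp
    rw [this, map_smul, invRep_single]
    by_cases h : x = w
    · subst h; simp [mul_comm]
    · have h' : (⟨g * x.1 * g⁻¹, hC g x.1 x.2⟩ : C) ≠ ⟨g * w.1 * g⁻¹, hC g w.1 w.2⟩ := by
        intro h'
        apply h
        ext1
        simpa using congrArg Subtype.val h'
      simp [h, h']

open Classical in
lemma invRep_character [Fintype C] (F : Type) [Field F] (g : WD n) :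
    (invRep F C hC).character g =
      ∑ w : C, if g * w.1 * g⁻¹ = w.1 then (((kap (g : WB n) (w.1 : WB n) : ℤˣ) : ℤ) : F) else 0 := by
  rw [Representation.character, LinearMap.trace_eq_matrix_trace F Finsupp.basisSingleOne,
    Matrix.trace]
  refine Finset.sum_congr rfl fun w _ => ?_
  rw [Matrix.diag_apply, LinearMap.toMatrix_apply, Finsupp.coe_basisSingleOne, invRep_single]
  simp [Finsupp.single_apply, Subtype.ext_iff]

lemma invRep_character_ofReal (g : WD n) :
    (((invRep ℝ C hC).character g : ℝ) : ℂ) = (invRep ℂ C hC).character g := by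
  classical
  rw [invRep_character, invRep_character, Complex.ofReal_sum]
  refine Finset.sum_congr rfl fun w _ => ?_
  split_ifs <;> simp

lemma theta_theta (g : WD n) : theta n (theta n g) = g := by
  have ht : t n * t n = 1 := by
    apply act_injective
    refine LinearMap.ext fun v => funext fun i => ?_
    rw [act_mul, act_apply, act_apply, act_one]
    by_cases h : i.val = 0 <;> simp [t, h]
  apply Subtype.ext
  rw [coe_theta, coe_theta, show t n * (t n * (g : WB n) * (t n)⁻¹) * (t n)⁻¹ =
    (t n * t n) * g * (t n * t n)⁻¹ by group, ht]
  simp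

/-- Reindexing the trace by `theta` leaves the signs unchanged because `t` preserves positivity. The
statement on `θ(C₀)` thus follows from the one on `C₀`. -/
lemma invRep_character_theta (F : Type) [Field F]
    (hC' : ∀ g w, w ∈ theta n '' C → g * w * g⁻¹ ∈ theta n '' C) (g : WD n) :
    (invRep F (theta n '' C) hC').character g = (invRep F C hC).character (theta n g) := by
  classical
  rw [invRep_character, invRep_character]
  symm
  refine Fintype.sum_equiv (M := F) (Equiv.Set.image (theta n) C (theta n).injective) _ _
    fun w => ?_
  have h1 : (kap ((theta n g : WD n) : WB n) (w.1 : WB n)) =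
      kap (g : WB n) ((theta n w.1 : WD n) : WB n) := by
    nth_rewrite 2 [← theta_theta g]
    rw [coe_theta (theta n g), coe_theta w.1, kap_conj_t]
  have h2 : theta n g * w.1 * (theta n g)⁻¹ = w.1 ↔
      g * theta n w.1 * g⁻¹ = theta n w.1 := by
    rw [← (theta n).injective.eq_iff, map_mul, map_mul, map_inv, theta_theta]
  simp only [Equiv.Set.image_apply, h1, h2]

include hC in
lemma conj_mem_theta (g w : WD n) (hw : w ∈ theta n '' C) : g * w * g⁻¹ ∈ theta n '' C := by
  obtain ⟨x, hx, rfl⟩ := hw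
  refine ⟨theta n g * x * (theta n g)⁻¹, hC _ _ hx, ?_⟩
  rw [map_mul, map_mul, map_inv, theta_theta]

lemma isInvolutionRep_invRep (hn : 1 < n) (hC2 : ∀ w ∈ C, w * w = 1) :
    IsInvolutionRep C (invRep ℝ C hC) := by
  intro r hr w w' hw'
  obtain ⟨a, ha⟩ := exists_isSimpleRefl hr
  rw [invRep_single, kap_simple ha]
  have hrinv : r⁻¹ = r := inv_eq_of_mul_eq_one_left (simple_mul_self hr)
  have hw'' : (⟨r * w.1 * r⁻¹, hC r w.1 w.2⟩ : C) = w' := by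
    ext1
    change r * w.1 * r⁻¹ = w'.1
    rw [hw', hrinv]
  rw [hw'']
  have hiff := commute_and_len_lt_iff hn ha w.1 (hC2 _ w.2)
  by_cases h : act (w.1 : WB n) a = -a
  · rw [if_pos h, if_pos (hiff.mpr h)]
    have : w' = w := by
      ext1
      rw [hw', (hiff.mpr h).1, mul_assoc, simple_mul_self hr, mul_one]
    rw [this]
    simp
  · rw [if_neg h, if_neg fun h' => h (hiff.mp h')]
    simp

include hC in
lemma IsInvolutionRep.unique (hn : 1 < n) {ρ ρ' : Representation ℝ (WD n) (C →₀ ℝ)}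
    (h : IsInvolutionRep C ρ) (h' : IsInvolutionRep C ρ') : ρ = ρ' := by
  refine MonoidHom.eq_of_eqOn_dense (closure_simple hn) fun r hr => ?_
  ext w : 2
  have hrinv : r⁻¹ = r := inv_eq_of_mul_eq_one_left (simple_mul_self hr)
  have hm := hC r w.1 w.2
  rw [hrinv] at hm
  simp only [LinearMap.comp_apply, Finsupp.lsingle_apply]
  rw [h r hr w ⟨_, hm⟩ rfl, h' r hr w ⟨_, hm⟩ rfl]

end InvolutionRep

/-! ### Signed perfect matchings and their transversals -/

section Transversal

variable {n : ℕ}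

lemma left_mul_apply (a b : WB n) (i : Fin n) :
    (a * b).left i = a.left i * b.left (a.right⁻¹ i) := rfl

lemma left_inv_apply (a : WB n) (i : Fin n) : (a⁻¹).left i = a.left (a.right i) := by
  have : (a⁻¹).left i = (a.left (a.right⁻¹⁻¹ i))⁻¹ := rfl
  rw [this, inv_inv, Int.units_inv_eq_self]

lemma left_conj_apply (g w : WB n) (j : Fin n) :
    (g * w * g⁻¹).left (g.right j) =
      g.left (g.right j) * w.left j * g.left (g.right (w.right⁻¹ j)) := by
  rw [left_mul_apply, left_mul_apply, left_inv_apply]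
  simp [mul_assoc]

lemma right_conj_apply (g w : WB n) (j : Fin n) :
    (g * w * g⁻¹).right (g.right j) = g.right (w.right j) := by
  simp

/-- `A` contains exactly one element of every pair `{i, w i}`. -/
def IsTrans (w : WB n) (A : Finset (Fin n)) : Prop := ∀ i, w.right i ∈ A ↔ i ∉ A

lemma IsTrans.ne {w : WB n} {A : Finset (Fin n)} (h : IsTrans w A) (i : Fin n) :
    w.right i ≠ i := by
  intro h'
  have := h i
  rw [h'] at this
  tauto

lemma IsTrans.conj {w : WB n} {A : Finset (Fin n)} (h : IsTrans w A) (g : WB n) :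
    IsTrans (g * w * g⁻¹) (A.map g.right.toEmbedding) := by
  intro i
  obtain ⟨j, rfl⟩ := g.right.surjective i
  rw [right_conj_apply]
  simpa using h j

/-- The product of the signs of the roots `e_j - w e_j` for `j` in `A`. -/
def transSign (w : WB n) (A : Finset (Fin n)) : ℤˣ := ∏ j ∈ A, sg (ee j - act w (ee j))

lemma isRoot_sub_act {w : WB n} {j : Fin n} (h : w.right j ≠ j) :
    IsRoot (ee j - act w (ee j)) := by
  refine ⟨j, w.right j, h.symm, 1, -w.left (w.right j), ?_⟩
  rw [act_ee]
  simp [sub_eq_add_neg]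

lemma right_right {w : WB n} (hw : w * w = 1) (i : Fin n) : w.right (w.right i) = i := by
  have : (w * w).right i = i := by rw [hw]; rfl
  exact this

lemma right_inv_eq {w : WB n} (hw : w * w = 1) : w.right⁻¹ = w.right := by
  ext i
  rw [Equiv.Perm.inv_eq_iff_eq.mpr (right_right hw i).symm]

lemma left_right {w : WB n} (hw : w * w = 1) (i : Fin n) : w.left (w.right i) = w.left i := by
  have h1 : (w * w).left i = 1 := by rw [hw]; rfl
  rw [left_mul_apply, right_inv_eq hw] at h1
  calc w.left (w.right i) = w.left i * (w.left i * w.left (w.right i)) := by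
        rw [← mul_assoc, Int.units_mul_self, one_mul]
    _ = w.left i := by rw [h1, mul_one]

/-- A root negated by `w` must be supported on a pair `{j, w j}`, and each pair carries exactly one
such root up to sign, `e_j - w e_j`. So a transversal indexes the negated positive roots. -/
lemma kap_eq_prod {w : WB n} (hw : w * w = 1) {A : Finset (Fin n)} (hA : IsTrans w A) (g : WB n) :
    kap g w = ∏ j ∈ A, sg (act g ((sg (ee j - act w (ee j)) : ℤ) • (ee j - act w (ee j)))) := by
  have hr : ∀ j, IsRoot (ee j - act w (ee j)) := fun j => isRoot_sub_act (hA.ne j)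
  symm
  refine Finset.prod_nbij (fun j => (sg (ee j - act w (ee j)) : ℤ) • (ee j - act w (ee j)))
    ?_ ?_ ?_ fun _ _ => rfl
  · intro j _
    have h1 := mem_posRoots.mp (hr j).sg_smul_mem
    refine mem_negRoots.mpr ⟨h1.1, h1.2, ?_⟩
    rw [map_smul, map_sub, ← act_mul, hw, act_one, ← smul_neg, neg_sub]
  · intro i hi j hj hij
    by_contra hne
    have h1 := congrFun hij i
    have h2 : w.right j ≠ i := by
      rintro rfl
      exact (hA j).mp hi hj
    have e1 : (ee i - act w (ee i)) i = 1 := by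
      rw [act_ee]; simp [ee, (hA.ne i).symm]
    have e2 : (ee j - act w (ee j)) i = 0 := by
      rw [act_ee]; simp [ee, h2.symm, hne]
    simp only [Pi.smul_apply, e1, e2] at h1
    simp at h1
  · intro v hv
    obtain ⟨⟨i, k, hik, a, b, rfl⟩, hpos, hneg⟩ := mem_negRoots.mp hv
    have key : ∀ (i k : Fin n) (a b : ℤˣ), i ≠ k →
        act w ((a : ℤ) • ee i + (b : ℤ) • ee k) = -((a : ℤ) • ee i + (b : ℤ) • ee k) →
        0 < ht ((a : ℤ) • ee i + (b : ℤ) • ee k) → i ∈ A →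
        (a : ℤ) • ee i + (b : ℤ) • ee k ∈
          (fun j => (sg (ee j - act w (ee j)) : ℤ) • (ee j - act w (ee j))) '' (A : Set (Fin n)) := by
      intro i k a b hik hneg hpos hi
      have hwk : w.right k = i := by
        by_contra hne
        have := congrFun hneg i
        rw [map_add, map_smul, map_smul, act_ee, act_ee] at this
        simp [ee, (hA.ne i).symm, hik, Ne.symm hne] at this
      have hwi : w.right i = k := by rw [← hwk, right_right hw]
      have hb : (b : ℤ) = -(a * w.left k) := by
        have := congrFun hneg k
        rw [map_add, map_smul, map_smul, act_ee, act_ee, hwk, hwi] at this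
        simp [ee, hik.symm] at this
        omega
      have hv : (a : ℤ) • ee i + (b : ℤ) • ee k = (a : ℤ) • (ee i - act w (ee i)) := by
        rw [act_ee, hwi, hb, smul_sub, smul_smul, neg_smul, sub_eq_add_neg]
      refine ⟨i, hi, ?_⟩
      rw [hv] at hpos ⊢
      have h1 := (hr i).sg_smul a
      rw [sg_of_pos hpos] at h1
      have h2 : sg (ee i - act w (ee i)) = a := by
        calc _ = a * (a * sg (ee i - act w (ee i))) := by
              rw [← mul_assoc, Int.units_mul_self, one_mul]
          _ = a := by rw [← h1, mul_one]
      simp only [h2]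
    by_cases hi : i ∈ A
    · exact key i k a b hik hneg hpos hi
    · have hk : k ∈ A := by
        have hwk : w.right k = i := by
          by_contra hne
          have := congrFun hneg i
          rw [map_add, map_smul, map_smul, act_ee, act_ee] at this
          simp [ee, (hA.ne i).symm, hik, Ne.symm hne] at this
        by_contra hk
        exact hi (hwk ▸ (hA k).mpr hk)
      rw [add_comm] at hneg hpos ⊢
      exact key k i b a hik.symm hneg hpos hk

/-- The sign `kap` in terms of a transversal. -/
lemma kap_mul_transSign {w : WB n} (hw : w * w = 1) {A : Finset (Fin n)} (hA : IsTrans w A)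
    (g : WB n) : kap g w * transSign w A =
      (∏ j ∈ A, g.left (g.right j)) * transSign (g * w * g⁻¹) (A.map g.right.toEmbedding) := by
  rw [kap_eq_prod hw hA, transSign, transSign, Finset.prod_map, ← Finset.prod_mul_distrib,
    ← Finset.prod_mul_distrib]
  refine Finset.prod_congr rfl fun j _ => ?_
  have hr : IsRoot (ee j - act w (ee j)) := isRoot_sub_act (hA.ne j)
  have hr' : IsRoot (ee (g.right j) - act (g * w * g⁻¹) (ee (g.right j))) := by
    refine isRoot_sub_act ?_
    rw [right_conj_apply]
    simpa using hA.ne j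
  have h1 : act g (ee j - act w (ee j)) =
      (g.left (g.right j) : ℤ) • (ee (g.right j) - act (g * w * g⁻¹) (ee (g.right j))) := by
    rw [smul_sub, ← map_smul (act (g * w * g⁻¹)), ← act_ee, ← act_mul, inv_mul_cancel_right,
      act_mul, map_sub]
  rw [map_smul, (hr.act g).sg_smul, mul_right_comm, Int.units_mul_self, one_mul, h1, hr'.sg_smul]
  rfl

/-- Fixed point free involutions such that the product of the signs of all edges is `e`. -/
def IsGood (w : WB n) (e : ℤˣ) : Prop :=
  w * w = 1 ∧ (∃ A, IsTrans w A) ∧ ∀ B, IsTrans w B → ∏ j ∈ B, w.left j = e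

lemma IsTrans.prod_mul {w : WB n} {A : Finset (Fin n)} (hA : IsTrans w A) (f : Fin n → ℤˣ) :
    ∏ j ∈ A, f j * f (w.right j) = ∏ j, f j := by
  classical
  rw [Finset.prod_mul_distrib, ← Finset.prod_mul_prod_compl A f]
  congr 1
  refine Finset.prod_nbij w.right ?_ w.right.injective.injOn ?_ fun _ _ => rfl
  · intro j hj
    rw [Finset.mem_compl, hA j, not_not]
    exact hj
  · intro j hj
    obtain ⟨i, rfl⟩ := w.right.surjective j
    refine ⟨i, ?_, rfl⟩
    rw [Finset.mem_coe, Finset.mem_compl, hA i, not_not] at hj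
    exact hj

/-- Conjugation multiplies the sign of an edge by the signs of `g` at both ends, and the edges
together cover every vertex once. The product of edge signs is thus invariant under `WD n` and
reversed by `t`. -/
lemma IsGood.conj {w : WB n} {e : ℤˣ} (h : IsGood w e) (g : WB n) :
    IsGood (g * w * g⁻¹) (e * signProd n g) := by
  obtain ⟨hw, ⟨A, hA⟩, hB⟩ := h
  refine ⟨?_, ⟨_, hA.conj g⟩, fun B hB' => ?_⟩
  · rw [show g * w * g⁻¹ * (g * w * g⁻¹) = g * (w * w) * g⁻¹ by group, hw]; group
  · have hB0 : IsTrans w (B.map g.right⁻¹.toEmbedding) := by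
      have := hB'.conj g⁻¹
      rwa [show g⁻¹ * (g * w * g⁻¹) * g⁻¹⁻¹ = w by group] at this
    rw [← hB _ hB0]
    have h1 : B = (B.map g.right⁻¹.toEmbedding).map g.right.toEmbedding := by
      rw [Finset.map_map]
      ext i
      simp only [Finset.mem_map, Function.Embedding.trans_apply, Equiv.coe_toEmbedding]
      simp
    have h2 : signProd n g = ∏ j, g.left (g.right j) := (Equiv.prod_comp g.right g.left).symm
    conv_lhs => rw [h1]
    rw [h2, ← hB0.prod_mul fun j => g.left (g.right j), ← Finset.prod_mul_distrib, Finset.prod_map]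
    refine Finset.prod_congr rfl fun j _ => ?_
    rw [Equiv.coe_toEmbedding, left_conj_apply, right_inv_eq hw, mul_comm (g.left _), mul_assoc]

end Transversal

/-! ### The matching `σ` and its class; separation of `C₀` from `θ(C₀)` -/

section Sigma

variable {m : ℕ}

/-- The vertices `2 p` and `2 p + 1` as an indexing of `Fin (2 * m)`. -/
def pairEquiv (m : ℕ) : Fin m × Bool ≃ Fin (2 * m) where
  toFun x := ⟨2 * x.1.val + x.2.toNat, by have := x.1.2; have := Bool.toNat_lt x.2; omega⟩
  invFun i := (⟨i.val / 2, by omega⟩, i.val % 2 == 1)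
  left_inv := by
    rintro ⟨p, b⟩
    cases b <;> (simp [Fin.ext_iff]; try omega)
  right_inv i := by
    ext
    rcases Nat.mod_two_eq_zero_or_one i.val with h | h <;> simp [h] <;> omega

/-- The vertex `2 p`. -/
def ev (p : Fin m) : Fin (2 * m) := pairEquiv m (p, false)

/-- The vertex `2 p + 1`. -/
def od (p : Fin m) : Fin (2 * m) := pairEquiv m (p, true)

@[simp] lemma ev_val (p : Fin m) : (ev p).val = 2 * p.val := rfl

@[simp] lemma od_val (p : Fin m) : (od p).val = 2 * p.val + 1 := rfl

lemma ev_or_od (i : Fin (2 * m)) : (∃ p, i = ev p) ∨ ∃ p, i = od p := by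
  obtain ⟨⟨p, b⟩, rfl⟩ := (pairEquiv m).surjective i
  cases b
  exacts [Or.inl ⟨p, rfl⟩, Or.inr ⟨p, rfl⟩]

@[simp] lemma ev_inj {p q : Fin m} : ev p = ev q ↔ p = q := by simp [ev]

@[simp] lemma od_inj {p q : Fin m} : od p = od q ↔ p = q := by simp [od]

@[simp] lemma ev_ne_od (p q : Fin m) : ev p ≠ od q := by simp [ev, od]

@[simp] lemma od_ne_ev (p q : Fin m) : od p ≠ ev q := by simp [ev, od]

/-- The odd vertices. -/
def odds (m : ℕ) : Finset (Fin (2 * m)) := Finset.univ.filter fun i => i.val % 2 = 1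

@[simp] lemma ev_notMem (p : Fin m) : ev p ∉ odds m := by simp [odds]

@[simp] lemma od_mem (p : Fin m) : od p ∈ odds m := by simp [odds]

lemma prod_odds {M : Type*} [CommMonoid M] (f : Fin (2 * m) → M) :
    ∏ j ∈ odds m, f j = ∏ p : Fin m, f (od p) := by
  symm
  refine Finset.prod_nbij od (fun p _ => od_mem p) (fun p _ q _ h => od_inj.mp h) ?_ fun _ _ => rfl
  intro i hi
  rcases ev_or_od i with ⟨p, rfl⟩ | ⟨p, rfl⟩
  · exact absurd hi (by simp)
  · exact ⟨p, by simp, rfl⟩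

lemma sigma_aux (l : List (Fin m)) (hl : l.Nodup) :
    ((l.map fun k => s (n := 2 * m) (2 * k.val) (by omega)).prod : WB (2 * m)).left = 1 ∧
    ∀ p, ((l.map fun k => s (n := 2 * m) (2 * k.val) (by omega)).prod : WB (2 * m)).right (ev p) =
        (if p ∈ l then od p else ev p) ∧
      ((l.map fun k => s (n := 2 * m) (2 * k.val) (by omega)).prod : WB (2 * m)).right (od p) =
        (if p ∈ l then ev p else od p) := by
  induction l with
  | nil => exact ⟨rfl, fun p => by simp⟩
  | cons k l ih =>
    obtain ⟨hk, hl'⟩ := List.nodup_cons.mp hl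
    obtain ⟨ih1, ih2⟩ := ih hl'
    rw [List.map_cons, List.prod_cons, Subgroup.coe_mul]
    have hr : (s (n := 2 * m) (2 * k.val) (by omega) : WB (2 * m)).right =
        Equiv.swap (ev k) (od k) := rfl
    constructor
    · ext1 i
      rw [left_mul_apply, ih1]; simp [s]
    · intro p
      rw [SemidirectProduct.mul_right, Equiv.Perm.mul_apply, Equiv.Perm.mul_apply, (ih2 p).1,
        (ih2 p).2, hr]
      by_cases hpk : p = k
      · subst hpk
        simp [hk]
      · by_cases hpl : p ∈ l <;> simp [hpk, hpl, Equiv.swap_apply_def]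

lemma sigma_left (m : ℕ) : (sigma m : WB (2 * m)).left = 1 :=
  (sigma_aux _ (List.nodup_finRange m)).1

@[simp] lemma sigma_ev (p : Fin m) : (sigma m : WB (2 * m)).right (ev p) = od p := by
  have := ((sigma_aux _ (List.nodup_finRange m)).2 p).1
  rwa [if_pos (List.mem_finRange p)] at this

@[simp] lemma sigma_od (p : Fin m) : (sigma m : WB (2 * m)).right (od p) = ev p := by
  have := ((sigma_aux _ (List.nodup_finRange m)).2 p).2
  rwa [if_pos (List.mem_finRange p)] at this

lemma sigma_mul_self (m : ℕ) : (sigma m : WB (2 * m)) * sigma m = 1 := by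
  refine SemidirectProduct.ext ?_ ?_
  · ext1 i
    rw [left_mul_apply, sigma_left]; simp
  · ext1 i
    rw [SemidirectProduct.mul_right, Equiv.Perm.mul_apply]
    rcases ev_or_od i with ⟨p, rfl⟩ | ⟨p, rfl⟩ <;> simp

lemma isTrans_odds {w : WB (2 * m)} (h : w.right = (sigma m : WB (2 * m)).right) :
    IsTrans w (odds m) := by
  intro i
  rw [h]
  rcases ev_or_od i with ⟨p, rfl⟩ | ⟨p, rfl⟩ <;> simp

lemma isGood_sigma (m : ℕ) : IsGood (sigma m : WB (2 * m)) 1 :=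
  ⟨sigma_mul_self m, ⟨_, isTrans_odds rfl⟩, fun B _ => by rw [sigma_left]; simp⟩

lemma isGood_of_mem {w : WD (2 * m)} (h : w ∈ C₀ m) : IsGood (w : WB (2 * m)) 1 := by
  obtain ⟨c, hc⟩ := isConj_iff.mp h
  have := (isGood_sigma m).conj (c : WB (2 * m))
  rw [show signProd (2 * m) (c : WB (2 * m)) = 1 from c.2, mul_one] at this
  rw [← hc]
  exact this

lemma isGood_of_mem_theta (hm : 1 ≤ m) {w : WD (2 * m)} (h : w ∈ theta (2 * m) '' C₀ m) :
    IsGood (w : WB (2 * m)) (-1) := by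
  obtain ⟨x, hx, rfl⟩ := h
  have := (isGood_of_mem hx).conj (t (2 * m))
  rw [one_mul] at this
  suffices h1 : signProd (2 * m) (t (2 * m)) = -1 by rw [← h1]; exact this
  change ∏ i : Fin (2 * m), (if i.val = 0 then (-1 : ℤˣ) else 1) = -1
  rw [Finset.prod_eq_single ⟨0, by omega⟩]
  · simp
  · intro i _ hi
    exact if_neg fun h => hi (Fin.ext h)
  · simp

/-- The product of the edge signs is `1` on one class and `-1` on the other. -/
lemma theta_ne (hm : 1 ≤ m) : theta (2 * m) '' C₀ m ≠ C₀ m := by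
  intro h
  have h1 : sigma m ∈ C₀ m := IsConj.refl _
  have h2 := isGood_of_mem_theta hm (h.symm ▸ h1)
  obtain ⟨A, hA⟩ := h2.2.1
  have h3 := (h2.2.2 A hA).symm.trans ((isGood_of_mem h1).2.2 A hA)
  exact absurd h3 (by decide)

lemma conj_mem_C₀ (g w : WD (2 * m)) (hw : w ∈ C₀ m) : g * w * g⁻¹ ∈ C₀ m :=
  IsConj.trans hw (isConj_iff.mpr ⟨g, rfl⟩)

lemma mul_self_of_isGood {w : WD (2 * m)} {e : ℤˣ} (h : IsGood (w : WB (2 * m)) e) : w * w = 1 :=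
  Subtype.ext h.1

end Sigma

/-! ### Bounding the commutant of the involution representation -/

section Commutant

open Representation

variable {m : ℕ}

/-- The complex involution representation on the class of `s_1 s_3 ⋯ s_{n-1}`. -/
noncomputable abbrev sigmaRep (m : ℕ) : Representation ℂ (WD (2 * m)) (C₀ m →₀ ℂ) :=
  invRep ℂ (C₀ m) conj_mem_C₀

open Classical in
/-- The sum of all `a_w` such that `w` has the same edges as `σ`, with positive signs on the edges
in `A`. -/
noncomputable def partVec (A : Finset (Fin m)) : C₀ m →₀ ℂ :=
  Finsupp.equivFunOnFinite.symm fun w =>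
    if (w.1 : WB (2 * m)).right = (sigma m : WB (2 * m)).right ∧
      ∀ p ∈ A, (w.1 : WB (2 * m)).left (od p) = 1 then 1 else 0

open Classical in
lemma partVec_apply (A : Finset (Fin m)) (w : C₀ m) : partVec A w =
    if (w.1 : WB (2 * m)).right = (sigma m : WB (2 * m)).right ∧
      ∀ p ∈ A, (w.1 : WB (2 * m)).left (od p) = 1 then 1 else 0 := rfl

lemma exists_conj_eq (g : WD (2 * m)) (w : C₀ m) :
    ∃ w' : C₀ m, w = ⟨g * w'.1 * g⁻¹, conj_mem_C₀ g w'.1 w'.2⟩ :=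
  ⟨⟨g⁻¹ * w.1 * g⁻¹⁻¹, conj_mem_C₀ _ _ w.2⟩, Subtype.ext (by simp [mul_assoc])⟩

lemma left_ev {w : WB (2 * m)} (hw : w * w = 1)
    (h : w.right = (sigma m : WB (2 * m)).right) (p : Fin m) :
    w.left (ev p) = w.left (od p) := by
  have := left_right hw (od p)
  rwa [h, sigma_od] at this

/-- The transposition of the edge `p` commutes with every `w` having the edges of `σ`. It acts on
`a_w` by `-1` if the edge is positive and by `1` if it is negative, so subtracting doubles the
former terms and kills the latter. -/
lemma partVec_insert (A : Finset (Fin m)) (p : Fin m) :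
    (2 : ℂ) • partVec (insert p A) = partVec A -
      sigmaRep m (s (2 * p.val) (by omega)) (partVec A) := by
  classical
  set z : WD (2 * m) := s (2 * p.val) (by omega) with hz
  have hzr : (z : WB (2 * m)).right = Equiv.swap (ev p) (od p) := rfl
  have hzl : (z : WB (2 * m)).left = 1 := rfl
  have hrefl : IsSimpleRefl (z : WB (2 * m)) (ee (od p) - ee (ev p)) := isSimpleRefl_s _ _
  have hcomm : (z : WB (2 * m)).right * (sigma m : WB (2 * m)).right *
      (z : WB (2 * m)).right⁻¹ = (sigma m : WB (2 * m)).right := by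
    rw [mul_inv_eq_iff_eq_mul]
    ext1 i
    rw [Equiv.Perm.mul_apply, Equiv.Perm.mul_apply, hzr]
    rcases ev_or_od i with ⟨q, rfl⟩ | ⟨q, rfl⟩ <;> by_cases h : q = p <;>
      simp [Equiv.swap_apply_def, h]
  ext w
  obtain ⟨w, rfl⟩ := exists_conj_eq z w
  have hg := isGood_of_mem w.2
  rw [Finsupp.sub_apply, invRep_apply, Finsupp.smul_apply, kap_simple hrefl]
  by_cases h : (w.1 : WB (2 * m)).right = (sigma m : WB (2 * m)).right
  · have hl : ∀ q, ((z : WB (2 * m)) * w.1 * (z : WB (2 * m))⁻¹).left (od q) = (w.1 : WB (2 * m)).left (od q) := by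
      intro q
      rw [left_mul_apply, left_mul_apply, left_inv_apply, hzl]
      simp only [Pi.one_apply, one_mul, mul_one, hzr, Equiv.swap_inv]
      by_cases hq : q = p
      · subst hq
        rw [Equiv.swap_apply_right, left_ev hg.1 h]
      · rw [Equiv.swap_apply_of_ne_of_ne (by simp) (by simpa using hq)]
    have hact : act (w.1 : WB (2 * m)) (ee (od p) - ee (ev p)) = -(ee (od p) - ee (ev p)) ↔
        (w.1 : WB (2 * m)).left (od p) = 1 := by
      rw [map_sub, act_ee, act_ee, h, sigma_od, sigma_ev, left_ev hg.1 h, ← smul_sub]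
      constructor
      · intro h'
        have := congrFun h' (od p)
        rcases Int.units_eq_one_or ((w.1 : WB (2 * m)).left (od p)) with h1 | h1
        · exact h1
        · rw [h1] at this
          simp [ee] at this
      · intro h'
        rw [h']; simp
    have hr : ((z : WB (2 * m)) * w.1 * (z : WB (2 * m))⁻¹).right = (sigma m : WB (2 * m)).right := by
      rw [SemidirectProduct.mul_right, SemidirectProduct.mul_right, SemidirectProduct.inv_right,
        h, hcomm]
    simp only [partVec_apply, Subgroup.coe_mul, Subgroup.coe_inv, hl, hr, h, hact, true_and,
      Finset.forall_mem_insert]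
    by_cases h1 : (w.1 : WB (2 * m)).left (od p) = 1 <;>
    by_cases h2 : ∀ q ∈ A, (w.1 : WB (2 * m)).left (od q) = 1 <;> simp [h1, h2]
    rw [if_pos h2, if_pos h2, if_pos h2]
    norm_num
  · have hr : ((z : WB (2 * m)) * w.1 * (z : WB (2 * m))⁻¹).right ≠ (sigma m : WB (2 * m)).right := by
      intro h'
      apply h
      rw [SemidirectProduct.mul_right, SemidirectProduct.mul_right, SemidirectProduct.inv_right,
        ← hcomm] at h'
      simpa using h'
    simp only [partVec_apply, Subgroup.coe_mul, Subgroup.coe_inv, hr, h, false_and, if_false]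
    simp

lemma partVec_univ : partVec (Finset.univ : Finset (Fin m)) =
    Finsupp.single (⟨sigma m, IsConj.refl _⟩ : C₀ m) 1 := by
  classical
  ext w
  rw [partVec_apply, Finsupp.single_apply]
  refine if_congr ?_ rfl rfl
  constructor
  · rintro ⟨h1, h2⟩
    refine Subtype.ext (Subtype.ext (SemidirectProduct.ext ?_ h1.symm))
    change (sigma m : WB (2 * m)).left = (w.1 : WB (2 * m)).left
    rw [sigma_left]
    ext1 i
    rcases ev_or_od i with ⟨p, rfl⟩ | ⟨p, rfl⟩
    · rw [left_ev (isGood_of_mem w.2).1 h1, h2 p (Finset.mem_univ _)]; rfl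
    · rw [h2 p (Finset.mem_univ _)]; rfl
  · rintro rfl
    exact ⟨rfl, fun p _ => by simp [sigma_left]⟩

/-- Imposing positivity on one edge after another produces `a_σ` from `partVec ∅`, and `a_σ`
generates the representation. -/
lemma eq_zero_of_partVec (T : IntertwiningMap (sigmaRep m) (sigmaRep m))
    (h : T (partVec ∅) = 0) : T = 0 := by
  classical
  have h1 : ∀ A, T (partVec A) = 0 := by
    intro A
    induction A using Finset.induction_on with
    | empty => exact h
    | insert p A _ ih =>
      have := congrArg T (partVec_insert A p)
      rw [map_smul, map_sub, T.isIntertwining, ih, map_zero, sub_zero] at this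
      simpa using this
  have h2 := h1 Finset.univ
  rw [partVec_univ] at h2
  refine IntertwiningMap.ext ?_
  ext w : 2
  obtain ⟨g, hg⟩ := isConj_iff.mp w.2
  have h3 := invRep_single ℂ (C₀ m) conj_mem_C₀ g ⟨sigma m, IsConj.refl _⟩
  have h4 := congrArg T h3
  rw [T.isIntertwining, h2, map_zero, map_smul] at h4
  have h5 : (⟨g * sigma m * g⁻¹, conj_mem_C₀ g _ (IsConj.refl _)⟩ : C₀ m) = w := Subtype.ext hg
  simp only [h5] at h4
  have h6 : ∀ e : ℤˣ, (((e : ℤˣ) : ℤ) : ℂ) ≠ 0 := fun e => by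
    rcases Int.units_eq_one_or e with rfl | rfl <;> simp
  exact (smul_eq_zero.mp h4.symm).resolve_left (h6 _)

/-- The elements preserving both the set of odd vertices and the set of edges of `σ`. -/
def IsDiag (g : WB (2 * m)) : Prop :=
  (∀ i, g.right i ∈ odds m ↔ i ∈ odds m) ∧
    g.right * (sigma m : WB (2 * m)).right * g.right⁻¹ = (sigma m : WB (2 * m)).right

lemma IsDiag.map_odds {g : WB (2 * m)} (hg : IsDiag g) :
    (odds m).map g.right.toEmbedding = odds m := by
  ext i
  obtain ⟨j, rfl⟩ := g.right.surjective i
  simpa using (hg.1 j).symm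

/-- The odd end of an edge of `σ` has the larger index, so its basis vector decides the sign of the
height whatever the sign of the edge. -/
lemma transSign_odds {w : WB (2 * m)} (h : w.right = (sigma m : WB (2 * m)).right) :
    transSign w (odds m) = 1 := by
  rw [transSign, prod_odds]
  refine Finset.prod_eq_one fun p _ => sg_of_pos ?_
  rw [act_ee, h, sigma_od, map_sub, map_smul, ht_ee, ht_ee]
  rcases Int.units_eq_one_or (w.left (ev p)) with h1 | h1 <;> (simp [h1]; try omega)

lemma sigmaRep_partVec {g : WD (2 * m)} (hg : IsDiag (g : WB (2 * m))) :
    sigmaRep m g (partVec ∅) =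
      (((∏ j ∈ odds m, (g : WB (2 * m)).left j : ℤˣ) : ℤ) : ℂ) • partVec ∅ := by
  classical
  ext w
  obtain ⟨w, rfl⟩ := exists_conj_eq g w
  have hgood := isGood_of_mem w.2
  rw [invRep_apply, Finsupp.smul_apply, smul_eq_mul]
  have hr : ((g : WB (2 * m)) * w.1 * (g : WB (2 * m))⁻¹).right = (sigma m : WB (2 * m)).right ↔
      (w.1 : WB (2 * m)).right = (sigma m : WB (2 * m)).right := by
    rw [SemidirectProduct.mul_right, SemidirectProduct.mul_right, SemidirectProduct.inv_right]
    nth_rewrite 1 [← hg.2]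
    simp
  simp only [partVec_apply, Subgroup.coe_mul, Subgroup.coe_inv, hr, Finset.notMem_empty,
    IsEmpty.forall_iff, implies_true, and_true]
  by_cases h : (w.1 : WB (2 * m)).right = (sigma m : WB (2 * m)).right
  · have h1 := kap_mul_transSign hgood.1 (isTrans_odds h) (g : WB (2 * m))
    rw [transSign_odds h, hg.map_odds, transSign_odds (hr.mpr h), mul_one, mul_one] at h1
    have h2 : ∏ j ∈ odds m, (g : WB (2 * m)).left ((g : WB (2 * m)).right j) =
        ∏ j ∈ odds m, (g : WB (2 * m)).left j := by
      conv_rhs => rw [← hg.map_odds, Finset.prod_map]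
      rfl
    rw [h1, h2]
  · simp [h]

/-- The vectors on which the elements satisfying `IsDiag` act as on `partVec ∅`. -/
def IsDiagVec (k : C₀ m →₀ ℂ) : Prop := ∀ g : WD (2 * m), IsDiag (g : WB (2 * m)) →
  sigmaRep m g k = (((∏ j ∈ odds m, (g : WB (2 * m)).left j : ℤˣ) : ℤ) : ℂ) • k

lemma IsDiagVec.apply {k : C₀ m →₀ ℂ} (hk : IsDiagVec k) {g : WD (2 * m)}
    (hg : IsDiag (g : WB (2 * m))) (w : C₀ m) :
    (((kap (g : WB (2 * m)) (w.1 : WB (2 * m)) : ℤˣ) : ℤ) : ℂ) * k w =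
      (((∏ j ∈ odds m, (g : WB (2 * m)).left j : ℤˣ) : ℤ) : ℂ) *
        k ⟨g * w.1 * g⁻¹, conj_mem_C₀ g w.1 w.2⟩ := by
  have := DFunLike.congr_fun (hk g hg) ⟨g * w.1 * g⁻¹, conj_mem_C₀ g w.1 w.2⟩
  rwa [invRep_apply, Finsupp.smul_apply, smul_eq_mul] at this

lemma IsDiagVec.eq_zero_of_conj {k : C₀ m →₀ ℂ} (hk : IsDiagVec k) {g : WD (2 * m)}
    (hg : IsDiag (g : WB (2 * m))) (w : C₀ m)
    (h : k ⟨g * w.1 * g⁻¹, conj_mem_C₀ g w.1 w.2⟩ = 0) : k w = 0 := by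
  have h1 := hk.apply hg w
  rw [h, mul_zero] at h1
  have h6 : ∀ e : ℤˣ, (((e : ℤˣ) : ℤ) : ℂ) ≠ 0 := fun e => by
    rcases Int.units_eq_one_or e with rfl | rfl <;> simp
  exact (mul_eq_zero.mp h1).resolve_left (h6 _)

/-- A sign change. -/
def signElt {n : ℕ} (e : Fin n → ℤˣ) (he : ∏ i, e i = 1) : WD n := ⟨⟨e, 1⟩, he⟩

lemma isDiag_signElt (e : Fin (2 * m) → ℤˣ) (he : ∏ i, e i = 1) :
    IsDiag (signElt e he : WB (2 * m)) :=
  ⟨fun _ => Iff.rfl, by simp [signElt]⟩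

/-- Some edge of `w` joins two vertices of equal parity. Changing the signs at both of its ends
fixes `w`, acts on `a_w` by `-1`, but should act on `k` by `1`. -/
lemma IsDiagVec.eq_zero_of_not_isTrans {k : C₀ m →₀ ℂ} (hk : IsDiagVec k) (w : C₀ m)
    (hw : ¬ IsTrans (w.1 : WB (2 * m)) (odds m)) : k w = 0 := by
  classical
  obtain ⟨hinv, ⟨A, hA⟩, -⟩ := isGood_of_mem w.2
  set x : WB (2 * m) := (w.1 : WB (2 * m)) with hx
  obtain ⟨i, hi⟩ : ∃ i, (x.right i ∈ odds m ↔ i ∈ odds m) := by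
    by_contra! hcon
    apply hw
    intro i
    have := hcon i
    tauto
  have hne : x.right i ≠ i := hA.ne i
  set e : Fin (2 * m) → ℤˣ := fun j => if j = i ∨ j = x.right i then -1 else 1 with he
  have hprod : ∀ B : Finset (Fin (2 * m)), ∏ j ∈ B, e j =
      (if i ∈ B then -1 else 1) * (if x.right i ∈ B then -1 else 1) := by
    intro B
    have : ∀ j, e j = (if j = i then -1 else 1) * (if j = x.right i then -1 else 1) := by
      intro j
      by_cases h1 : j = i
      · subst h1; simp [he, hne.symm]
      · simp [he, h1]
    rw [Finset.prod_congr rfl fun j _ => this j, Finset.prod_mul_distrib, Finset.prod_ite_eq',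
      Finset.prod_ite_eq']
  have hsymm : ∀ j, e (x.right j) = e j := by
    intro j
    have h1 : x.right j = i ↔ j = x.right i := by
      constructor
      · rintro rfl; rw [right_right hinv]
      · rintro rfl; rw [right_right hinv]
    have h2 : x.right j = x.right i ↔ j = i := by simp
    simp only [he, h1, h2, or_comm]
  have he1 : ∏ j, e j = 1 := by rw [hprod]; simp
  -- The two changed vertices are both odd or both even.
  have hodd : ∏ j ∈ odds m, e j = 1 := by
    rw [hprod, if_congr hi rfl rfl]
    split_ifs <;> simp
  have hkap : kap (signElt e he1 : WB (2 * m)) x = -1 := by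
    have h1 := kap_mul_transSign hinv hA (signElt e he1 : WB (2 * m))
    have h2 : (signElt e he1 : WB (2 * m)) * x * (signElt e he1 : WB (2 * m))⁻¹ = x := by
      refine SemidirectProduct.ext ?_ (by simp [signElt])
      ext1 j
      have := left_conj_apply (signElt e he1 : WB (2 * m)) x j
      rw [right_inv_eq hinv] at this
      refine this.trans ?_
      change e j * x.left j * e (x.right j) = x.left j
      rw [hsymm, mul_right_comm, Int.units_mul_self, one_mul]
    have h3 : A.map (signElt e he1 : WB (2 * m)).right.toEmbedding = A := by
      ext j
      simp only [signElt, Finset.mem_map_equiv]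
      rfl
    rw [h2, h3] at h1
    rw [mul_right_cancel h1]
    change ∏ j ∈ A, e j = -1
    rw [hprod]
    -- A transversal contains exactly one of the two changed vertices.
    have := hA i
    by_cases h : i ∈ A <;> simp [h, this]
  have h1 := hk.apply (isDiag_signElt e he1) w
  have h2 : (⟨signElt e he1 * w.1 * (signElt e he1)⁻¹, conj_mem_C₀ _ w.1 w.2⟩ : C₀ m) = w := by
    ext1
    apply Subtype.ext
    refine SemidirectProduct.ext ?_ (by simp [signElt])
    ext1 j
    have := left_conj_apply (signElt e he1 : WB (2 * m)) x j
    rw [right_inv_eq hinv] at this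
    refine this.trans ?_
    change e j * x.left j * e (x.right j) = x.left j
    rw [hsymm, mul_right_comm, Int.units_mul_self, one_mul]
  rw [h2, ← hx, hkap] at h1
  have h3 : ∏ j ∈ odds m, (signElt e he1 : WB (2 * m)).left j = 1 := hodd
  rw [h3] at h1
  simp only [Units.val_neg, Units.val_one, Int.cast_neg, Int.cast_one, neg_mul, one_mul] at h1
  linear_combination (-1 / 2 : ℂ) * h1

/-- The permutation of the vertices of `σ` preserving parity given by a permutation of edges. -/
def diagPerm (g : Equiv.Perm (Fin m)) : Equiv.Perm (Fin (2 * m)) :=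
  (pairEquiv m).permCongr (Equiv.prodCongr g (Equiv.refl Bool))

@[simp] lemma diagPerm_ev (g : Equiv.Perm (Fin m)) (p : Fin m) :
    diagPerm g (ev p) = ev (g p) := by simp [diagPerm, ev, Equiv.permCongr_apply]

@[simp] lemma diagPerm_od (g : Equiv.Perm (Fin m)) (p : Fin m) :
    diagPerm g (od p) = od (g p) := by simp [diagPerm, od, Equiv.permCongr_apply]

/-- The involution interchanging `2 p + 1` and `2 π(p)`. -/
def matchPerm (g : Equiv.Perm (Fin m)) : Equiv.Perm (Fin (2 * m)) :=
  (pairEquiv m).permCongr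
    { toFun := fun x => bif x.2 then (g x.1, false) else (g⁻¹ x.1, true)
      invFun := fun x => bif x.2 then (g x.1, false) else (g⁻¹ x.1, true)
      left_inv := by rintro ⟨p, _ | _⟩ <;> simp
      right_inv := by rintro ⟨p, _ | _⟩ <;> simp }

@[simp] lemma matchPerm_ev (g : Equiv.Perm (Fin m)) (p : Fin m) :
    matchPerm g (ev p) = od (g⁻¹ p) := by simp [matchPerm, ev, od, Equiv.permCongr_apply]

@[simp] lemma matchPerm_od (g : Equiv.Perm (Fin m)) (p : Fin m) :
    matchPerm g (od p) = ev (g p) := by simp [matchPerm, ev, od, Equiv.permCongr_apply]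

/-- A permutation as an element of `WD n`. -/
def permElt {n : ℕ} (τ : Equiv.Perm (Fin n)) : WD n :=
  ⟨⟨1, τ⟩, by simp [MonoidHom.mem_ker, signProd]⟩

lemma permElt_conj {n : ℕ} (σ τ : Equiv.Perm (Fin n)) :
    permElt σ * permElt τ * (permElt σ)⁻¹ = permElt (σ * τ * σ⁻¹) := by
  apply Subtype.ext
  refine SemidirectProduct.ext ?_ rfl
  ext1 i
  rw [Subgroup.coe_mul, Subgroup.coe_mul, Subgroup.coe_inv, left_mul_apply, left_mul_apply,
    left_inv_apply]
  simp [permElt]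

lemma isDiag_permElt (g : Equiv.Perm (Fin m)) : IsDiag (permElt (diagPerm g) : WB (2 * m)) := by
  constructor
  · intro i
    change diagPerm g i ∈ odds m ↔ i ∈ odds m
    rcases ev_or_od i with ⟨p, rfl⟩ | ⟨p, rfl⟩ <;> simp
  · change diagPerm g * (sigma m : WB (2 * m)).right * (diagPerm g)⁻¹ = _
    rw [mul_inv_eq_iff_eq_mul]
    ext1 i
    rw [Equiv.Perm.mul_apply, Equiv.Perm.mul_apply]
    rcases ev_or_od i with ⟨p, rfl⟩ | ⟨p, rfl⟩ <;> simp

lemma matchPerm_conj (g τ : Equiv.Perm (Fin m)) :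
    diagPerm g * matchPerm τ * (diagPerm g)⁻¹ = matchPerm (g * τ * g⁻¹) := by
  rw [mul_inv_eq_iff_eq_mul]
  ext1 i
  rw [Equiv.Perm.mul_apply, Equiv.Perm.mul_apply]
  rcases ev_or_od i with ⟨p, rfl⟩ | ⟨p, rfl⟩ <;> simp [mul_assoc]

lemma exists_eq_matchPerm {τ : Equiv.Perm (Fin (2 * m))} (hτ : ∀ i, τ (τ i) = i)
    (h : ∀ i, τ i ∈ odds m ↔ i ∉ odds m) : ∃ g : Equiv.Perm (Fin m), τ = matchPerm g := by
  have h1 : ∀ p : Fin m, ∃ q, τ (od p) = ev q := by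
    intro p
    rcases ev_or_od (τ (od p)) with hq | ⟨q, hq⟩
    · exact hq
    · exact absurd ((h (od p)).mp (hq ▸ od_mem q)) (by simp)
  choose f hf using h1
  have hinj : Function.Injective f := by
    intro p q hpq
    have : τ (od p) = τ (od q) := by rw [hf, hf, hpq]
    simpa using this
  refine ⟨Equiv.ofBijective f (Finite.injective_iff_bijective.mp hinj), ?_⟩
  ext1 i
  rcases ev_or_od i with ⟨p, rfl⟩ | ⟨p, rfl⟩
  · obtain ⟨q, rfl⟩ := (Finite.injective_iff_bijective.mp hinj).2 p
    rw [matchPerm_ev, ← hf, hτ, od_inj, eq_comm, Equiv.Perm.inv_eq_iff_eq]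
    rfl
  · rw [matchPerm_od, hf]; rfl

open Classical in
/-- The coefficient of `a_x`. -/
noncomputable def coeffAt (C : Set (WD (2 * m))) (x : WD (2 * m)) : (C →₀ ℂ) →ₗ[ℂ] ℂ :=
  if h : x ∈ C then Finsupp.lapply ⟨x, h⟩ else 0

/-- A matching between odd and even vertices is a permutation of `Fin m` with signs. Sign changes in
`WD` remove the signs, and the diagonal `𝔖_m` conjugates the permutation, so one coefficient per
conjugacy class remains. -/
lemma IsDiagVec.eq_zero {k : C₀ m →₀ ℂ} (hk : IsDiagVec k)
    (h : ∀ c : ConjClasses (Equiv.Perm (Fin m)),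
      coeffAt (C₀ m) (permElt (matchPerm (Quotient.out c))) k = 0) : k = 0 := by
  ext w
  change k w = 0
  by_cases hw : IsTrans (w.1 : WB (2 * m)) (odds m)
  swap
  · exact hk.eq_zero_of_not_isTrans w hw
  obtain ⟨hinv, -, hgood⟩ := isGood_of_mem w.2
  set x : WB (2 * m) := (w.1 : WB (2 * m)) with hx
  set e : Fin (2 * m) → ℤˣ := fun j => if j ∈ odds m then x.left j else 1 with he
  -- Changing signs at the odd ends of negative edges stays in `WD` because the product of the edge
  -- signs is `1` on `C₀`.
  have he1 : ∏ j, e j = 1 := by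
    rw [← hgood _ hw, Finset.prod_ite_mem, Finset.univ_inter]
  obtain ⟨τ, hτ⟩ := exists_eq_matchPerm (right_right hinv) hw
  refine hk.eq_zero_of_conj (isDiag_signElt e he1) w ?_
  have h1 : signElt e he1 * w.1 * (signElt e he1)⁻¹ = permElt (matchPerm τ) := by
    apply Subtype.ext
    refine SemidirectProduct.ext ?_ ?_
    · ext1 j
      have := left_conj_apply (signElt e he1 : WB (2 * m)) x j
      rw [right_inv_eq hinv] at this
      refine this.trans ?_
      change e j * x.left j * e (x.right j) = 1
      have h2 := hw j
      by_cases hj : j ∈ odds m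
      · have h3 : x.right j ∉ odds m := fun h' => h2.mp h' hj
        simp [he, hj, h3]
      · have h3 := h2.mpr hj
        simp [he, hj, h3, left_right hinv]
    · rw [← hτ]
      simp [signElt, hx, permElt]
  obtain ⟨g, hg⟩ : ∃ g, g * τ * g⁻¹ = Quotient.out (ConjClasses.mk τ) := by
    have : ConjClasses.mk (Quotient.out (ConjClasses.mk τ)) = ConjClasses.mk τ :=
      Quotient.out_eq _
    exact isConj_iff.mp (ConjClasses.mk_eq_mk_iff_isConj.mp this).symm
  refine hk.eq_zero_of_conj (isDiag_permElt g) _ ?_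
  have h4 := h (ConjClasses.mk τ)
  have h5 : permElt (diagPerm g) * (signElt e he1 * w.1 * (signElt e he1)⁻¹) *
      (permElt (diagPerm g))⁻¹ = permElt (matchPerm (Quotient.out (ConjClasses.mk τ))) := by
    rw [h1, permElt_conj, matchPerm_conj, hg]
  rw [← h5, coeffAt, dif_pos (conj_mem_C₀ _ _ (conj_mem_C₀ _ _ w.2))] at h4
  exact h4

lemma card_conjClasses_le (m : ℕ) [Fintype (ConjClasses (Equiv.Perm (Fin m)))] :
    Fintype.card (ConjClasses (Equiv.Perm (Fin m))) ≤ Fintype.card m.Partition := by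
  classical
  have h := Fintype.card_fin m
  refine le_of_le_of_eq (Fintype.card_le_of_injective
    (fun c => (Quotient.out c : Equiv.Perm (Fin m)).partition) ?_)
    (by rw [h] : Fintype.card (Fintype.card (Fin m)).Partition = Fintype.card m.Partition)
  intro c d hcd
  have := Equiv.Perm.partition_eq_of_isConj.mpr hcd
  have h1 := ConjClasses.mk_eq_mk_iff_isConj.mpr this
  exact (Quotient.out_eq c).symm.trans (h1.trans (Quotient.out_eq d))

/-- The commutant of the involution representation has dimension at most the number of
partitions. -/
lemma finrank_commutant_le (m : ℕ) :
    Module.finrank ℂ (IntertwiningMap (sigmaRep m) (sigmaRep m)) ≤ Fintype.card m.Partition := by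
  classical
  have : Fintype (ConjClasses (Equiv.Perm (Fin m))) := Fintype.ofFinite _
  let F : IntertwiningMap (sigmaRep m) (sigmaRep m) →ₗ[ℂ]
      (ConjClasses (Equiv.Perm (Fin m)) → ℂ) :=
    { toFun := fun T c => coeffAt (C₀ m) (permElt (matchPerm (Quotient.out c))) (T (partVec ∅))
      map_add' := fun T T' => by ext c; simp
      map_smul' := fun a T => by ext c; simp }
  have hF : Function.Injective F := by
    rw [injective_iff_map_eq_zero]
    intro T hT
    refine eq_zero_of_partVec T (IsDiagVec.eq_zero ?_ fun c => congrFun hT c)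
    intro g hg
    rw [← T.isIntertwining, sigmaRep_partVec hg, map_smul]
  have h1 := LinearMap.finrank_le_finrank_of_injective hF
  rw [Module.finrank_fintype_fun_eq_card] at h1
  exact h1.trans (card_conjClasses_le m)

end Commutant

/-! ### The action of signed permutations on monomials -/

section Poly

open Representation MvPolynomial

variable {n : ℕ}

lemma polyRepB_mul (w : WB n) (f g : MvPolynomial (Fin n) ℂ) :
    polyRepB n w (f * g) = polyRepB n w f * polyRepB n w g :=
  map_mul (aeval fun j => C (((w.left (w.right j) : ℤˣ) : ℤ) : ℂ) * X (w.right j) :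
    MvPolynomial (Fin n) ℂ →ₐ[ℂ] MvPolynomial (Fin n) ℂ) f g

lemma polyRepB_C (w : WB n) (c : ℂ) : polyRepB n w (C c) = C c :=
  (aeval fun j => C (((w.left (w.right j) : ℤˣ) : ℤ) : ℂ) * X (w.right j) :
    MvPolynomial (Fin n) ℂ →ₐ[ℂ] MvPolynomial (Fin n) ℂ).commutes c

lemma polyRepB_X (w : WB n) (j : Fin n) :
    polyRepB n w (X j) = C (((w.left (w.right j) : ℤˣ) : ℤ) : ℂ) * X (w.right j) :=
  aeval_X _ j

/-- The sign by which `w` acts on a monomial. -/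
def monSign (w : WB n) (γ : Fin n →₀ ℕ) : ℤˣ := ∏ j, w.left (w.right j) ^ γ j

lemma polyRepB_monomial (w : WB n) (γ : Fin n →₀ ℕ) (c : ℂ) :
    polyRepB n w (monomial γ c) =
      monomial (γ.equivMapDomain w.right) (((monSign w γ : ℤˣ) : ℤ) * c) := by
  have h : polyRepB n w (monomial γ c) = (aeval fun j => C (((w.left (w.right j) : ℤˣ) : ℤ) : ℂ) *
      X (w.right j) : MvPolynomial (Fin n) ℂ →ₐ[ℂ] MvPolynomial (Fin n) ℂ) (monomial γ c) := rfl
  rw [h, aeval_monomial, Finsupp.prod_fintype _ _ fun i => pow_zero _, monomial_eq (s :=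
    γ.equivMapDomain w.right), Finsupp.prod_fintype _ _ fun i => pow_zero _,
    ← Equiv.prod_comp w.right fun i => X i ^ (γ.equivMapDomain w.right) i]
  simp only [mul_pow, Finset.prod_mul_distrib, Finsupp.equivMapDomain_apply,
    Equiv.symm_apply_apply, monSign, ← C_pow]
  rw [← map_prod, algebraMap_eq, ← mul_assoc, ← C_mul]
  congr 2
  push_cast
  ring

lemma coeff_polyRepB (w : WB n) (f : MvPolynomial (Fin n) ℂ) (γ : Fin n →₀ ℕ) :
    coeff (γ.equivMapDomain w.right) (polyRepB n w f) = ((monSign w γ : ℤˣ) : ℤ) * coeff γ f := by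
  classical
  induction f using MvPolynomial.induction_on' with
  | monomial u a =>
    rw [polyRepB_monomial, coeff_monomial, coeff_monomial]
    have : u.equivMapDomain w.right = γ.equivMapDomain w.right ↔ u = γ := by
      constructor
      · intro h
        ext i
        have := DFunLike.congr_fun h (w.right i)
        simpa using this
      · rintro rfl; rfl
    by_cases h : u = γ
    · subst h; simp
    · simp [this, h]
  | add p q hp hq => rw [map_add, coeff_add, coeff_add, hp, hq, mul_add]

lemma exists_eq_equivMapDomain (w : WB n) (d : Fin n →₀ ℕ) :
    ∃ γ : Fin n →₀ ℕ, d = γ.equivMapDomain w.right :=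
  ⟨d.equivMapDomain w.right.symm, by ext i; simp⟩

lemma weight_one_eq_sum (γ : Fin n →₀ ℕ) : Finsupp.weight (1 : Fin n → ℕ) γ = ∑ i, γ i := by
  rw [← Finsupp.degree_eq_sum, Finsupp.degree_eq_weight_one]
  rfl

lemma isHomogeneous_polyRepB (w : WB n) {f : MvPolynomial (Fin n) ℂ} {d : ℕ}
    (hf : f.IsHomogeneous d) : (polyRepB n w f).IsHomogeneous d := by
  intro γ hγ
  obtain ⟨γ, rfl⟩ := exists_eq_equivMapDomain w γ
  rw [coeff_polyRepB] at hγ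
  have h1 := hf (right_ne_zero_of_mul hγ)
  rw [← h1, weight_one_eq_sum, weight_one_eq_sum, ← Equiv.sum_comp w.right]
  simp

/-- The `d`-th symmetric power of the reflection representation. -/
noncomputable def symPow (n d : ℕ) : Subrepresentation (polyRep n) where
  toSubmodule := homogeneousSubmodule (Fin n) ℂ d
  apply_mem_toSubmodule g _ hv := isHomogeneous_polyRepB (g : WB n) hv

instance (n d : ℕ) : FiniteDimensional ℂ (homogeneousSubmodule (Fin n) ℂ d) :=
  Module.Finite.of_fg (homogeneousSubmodule_fg (Fin n) ℂ d)

instance (n d : ℕ) : FiniteDimensional ℂ (symPow n d).toSubmodule :=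
  inferInstanceAs (FiniteDimensional ℂ (homogeneousSubmodule (Fin n) ℂ d))

end Poly

/-! ### Images and compositions of intertwining maps -/

section Embedding

open Representation

variable {G : Type} [Group G] {V W : Type*} [AddCommGroup V] [Module ℂ V]
  [AddCommGroup W] [Module ℂ W] {ρ : Representation ℂ G V} {σ : Representation ℂ G W}

lemma character_range (f : IntertwiningMap ρ σ) (hf : Function.Injective f) :
    f.range.toRepresentation.character = ρ.character := by
  refine (char_iso (Representation.Equiv.mk (LinearEquiv.ofInjective f.toLinearMap hf) ?_)).symm
  intro g
  ext v
  exact f.isIntertwining _ _ g v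

/-- The inclusion of a subrepresentation. -/
def subtypeHom (U : Subrepresentation ρ) : IntertwiningMap U.toRepresentation ρ where
  toLinearMap := U.toSubmodule.subtype
  isIntertwining' _ := rfl

/-- The composition of intertwining maps. -/
def compHom {X : Type*} [AddCommGroup X] [Module ℂ X] {τ : Representation ℂ G X}
    (f : IntertwiningMap σ τ) (g : IntertwiningMap ρ σ) : IntertwiningMap ρ τ where
  toLinearMap := f.toLinearMap ∘ₗ g.toLinearMap
  isIntertwining' x := by
    ext v
    exact (congrArg f (g.isIntertwining _ _ x v)).trans (f.isIntertwining _ _ x (g v))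

end Embedding

/-! ### Every irreducible representation occurs in the polynomials -/

section Occurrence

open Representation MvPolynomial

variable {n : ℕ}

/-- A vector with trivial stabilizer. -/
def regPoint (n : ℕ) (i : Fin n) : ℂ := (i.val : ℂ) + 1

/-- The coordinates `1, 2, …, n` of the regular point are positive and distinct, so a signed
permutation fixing all their values is trivial. Otherwise some variable takes different values, and
it is shifted by a constant. -/
lemma exists_separating (g : WD n) (hg : g ≠ 1) : ∃ p : MvPolynomial (Fin n) ℂ,
    eval (regPoint n) p ≠ 0 ∧ eval (regPoint n) (polyRep n g p) = 0 := by
  have h1 : ∃ j, eval (regPoint n) (polyRep n g (X j)) ≠ regPoint n j := by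
    by_contra! hcon
    apply hg
    have key : ∀ j, (g : WB n).right j = j ∧ (g : WB n).left ((g : WB n).right j) = 1 := by
      intro j
      have h := hcon j
      change eval (regPoint n) (polyRepB n g (X j)) = _ at h
      rw [polyRepB_X, map_mul, eval_C, eval_X, regPoint, regPoint] at h
      rcases Int.units_eq_one_or ((g : WB n).left ((g : WB n).right j)) with h' | h'
      · refine ⟨?_, h'⟩
        rw [h'] at h
        simp only [Units.val_one, Int.cast_one, one_mul, add_left_inj] at h
        exact Fin.ext (by exact_mod_cast h)
      · rw [h'] at h
        have h2 : (((((g : WB n).right j).val : ℤ) + 1 + (j.val + 1) : ℤ) : ℂ) = 0 := by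
          push_cast at h ⊢
          linear_combination -h
        have h3 := Int.cast_eq_zero.mp h2
        omega
    apply Subtype.ext
    refine SemidirectProduct.ext ?_ ?_
    · ext1 i
      have := (key i).2
      rw [(key i).1] at this
      exact this
    · ext1 i
      exact (key i).1
  obtain ⟨j, hj⟩ := h1
  refine ⟨X j - C (eval (regPoint n) (polyRep n g (X j))), ?_, ?_⟩
  · rw [map_sub, eval_X, eval_C]
    exact sub_ne_zero.mpr hj.symm
  · have : polyRep n g (C (eval (regPoint n) (polyRep n g (X j)))) =
        C (eval (regPoint n) (polyRep n g (X j))) := polyRepB_C _ _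
    rw [map_sub, this, map_sub, eval_C, sub_self]

lemma exists_interpolation (n : ℕ) : ∃ p : MvPolynomial (Fin n) ℂ,
    eval (regPoint n) p ≠ 0 ∧ ∀ g : WD n, g ≠ 1 → eval (regPoint n) (polyRep n g p) = 0 := by
  classical
  choose! p hp0 hp using exists_separating (n := n)
  have hmul : ∀ (g : WD n) (s : Finset (WD n)), polyRep n g (∏ h ∈ s, p h) =
      ∏ h ∈ s, polyRep n g (p h) := by
    intro g s
    induction s using Finset.induction_on with
    | empty =>
      have := polyRepB_C (g : WB n) 1
      rw [map_one] at this
      exact this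
    | insert a s ha ih =>
      rw [Finset.prod_insert ha, Finset.prod_insert ha, ← ih]
      exact polyRepB_mul _ _ _
  refine ⟨∏ h ∈ Finset.univ.erase 1, p h, ?_, fun g hg => ?_⟩
  · rw [map_prod]
    exact Finset.prod_ne_zero_iff.mpr fun h hh => hp0 h (Finset.ne_of_mem_erase hh)
  · rw [hmul, map_prod]
    exact Finset.prod_eq_zero (Finset.mem_erase.mpr ⟨hg, Finset.mem_univ _⟩) (hp g hg)

/-- Evaluation at the regular point as a linear form. -/
noncomputable def regEval (n : ℕ) : MvPolynomial (Fin n) ℂ →ₗ[ℂ] ℂ :=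
  (aeval (regPoint n) : MvPolynomial (Fin n) ℂ →ₐ[ℂ] ℂ).toLinearMap

lemma regEval_apply (f : MvPolynomial (Fin n) ℂ) : regEval n f = eval (regPoint n) f := by
  rw [← coe_aeval_eq_eval]; rfl

/-- The map from polynomials to a representation given by evaluation along a regular orbit. -/
noncomputable def orbitHom {V : Type*} [AddCommGroup V] [Module ℂ V]
    (ρ : Representation ℂ (WD n) V) (v : V) : IntertwiningMap (polyRep n) ρ where
  toLinearMap := ∑ g : WD n,
    (regEval n ∘ₗ polyRep n g⁻¹).smulRight (ρ g v)
  isIntertwining' h := by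
    refine LinearMap.ext fun f => ?_
    rw [LinearMap.comp_apply, LinearMap.comp_apply, LinearMap.sum_apply, LinearMap.sum_apply,
      map_sum, ← Equiv.sum_comp (Equiv.mulLeft h)]
    refine Finset.sum_congr rfl fun g _ => ?_
    rw [LinearMap.smulRight_apply, LinearMap.smulRight_apply, map_smul, LinearMap.comp_apply,
      LinearMap.comp_apply, Equiv.coe_mulLeft, map_mul ρ, Module.End.mul_apply,
      ← Module.End.mul_apply (polyRep n (h * g)⁻¹), ← map_mul, mul_inv_rev, inv_mul_cancel_right]

lemma orbitHom_apply {V : Type*} [AddCommGroup V] [Module ℂ V]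
    (ρ : Representation ℂ (WD n) V) (v : V) (f : MvPolynomial (Fin n) ℂ) :
    orbitHom ρ v f = ∑ g : WD n, eval (regPoint n) (polyRep n g⁻¹ f) • ρ g v := by
  change (∑ g : WD n, (regEval n ∘ₗ polyRep n g⁻¹).smulRight (ρ g v)) f = _
  rw [LinearMap.sum_apply]
  refine Finset.sum_congr rfl fun g _ => ?_
  rw [LinearMap.smulRight_apply, LinearMap.comp_apply, regEval_apply]

/-- Every irreducible representation occurs in some symmetric power. -/
lemma IsIrr.exists_symPow {χ : WD n → ℂ} (hχ : IsIrr χ) :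
    ∃ d, ∃ U : Subrepresentation (polyRep n),
      U.toSubmodule ≤ homogeneousSubmodule (Fin n) ℂ d ∧ U.toRepresentation.character = χ := by
  obtain ⟨V, _, _, _, ρ, hρ, rfl⟩ := hχ
  obtain ⟨v, hv⟩ : ∃ v : V, v ≠ 0 := by
    by_contra! hcon
    apply bot_ne_top (α := Subrepresentation ρ)
    apply Subrepresentation.toSubmodule_injective
    ext x
    simp [hcon x]
  obtain ⟨p, hp0, hp⟩ := exists_interpolation n
  -- The interpolating polynomial leaves only the term of the identity, a nonzero multiple of `v`.
  have h1 : orbitHom ρ v p ≠ 0 := by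
    rw [orbitHom_apply, Finset.sum_eq_single 1]
    · simpa [hv] using hp0
    · intro g _ hg
      rw [hp _ (by simpa using hg), zero_smul]
    · simp
  obtain ⟨d, hd⟩ : ∃ d, orbitHom ρ v (homogeneousComponent d p) ≠ 0 := by
    by_contra! hcon
    apply h1
    rw [← sum_homogeneousComponent p, map_sum]
    exact Finset.sum_eq_zero fun d _ => hcon d
  let F : IntertwiningMap (symPow n d).toRepresentation ρ :=
    compHom (orbitHom ρ v) (subtypeHom (symPow n d))
  have hF : F ≠ 0 := by
    intro h0
    exact hd (DFunLike.congr_fun h0 ⟨_, homogeneousComponent_mem d p⟩)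
  -- The pairing is symmetric, so a nonzero map from the symmetric power yields one into it, which
  -- is injective by irreducibility.
  have h2 := ip_ne_zero_of_hom _ _ F hF
  rw [ip_comm] at h2
  obtain ⟨f, hf⟩ := exists_hom_of_ip_ne_zero _ _ h2
  have hinj := (IsIrreducible.injective_or_eq_zero f).resolve_right hf
  refine ⟨d, (compHom (subtypeHom (symPow n d)) f).range, ?_, ?_⟩
  · rintro _ ⟨x, rfl⟩
    exact (f x).2
  · exact character_range _ (Subtype.val_injective.comp hinj)

end Occurrence

/-! ### Combinatorics of the blocks of `2α*` and the longest element -/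

section Blocks

variable {m : ℕ} (α : m.Partition)

lemma sum_card_filter_lt (M : ℕ) (S : Multiset ℕ) (hS : ∀ a ∈ S, a ≤ M) :
    ∑ j ∈ Finset.range M, (S.filter (j < ·)).card = S.sum := by
  induction S using Multiset.induction_on with
  | empty => simp
  | cons a S ih =>
    have ha := hS a (Multiset.mem_cons_self _ _)
    have h1 : ∀ j, ((a ::ₘ S).filter (j < ·)).card =
        (if j < a then 1 else 0) + (S.filter (j < ·)).card := by
      intro j
      by_cases h : j < a
      · rw [Multiset.filter_cons_of_pos _ h, Multiset.card_cons, if_pos h, add_comm]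
      · rw [Multiset.filter_cons_of_neg _ h, if_neg h, zero_add]
    rw [Finset.sum_congr rfl fun j _ => h1 j, Finset.sum_add_distrib,
      ih fun b hb => hS b (Multiset.mem_cons_of_mem hb), Multiset.sum_cons, Finset.sum_boole]
    congr 1
    have : (Finset.range M).filter (· < a) = Finset.range a := by
      ext j; simp; omega
    rw [this]; simp

lemma partialSum_self : partialSum α m = 2 * m := by
  rw [partialSum, ← Finset.mul_sum]
  congr 1
  refine (sum_card_filter_lt m α.parts fun a ha => ?_).trans α.parts_sum
  have := Multiset.le_sum_of_mem ha
  rwa [α.parts_sum] at this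

lemma partialSum_succ (k : ℕ) : partialSum α (k + 1) = partialSum α k + 2 * conjPart α k :=
  Finset.sum_range_succ _ _

lemma partialSum_mono : Monotone (partialSum α) :=
  monotone_nat_of_le_succ fun k => by rw [partialSum_succ]; omega

lemma even_partialSum (k : ℕ) : 2 ∣ partialSum α k := by
  rw [partialSum, ← Finset.mul_sum]
  exact dvd_mul_right _ _

/-- The index of the block containing `i`. -/
def blk (i : Fin (2 * m)) : ℕ := Nat.findGreatest (fun k => partialSum α k ≤ i.val) m

lemma partialSum_blk_le (i : Fin (2 * m)) : partialSum α (blk α i) ≤ i.val :=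
  Nat.findGreatest_spec (P := fun k => partialSum α k ≤ i.val) (Nat.zero_le m) (by simp [partialSum])

/-- The search bound `m` in `blk` suffices because the first `m` parts already exhaust `2 * m`. -/
lemma lt_partialSum_blk (i : Fin (2 * m)) : i.val < partialSum α (blk α i + 1) := by
  by_contra! hcon
  rcases lt_or_ge (blk α i) m with h | h
  · have := Nat.le_findGreatest (P := fun k => partialSum α k ≤ i.val) (n := m) h hcon
    exact absurd this (by unfold blk; omega)
  · have h1 := partialSum_mono α (show m ≤ blk α i + 1 by omega)
    rw [partialSum_self] at h1
    have := i.2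
    omega

lemma mem_Ico_iff (k : ℕ) (i : Fin (2 * m)) :
    i.val ∈ Set.Ico (partialSum α k) (partialSum α (k + 1)) ↔ blk α i = k := by
  have h1 := partialSum_blk_le α i
  have h2 := lt_partialSum_blk α i
  rw [Set.mem_Ico]
  constructor
  · rintro ⟨h3, h4⟩
    by_contra hne
    rcases lt_or_gt_of_ne hne with h | h
    · have := partialSum_mono α (show blk α i + 1 ≤ k from h)
      omega
    · have := partialSum_mono α (show k + 1 ≤ blk α i from h)
      omega
  · rintro rfl
    exact ⟨h1, h2⟩

lemma mem_young {w : WD (2 * m)} : w ∈ young α ↔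
    (w : WB (2 * m)).left = 1 ∧ ∀ i, blk α ((w : WB (2 * m)).right i) = blk α i := by
  change (_ ∧ _) ↔ _
  simp only [mem_Ico_iff]
  refine and_congr_right fun _ => ⟨fun h i => (h (blk α i) i).mpr rfl, fun h k i => by rw [h]⟩

lemma permElt_mem_young {τ : Equiv.Perm (Fin (2 * m))} :
    permElt τ ∈ young α ↔ ∀ i, blk α (τ i) = blk α i := by
  rw [mem_young]
  exact ⟨fun h => h.2, fun h => ⟨rfl, h⟩⟩

lemma eq_permElt {w : WD (2 * m)} (hw : w ∈ young α) : w = permElt (w : WB (2 * m)).right :=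
  Subtype.ext (SemidirectProduct.ext ((mem_young α).mp hw).1 rfl)

lemma blk_mono {i j : Fin (2 * m)} (h : i ≤ j) : blk α i ≤ blk α j := by
  by_contra! hcon
  have h1 := lt_partialSum_blk α j
  have h2 := partialSum_blk_le α i
  have h3 := partialSum_mono α (show blk α j + 1 ≤ blk α i from hcon)
  have : i.val ≤ j.val := h
  omega

/-- The position of `i` inside its block. -/
def pos (i : Fin (2 * m)) : ℕ := i.val - partialSum α (blk α i)

lemma pos_add (i : Fin (2 * m)) : pos α i + partialSum α (blk α i) = i.val := by
  have := partialSum_blk_le α i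
  unfold pos; omega

lemma pos_lt (i : Fin (2 * m)) : pos α i < 2 * conjPart α (blk α i) := by
  have h1 := lt_partialSum_blk α i
  have h2 := pos_add α i
  rw [partialSum_succ] at h1
  omega

lemma eq_of_blk_pos {i j : Fin (2 * m)} (h : blk α i = blk α j) (h' : pos α i = pos α j) :
    i = j := by
  have h1 := pos_add α i
  have h2 := pos_add α j
  rw [h, h'] at h1
  exact Fin.ext (by omega)

lemma partialSum_add_lt {b d : ℕ} (h : d < 2 * conjPart α b) : partialSum α b + d < 2 * m := by
  rcases lt_or_ge b m with hb | hb
  · have h1 := partialSum_mono α (show b + 1 ≤ m from hb)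
    rw [partialSum_self, partialSum_succ] at h1
    omega
  · have : conjPart α b = 0 := by
      rw [conjPart, Multiset.card_eq_zero, Multiset.filter_eq_nil]
      intro a ha
      have := Multiset.le_sum_of_mem ha
      rw [α.parts_sum] at this
      omega
    omega

lemma exists_pos_eq {b d : ℕ} (h : d < 2 * conjPart α b) : ∃ i, blk α i = b ∧ pos α i = d := by
  have h1 := partialSum_add_lt α h
  have h2 : blk α ⟨_, h1⟩ = b := by
    rw [← mem_Ico_iff, Set.mem_Ico, partialSum_succ]
    exact ⟨by simp, by simpa using h⟩
  refine ⟨⟨_, h1⟩, h2, ?_⟩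
  rw [pos, h2]
  simp

/-- The number of elements of the block of `i` on which `γ` is smaller than at `i`. -/
def blkRank (γ : Fin (2 * m) → ℕ) (i : Fin (2 * m)) : ℕ :=
  (Finset.univ.filter fun j => blk α j = blk α i ∧ γ j < γ i).card

/-- `γ` takes distinct values on every block. -/
def BlkInj (γ : Fin (2 * m) → ℕ) : Prop := ∀ i j, blk α i = blk α j → γ i = γ j → i = j

lemma blkInj_pos : BlkInj α (pos α) := fun _ _ => eq_of_blk_pos α

-- The elements of the block with smaller value take distinct values in `{0, …, γ i - 1}`.
variable {α} in
lemma BlkInj.blkRank_le {γ : Fin (2 * m) → ℕ} (h : BlkInj α γ) (i : Fin (2 * m)) :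
    blkRank α γ i ≤ γ i := by
  rw [← Finset.card_range (γ i)]
  refine Finset.card_le_card_of_injOn γ (fun j hj => ?_) fun j hj k hk hjk => ?_
  · simp only [Finset.coe_filter, Finset.mem_univ, true_and, Set.mem_ofPred_eq] at hj
    simpa using hj.2
  · simp only [Finset.coe_filter, Finset.mem_univ, true_and, Set.mem_ofPred_eq] at hj hk
    exact h j k (hj.1.trans hk.1.symm) hjk

lemma blkRank_pos (i : Fin (2 * m)) : blkRank α (pos α) i = pos α i := by
  refine le_antisymm ((blkInj_pos α).blkRank_le i) ?_
  rw [← Finset.card_range (pos α i)]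
  refine Finset.card_le_card_of_surjOn (pos α) fun d hd => ?_
  have hd' : d < pos α i := by simpa using hd
  obtain ⟨j, hj, hj'⟩ := exists_pos_eq α (hd'.trans (pos_lt α i))
  exact ⟨j, by simp [hj, hj', hd'], hj'⟩

-- Each ordered pair of distinct elements of a block is counted once, as smaller or as larger. The
-- right side does not involve `γ`, so the sum of ranks can be evaluated on the positions.
variable {α} in
lemma BlkInj.two_mul_sum_blkRank {γ : Fin (2 * m) → ℕ} (h : BlkInj α γ) :
    2 * ∑ i, blkRank α γ i =
      ∑ i, (Finset.univ.filter fun j => blk α j = blk α i ∧ j ≠ i).card := by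
  have h1 : ∑ i, blkRank α γ i =
      ∑ i, (Finset.univ.filter fun j => blk α j = blk α i ∧ γ i < γ j).card := by
    simp only [blkRank, Finset.card_filter]
    rw [Finset.sum_comm]
    simp only [eq_comm]
  rw [two_mul]
  nth_rewrite 2 [h1]
  rw [← Finset.sum_add_distrib]
  refine Finset.sum_congr rfl fun i _ => ?_
  rw [blkRank, ← Finset.card_union_of_disjoint]
  · congr 1
    ext j
    simp only [Finset.mem_union, Finset.mem_filter, Finset.mem_univ, true_and]
    constructor
    · rintro (⟨h2, h3⟩ | ⟨h2, h3⟩)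
      · exact ⟨h2, by rintro rfl; omega⟩
      · exact ⟨h2, by rintro rfl; omega⟩
    · rintro ⟨h2, h3⟩
      have : γ j ≠ γ i := fun h' => h3 (h j i h2 h')
      rcases lt_or_gt_of_ne this with h4 | h4
      · exact Or.inl ⟨h2, h4⟩
      · exact Or.inr ⟨h2, h4⟩
  · rw [Finset.disjoint_filter]
    rintro j _ ⟨-, h2⟩ ⟨-, h3⟩
    omega

/-- The sum of the positions, i.e. the number of inversions of the longest element of the Young
subgroup. -/
def posSum : ℕ := ∑ i, pos α i

variable {α} in
lemma BlkInj.sum_blkRank {γ : Fin (2 * m) → ℕ} (h : BlkInj α γ) :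
    ∑ i, blkRank α γ i = posSum α := by
  have h1 := h.two_mul_sum_blkRank
  have h2 := (blkInj_pos α).two_mul_sum_blkRank
  rw [← h1, Finset.sum_congr rfl fun i _ => blkRank_pos α i] at h2
  have h3 : posSum α = Finset.univ.sum (pos α) := rfl
  rw [h3]
  omega

variable {α} in
lemma BlkInj.posSum_le {γ : Fin (2 * m) → ℕ} (h : BlkInj α γ) : posSum α ≤ ∑ i, γ i := by
  rw [← h.sum_blkRank]
  exact Finset.sum_le_sum fun i _ => h.blkRank_le i

variable {α} in
/-- Exponents which are distinct on the blocks and of minimal sum are a rearrangement of the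
positions by an element of the Young subgroup. -/
lemma BlkInj.exists_perm {γ : Fin (2 * m) → ℕ} (h : BlkInj α γ) (hs : ∑ i, γ i = posSum α) :
    ∃ τ : Equiv.Perm (Fin (2 * m)), (∀ i, blk α (τ i) = blk α i) ∧ ∀ i, pos α (τ i) = γ i := by
  -- Minimality forces equality in the termwise bound, so `γ` is its own rank function and its
  -- values are positions in the block.
  have h1 : ∀ i, γ i = blkRank α γ i := fun i =>
    ((Finset.sum_eq_sum_iff_of_le fun i _ => h.blkRank_le i).mp
      (h.sum_blkRank.trans hs.symm) i (Finset.mem_univ i)).symm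
  have h2 : ∀ i, γ i < 2 * conjPart α (blk α i) := by
    intro i
    rw [h1, ← Finset.card_range (2 * conjPart α (blk α i))]
    calc blkRank α γ i < (Finset.univ.filter fun j => blk α j = blk α i).card := by
          refine Finset.card_lt_card ⟨fun j hj => ?_, fun h' => ?_⟩
          · simp only [Finset.mem_filter, Finset.mem_univ, true_and] at hj ⊢
            exact hj.1
          · have := h' (Finset.mem_filter.mpr ⟨Finset.mem_univ i, rfl⟩)
            simp at this
      _ ≤ _ := by
          refine Finset.card_le_card_of_injOn (pos α) (fun j hj => ?_) fun j hj k hk hjk => ?_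
          · have hj' : blk α j = blk α i := by simpa using hj
            simpa [hj'] using pos_lt α j
          · have hj' : blk α j = blk α i := by simpa using hj
            have hk' : blk α k = blk α i := by simpa using hk
            exact eq_of_blk_pos α (hj'.trans hk'.symm) hjk
  choose f hf hf' using fun i => exists_pos_eq α (h2 i)
  have hinj : Function.Injective f := by
    intro i j hij
    refine h i j ?_ ?_
    · rw [← hf i, ← hf j, hij]
    · rw [← hf' i, ← hf' j, hij]
  exact ⟨Equiv.ofBijective f (Finite.injective_iff_bijective.mp hinj), hf, hf'⟩

/-- The pairs `i < j` in the same block. -/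
def blkPairs : Finset (Fin (2 * m) × Fin (2 * m)) :=
  Finset.univ.filter fun x => blk α x.1 = blk α x.2 ∧ x.1 < x.2

lemma pos_lt_pos_iff {i j : Fin (2 * m)} (h : blk α i = blk α j) : pos α i < pos α j ↔ i < j := by
  have h1 := pos_add α i
  have h2 := pos_add α j
  rw [h] at h1
  rw [Fin.lt_def]
  omega

lemma card_blkPairs : (blkPairs α).card = posSum α := by
  rw [← (blkInj_pos α).sum_blkRank, blkPairs, Finset.card_filter, Fintype.sum_prod_type_right]
  refine Finset.sum_congr rfl fun j _ => ?_
  rw [blkRank, Finset.card_filter]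
  refine Finset.sum_congr rfl fun i _ => if_congr ?_ rfl rfl
  exact and_congr_right fun h => (pos_lt_pos_iff α h).symm

/-- The root `e_j - e_i`. -/
def pairRoot {n : ℕ} (x : Fin n × Fin n) : Fin n → ℤ := ee x.2 - ee x.1

lemma pairRoot_injOn : Set.InjOn pairRoot (blkPairs α : Set (Fin (2 * m) × Fin (2 * m))) := by
  rintro ⟨i, j⟩ hx ⟨k, l⟩ hy h
  have hij : i ≠ j := by
    have : i < j := by simpa [blkPairs] using (Finset.mem_filter.mp hx).2.2
    exact this.ne
  have h1 := congrFun h i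
  have h2 := congrFun h j
  simp only [pairRoot, Pi.sub_apply, ee, Pi.single_apply, hij, hij.symm, if_true, if_false] at h1 h2
  have : i = k := by
    by_contra hne
    rw [if_neg hne] at h1
    split_ifs at h1 <;> omega
  have : j = l := by
    by_contra hne
    rw [if_neg hne] at h2
    split_ifs at h2 <;> omega
  simp_all

lemma act_permElt_ee {n : ℕ} (τ : Equiv.Perm (Fin n)) (i : Fin n) :
    act (permElt τ : WB n) (ee i) = ee (τ i) := by
  rw [act_ee]; simp [permElt]

lemma permElt_inv {n : ℕ} (τ : Equiv.Perm (Fin n)) :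
    ((permElt τ : WD n) : WB n)⁻¹ = (permElt τ⁻¹ : WD n) := by
  refine SemidirectProduct.ext ?_ rfl
  ext1 i
  rw [left_inv_apply]; rfl

/-- A permutation keeps roots `e_i + e_j` positive. Block indices increase with the vertex and are
preserved by `τ`, so an inverted pair must share its block. -/
lemma invSet_subset {τ : Equiv.Perm (Fin (2 * m))} (hτ : ∀ i, blk α (τ i) = blk α i)
    (v : Fin (2 * m) → ℤ) (hv : v ∈ posRoots (2 * m)) (hneg : ht (act (permElt τ : WB (2 * m)) v) < 0) :
    v ∈ (blkPairs α).image pairRoot := by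
  obtain ⟨⟨i, j, hij, a, b, rfl⟩, hpos⟩ := mem_posRoots.mp hv
  have key : ∀ i j : Fin (2 * m), i ≠ j → 0 < ht (ee i - ee j) →
      ht (ee (τ i) - ee (τ j)) < 0 → ee i - ee j ∈ (blkPairs α).image pairRoot := by
    intro i j hij h1 h2
    rw [map_sub, ht_ee, ht_ee] at h1 h2
    have hji : j < i := by rw [Fin.lt_def]; omega
    have hτij : τ i < τ j := by rw [Fin.lt_def]; omega
    refine Finset.mem_image.mpr ⟨(j, i), ?_, rfl⟩
    simp only [blkPairs, Finset.mem_filter, Finset.mem_univ, true_and]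
    refine ⟨le_antisymm (blk_mono α hji.le) ?_, hji⟩
    rw [← hτ i, ← hτ j]
    exact blk_mono α hτij.le
  rw [map_add, map_smul, map_smul, act_permElt_ee, act_permElt_ee] at hneg
  rcases Int.units_eq_one_or a with rfl | rfl <;> rcases Int.units_eq_one_or b with rfl | rfl
  · simp [ht_ee] at hneg; omega
  · simp only [Units.val_one, one_smul, Units.val_neg, neg_smul, ← sub_eq_add_neg] at hpos hneg ⊢
    exact key i j hij hpos hneg
  · simp only [Units.val_one, one_smul, Units.val_neg, neg_smul, neg_add_eq_sub] at hpos hneg ⊢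
    exact key j i hij.symm hpos hneg
  · simp [ht_ee] at hpos; omega

lemma invCount_le {w : WD (2 * m)} (hw : w ∈ young α) : invCount (w : WB (2 * m)) ≤ posSum α := by
  classical
  rw [← card_blkPairs, ← Finset.card_image_of_injOn (pairRoot_injOn α)]
  refine Finset.card_le_card fun v hv => ?_
  rw [eq_permElt α hw, permElt_inv] at hv
  obtain ⟨h1, h2⟩ := Finset.mem_filter.mp hv
  refine invSet_subset α (fun i => ?_) v h1 h2
  have := ((mem_young α).mp hw).2 ((w : WB (2 * m)).right⁻¹ i)
  rw [← this]
  simp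

/-- The reversal of all blocks. -/
def blkRev (i : Fin (2 * m)) : Fin (2 * m) :=
  ⟨partialSum α (blk α i) + (2 * conjPart α (blk α i) - 1 - pos α i),
    partialSum_add_lt α (by have := pos_lt α i; omega)⟩

lemma blk_blkRev (i : Fin (2 * m)) : blk α (blkRev α i) = blk α i := by
  have := pos_lt α i
  rw [← mem_Ico_iff, Set.mem_Ico, partialSum_succ]
  simp only [blkRev]
  omega

lemma blkRev_blkRev (i : Fin (2 * m)) : blkRev α (blkRev α i) = i := by
  have h1 := pos_lt α i
  have h2 := pos_add α i
  have h3 := pos_add α (blkRev α i)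
  have h4 : (blkRev α i).val =
    partialSum α (blk α i) + (2 * conjPart α (blk α i) - 1 - pos α i) := rfl
  rw [blk_blkRev] at h3
  ext
  change partialSum α (blk α (blkRev α i)) +
    (2 * conjPart α (blk α (blkRev α i)) - 1 - pos α (blkRev α i)) = i.val
  rw [blk_blkRev]
  omega

/-- The permutation reversing all blocks. -/
def revPerm : Equiv.Perm (Fin (2 * m)) :=
  Function.Involutive.toPerm (blkRev α) (blkRev_blkRev α)

lemma revPerm_lt {i j : Fin (2 * m)} (h : blk α i = blk α j) (hij : i < j) :
    revPerm α j < revPerm α i := by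
  have h1 := pos_add α i
  have h2 := pos_add α j
  have h3 := pos_lt α j
  rw [h] at h1
  have : i.val < j.val := hij
  change (blkRev α j).val < (blkRev α i).val
  simp only [blkRev, h]
  omega

lemma invCount_revPerm : invCount (permElt (revPerm α) : WB (2 * m)) = posSum α := by
  classical
  have hmem : permElt (revPerm α) ∈ young α := (permElt_mem_young α).mpr (blk_blkRev α)
  refine le_antisymm (invCount_le α hmem) ?_
  rw [← card_blkPairs, ← Finset.card_image_of_injOn (pairRoot_injOn α)]
  refine Finset.card_le_card fun v hv => ?_
  obtain ⟨⟨i, j⟩, hx, rfl⟩ := Finset.mem_image.mp hv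
  simp only [blkPairs, Finset.mem_filter, Finset.mem_univ, true_and] at hx
  have h1 := revPerm_lt α hx.1 hx.2
  have h2 : (revPerm α)⁻¹ = revPerm α := rfl
  rw [Finset.mem_filter, mem_posRoots, permElt_inv, h2, pairRoot, map_sub, map_sub, act_permElt_ee,
    act_permElt_ee, map_sub, ht_ee, ht_ee, ht_ee, ht_ee]
  have h3 : i.val < j.val := hx.2
  have h4 : (revPerm α j).val < (revPerm α i).val := h1
  refine ⟨⟨⟨j, i, hx.2.ne', 1, -1, by simp [sub_eq_add_neg]⟩, ?_⟩, ?_⟩ <;> simp only <;> omega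

/-- The length of a longest element of the Young subgroup. -/
lemma len_longest (hm : 1 ≤ m) {w₀ : WD (2 * m)} (hw₀ : w₀ ∈ young α)
    (hmax : ∀ w ∈ young α, len w ≤ len w₀) : len w₀ = posSum α := by
  have h1 := hmax _ ((permElt_mem_young α).mpr (blk_blkRev α) : permElt (revPerm α) ∈ young α)
  rw [len_eq (by omega), len_eq (by omega), invCount_revPerm] at h1
  rw [len_eq (by omega)]
  exact le_antisymm (invCount_le α hw₀) h1

lemma exists_longest (hm : 1 ≤ m) :
    ∃ w₀ ∈ young α, (∀ w ∈ young α, len w ≤ len w₀) ∧ len w₀ = posSum α := by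
  refine ⟨permElt (revPerm α), (permElt_mem_young α).mpr (blk_blkRev α), fun w hw => ?_, ?_⟩
  · rw [len_eq (by omega), len_eq (by omega), invCount_revPerm]
    exact invCount_le α hw
  · rw [len_eq (by omega), invCount_revPerm]

/-- Blocks begin and end at even numbers, which is why `σ` belongs to every Young subgroup
considered. -/
lemma blk_od (p : Fin m) : blk α (od p) = blk α (ev p) := by
  obtain ⟨c, hc⟩ := even_partialSum α (blk α (ev p))
  obtain ⟨d, hd⟩ := even_partialSum α (blk α (ev p) + 1)
  have h1 := partialSum_blk_le α (ev p)
  have h2 := lt_partialSum_blk α (ev p)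
  rw [← mem_Ico_iff, Set.mem_Ico]
  simp only [ev_val, od_val] at *
  omega

lemma pos_ev_even (p : Fin m) : pos α (ev p) % 2 = 0 := by
  obtain ⟨c, hc⟩ := even_partialSum α (blk α (ev p))
  have := pos_add α (ev p)
  rw [ev_val] at this
  omega

lemma pos_od (p : Fin m) : pos α (od p) = pos α (ev p) + 1 := by
  have h1 := pos_add α (ev p)
  have h2 := pos_add α (od p)
  rw [blk_od] at h2
  simp only [ev_val, od_val] at *
  omega

/-- The partition is determined by the numbers of vertices at given positions. -/
lemma card_pos_eq (d : ℕ) : (Finset.univ.filter fun i => pos α i = d).card =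
    ((Finset.range m).filter fun k => d < 2 * conjPart α k).card := by
  refine Finset.card_nbij (blk α) ?_ ?_ ?_
  · intro i hi
    have hi' : pos α i = d := by simpa using hi
    have h1 := pos_lt α i
    simp only [Finset.coe_filter, Finset.mem_range, Set.mem_ofPred_eq]
    refine ⟨?_, hi' ▸ h1⟩
    by_contra! hcon
    have h2 := partialSum_mono α hcon
    rw [partialSum_self] at h2
    have h3 := partialSum_blk_le α i
    have := i.2
    omega
  · intro i hi j hj hij
    have hi' : pos α i = d := by simpa using hi
    have hj' : pos α j = d := by simpa using hj
    exact eq_of_blk_pos α hij (hi'.trans hj'.symm)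
  · intro k hk
    have hk' : k < m ∧ d < 2 * conjPart α k := by simpa using hk
    obtain ⟨i, hi, hi'⟩ := exists_pos_eq α hk'.2
    exact ⟨i, by simpa using hi', hi⟩

lemma conjPart_antitone : Antitone (conjPart α) := by
  intro a b hab
  refine Multiset.card_le_card (Multiset.monotone_filter_right _ fun c hc => ?_)
  omega

/-- The number of vertices at position `d` is the number of blocks of size greater than `d`. As the
parts decrease, these numbers determine each of them, and differences of successive parts of `α*`
count the parts of `α`. -/
lemma partition_ext {α β : m.Partition}
    (h : ∀ d, (Finset.univ.filter fun i => pos α i = d).card =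
      (Finset.univ.filter fun i => pos β i = d).card) : α = β := by
  classical
  have hlt : ∀ (γ : m.Partition) (k d : ℕ), k < m → (d < 2 * conjPart γ k ↔
      k < (Finset.univ.filter fun i => pos γ i = d).card) := by
    intro γ k d hk
    rw [card_pos_eq]
    constructor
    · intro h1
      have : Finset.range (k + 1) ⊆ (Finset.range m).filter fun k => d < 2 * conjPart γ k := by
        intro l hl
        simp only [Finset.mem_range, Finset.mem_filter] at hl ⊢
        have := conjPart_antitone γ (show l ≤ k by omega)
        omega
      have := Finset.card_le_card this
      rw [Finset.card_range] at this
      omega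
    · intro h1
      by_contra hcon
      have : ((Finset.range m).filter fun k => d < 2 * conjPart γ k) ⊆ Finset.range k := by
        intro l hl
        simp only [Finset.mem_range, Finset.mem_filter] at hl ⊢
        by_contra hlk
        have := conjPart_antitone γ (show k ≤ l by omega)
        omega
      have := Finset.card_le_card this
      rw [Finset.card_range] at this
      omega
  have hzero : ∀ (γ : m.Partition) (k : ℕ), m ≤ k → conjPart γ k = 0 := by
    intro γ k hk
    rw [conjPart, Multiset.card_eq_zero, Multiset.filter_eq_nil]
    intro a ha
    have := Multiset.le_sum_of_mem ha
    rw [γ.parts_sum] at this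
    omega
  have hconj : ∀ k, conjPart α k = conjPart β k := by
    intro k
    rcases lt_or_ge k m with hk | hk
    · have h1 : ∀ d, d < 2 * conjPart α k ↔ d < 2 * conjPart β k := fun d => by
        rw [hlt α k d hk, hlt β k d hk, h]
      have h2 := h1 (2 * conjPart α k)
      have h3 := h1 (2 * conjPart β k)
      omega
    · rw [hzero α k hk, hzero β k hk]
  have hcount : ∀ (γ : m.Partition) (k : ℕ),
      conjPart γ k = γ.parts.count (k + 1) + conjPart γ (k + 1) := by
    intro γ k
    simp only [conjPart, ← Multiset.countP_eq_card_filter]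
    induction γ.parts using Multiset.induction_on with
    | empty => simp
    | cons a S ih =>
      simp only [Multiset.countP_cons, Multiset.count_cons]
      split_ifs <;> omega
  ext1
  ext a
  cases a with
  | zero =>
    rw [Multiset.count_eq_zero_of_notMem fun h => absurd (α.parts_pos h) (by omega),
      Multiset.count_eq_zero_of_notMem fun h => absurd (β.parts_pos h) (by omega)]
  | succ k =>
    have h1 := hcount α k
    have h2 := hcount β k
    rw [hconj, hconj] at h1
    omega

end Blocks

/-! ### Polynomials that are antisymmetric under the Young subgroup -/

section SemiInvariants

open Representation MvPolynomial

variable {m : ℕ} (α : m.Partition)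

noncomputable instance : Fintype (young α) := Fintype.ofFinite _

/-- The sign character of the Young subgroup, as a linear character. -/
def lam : young α →* ℂˣ :=
  (Units.map (Int.castRingHom ℂ : ℤ →* ℂ)).comp (Equiv.Perm.sign.comp
    (SemidirectProduct.rightHom.comp ((WD (2 * m)).subtype.comp (young α).subtype)))

lemma lam_coe (h : young α) : (lam α h : ℂ) = youngSign α h := rfl

/-- The exponents of the monomial given by the positions inside the blocks. -/
noncomputable def posExp : Fin (2 * m) →₀ ℕ := Finsupp.equivFunOnFinite.symm (pos α)

@[simp] lemma posExp_apply (i : Fin (2 * m)) : posExp α i = pos α i := rfl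

lemma monSign_permElt {n : ℕ} (τ : Equiv.Perm (Fin n)) (γ : Fin n →₀ ℕ) :
    monSign (permElt τ : WB n) γ = 1 :=
  Finset.prod_eq_one fun _ _ => one_pow _

lemma polyRep_permElt_monomial {n : ℕ} (τ : Equiv.Perm (Fin n)) (γ : Fin n →₀ ℕ) (c : ℂ) :
    polyRep n (permElt τ) (monomial γ c) = monomial (γ.equivMapDomain τ) c := by
  have h := polyRepB_monomial (permElt τ : WB n) γ c
  rw [monSign_permElt, Units.val_one, Int.cast_one, one_mul] at h
  exact h

lemma coeff_polyRep_permElt {n : ℕ} (τ : Equiv.Perm (Fin n)) (f : MvPolynomial (Fin n) ℂ)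
    (γ : Fin n →₀ ℕ) :
    coeff (γ.equivMapDomain τ) (polyRep n (permElt τ) f) = coeff γ f := by
  have h := coeff_polyRepB (permElt τ : WB n) f γ
  rw [monSign_permElt, Units.val_one, Int.cast_one, one_mul] at h
  exact h

/-- The polynomials on which the Young subgroup acts through its sign character. -/
abbrev IsAnti (f : MvPolynomial (Fin (2 * m)) ℂ) : Prop :=
  IsSemiInv (young α) (lam α) (polyRep (2 * m)) f

variable {α}

lemma IsAnti.coeff_perm {f : MvPolynomial (Fin (2 * m)) ℂ} (hf : IsAnti α f)
    {τ : Equiv.Perm (Fin (2 * m))} (hτ : ∀ i, blk α (τ i) = blk α i) (γ : Fin (2 * m) →₀ ℕ) :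
    coeff γ f = ((Equiv.Perm.sign τ : ℤ) : ℂ) * coeff (γ.equivMapDomain τ) f := by
  have h1 := hf ⟨permElt τ, (permElt_mem_young α).mpr hτ⟩
  rw [← coeff_polyRep_permElt τ f γ]
  exact (congrArg (coeff (γ.equivMapDomain τ)) h1).trans (coeff_smul _ _ _)

/-- A transposition of two equal exponents in a block fixes the monomial but must negate its
coefficient. -/
lemma IsAnti.blkInj {f : MvPolynomial (Fin (2 * m)) ℂ} (hf : IsAnti α f)
    {γ : Fin (2 * m) →₀ ℕ} (hγ : coeff γ f ≠ 0) : BlkInj α γ := by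
  intro i j hij hγij
  by_contra hne
  have h1 : ∀ k, blk α (Equiv.swap i j k) = blk α k := by
    intro k
    rw [Equiv.swap_apply_def]
    split_ifs with h h' <;> simp_all
  have h2 : γ.equivMapDomain (Equiv.swap i j) = γ := by
    ext k
    rw [Finsupp.equivMapDomain_apply, Equiv.symm_swap, Equiv.swap_apply_def]
    split_ifs with h h' <;> simp_all
  have h3 := hf.coeff_perm h1 γ
  rw [h2, Equiv.Perm.sign_swap hne] at h3
  apply hγ
  push_cast at h3
  linear_combination (1 / 2 : ℂ) * h3

lemma IsAnti.posSum_le {f : MvPolynomial (Fin (2 * m)) ℂ} (hf : IsAnti α f) (h0 : f ≠ 0) {d : ℕ}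
    (hd : f.IsHomogeneous d) : posSum α ≤ d := by
  obtain ⟨γ, hγ⟩ := ne_zero_iff.mp h0
  rw [← hd hγ, weight_one_eq_sum]
  exact (hf.blkInj hγ).posSum_le

/-- In the minimal degree all exponents that occur are rearrangements of the positions within
blocks, so every coefficient is that of `posExp α` up to sign. -/
lemma IsAnti.eq_zero {f : MvPolynomial (Fin (2 * m)) ℂ} (hf : IsAnti α f)
    (hd : f.IsHomogeneous (posSum α)) (hc : coeff (posExp α) f = 0) : f = 0 := by
  by_contra h0
  obtain ⟨γ, hγ⟩ := ne_zero_iff.mp h0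
  obtain ⟨τ, h1, h2⟩ := (hf.blkInj hγ).exists_perm (by rw [← hd hγ, weight_one_eq_sum])
  have h3 : γ.equivMapDomain τ = posExp α := by
    ext i
    obtain ⟨j, rfl⟩ := τ.surjective i
    rw [posExp_apply, h2]
    simp
  rw [hf.coeff_perm h1, h3, hc, mul_zero] at hγ
  exact hγ rfl

variable (α)

/-- The antisymmetrization over the Young subgroup of the monomial given by the positions. -/
noncomputable def anti : MvPolynomial (Fin (2 * m)) ℂ :=
  ∑ h : young α, (lam α h : ℂ) • polyRep (2 * m) h (monomial (posExp α) 1)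

lemma isAnti_anti : IsAnti α (anti α) := by
  intro g
  rw [anti, map_sum, Finset.smul_sum]
  refine Fintype.sum_equiv (Equiv.mulLeft g) _ _ fun h => ?_
  have h1 : (lam α g : ℂ) * lam α g = 1 := by
    rw [lam_coe, youngSign, ← Int.cast_mul, ← Units.val_mul, Int.units_mul_self]
    simp
  rw [Equiv.coe_mulLeft, map_smul, map_mul, Units.val_mul, smul_smul, ← mul_assoc, h1, one_mul,
    Subgroup.coe_mul, map_mul]
  rfl

lemma polyRep_young (h : young α) (γ : Fin (2 * m) →₀ ℕ) :
    polyRep (2 * m) h (monomial γ 1) =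
      monomial (γ.equivMapDomain ((h : WD (2 * m)) : WB (2 * m)).right) 1 := by
  rw [eq_permElt α h.2, polyRep_permElt_monomial]
  rfl

lemma sum_posExp : ∑ i, posExp α i = posSum α := rfl

lemma isHomogeneous_anti : (anti α).IsHomogeneous (posSum α) := by
  refine (homogeneousSubmodule (Fin (2 * m)) ℂ (posSum α)).sum_mem fun h _ =>
    Submodule.smul_mem _ _ (isHomogeneous_polyRepB _ ?_)
  refine isHomogeneous_monomial _ ?_
  rw [Finsupp.degree_eq_sum, sum_posExp]

lemma blk_right (h : young α) (i : Fin (2 * m)) :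
    blk α (((h : WD (2 * m)) : WB (2 * m)).right i) = blk α i := ((mem_young α).mp h.2).2 i

lemma blk_right_symm (h : young α) (i : Fin (2 * m)) :
    blk α (((h : WD (2 * m)) : WB (2 * m)).right.symm i) = blk α i := by
  rw [← blk_right α h (((h : WD (2 * m)) : WB (2 * m)).right.symm i), Equiv.apply_symm_apply]

/-- Block and position determine a vertex, so only the identity of the Young subgroup fixes the
monomial and nothing cancels. -/
lemma coeff_anti : coeff (posExp α) (anti α) = 1 := by
  classical
  rw [anti, coeff_sum, Finset.sum_eq_single 1]
  · simp
  · intro h _ hne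
    rw [coeff_smul, polyRep_young, coeff_monomial, if_neg, smul_zero]
    intro h1
    apply hne
    refine Subtype.ext ((eq_permElt α h.2).trans ?_)
    refine Subtype.ext (SemidirectProduct.ext rfl ?_)
    ext1 i
    refine eq_of_blk_pos α (blk_right α h i) ?_
    have := DFunLike.congr_fun h1 (((h : WD (2 * m)) : WB (2 * m)).right i)
    have h2 : pos α (((h : WD (2 * m)) : WB (2 * m)).right i) = pos α i := by simpa using this.symm
    exact h2
  · simp

lemma anti_ne_zero : anti α ≠ 0 := fun h => by
  have := coeff_anti α
  rw [h] at this
  simp at this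

variable {α}

lemma IsAnti.eq_smul {f : MvPolynomial (Fin (2 * m)) ℂ} (hf : IsAnti α f)
    (hd : f.IsHomogeneous (posSum α)) : f = coeff (posExp α) f • anti α := by
  have h1 : IsAnti α (f - coeff (posExp α) f • anti α) := by
    intro h
    rw [map_sub, map_smul, hf h, isAnti_anti α h, smul_sub, smul_comm]
  refine sub_eq_zero.mp (h1.eq_zero ?_ ?_)
  · exact (homogeneousSubmodule (Fin (2 * m)) ℂ (posSum α)).sub_mem hd
      (Submodule.smul_mem _ _ (isHomogeneous_anti α))
  · rw [coeff_sub, coeff_smul, coeff_anti, smul_eq_mul, mul_one, sub_self]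

end SemiInvariants

/-! ### The equivariant pairing of monomials with matchings -/

section Pairing

open MvPolynomial

variable {n : ℕ}

/-- The involution of `ℕ` interchanging `2 k` and `2 k + 1`. -/
def flip2 (k : ℕ) : ℕ := if k % 2 = 0 then k + 1 else k - 1

lemma flip2_flip2 (k : ℕ) : flip2 (flip2 k) = k := by
  unfold flip2; split_ifs <;> omega

lemma flip2_mod (k : ℕ) : flip2 k % 2 = 1 ↔ k % 2 ≠ 1 := by
  unfold flip2; split_ifs <;> omega

/-- The exponent `γ` is compatible with the matching given by `w`. -/
def Compat (w : WB n) (γ : Fin n →₀ ℕ) : Prop := ∀ i, γ (w.right i) = flip2 (γ i)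

/-- The set of odd exponents. -/
def oddSet (γ : Fin n →₀ ℕ) : Finset (Fin n) := Finset.univ.filter fun i => γ i % 2 = 1

lemma mem_oddSet {γ : Fin n →₀ ℕ} {i : Fin n} : i ∈ oddSet γ ↔ γ i % 2 = 1 := by simp [oddSet]

lemma Compat.isTrans {w : WB n} {γ : Fin n →₀ ℕ} (h : Compat w γ) : IsTrans w (oddSet γ) := by
  intro i
  rw [mem_oddSet, mem_oddSet, h i, flip2_mod]

lemma compat_conj {g w : WB n} {γ : Fin n →₀ ℕ} :
    Compat (g * w * g⁻¹) (γ.equivMapDomain g.right) ↔ Compat w γ := by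
  unfold Compat
  rw [g.right.surjective.forall]
  refine forall_congr' fun i => ?_
  rw [right_conj_apply]
  simp

lemma oddSet_equivMapDomain (τ : Equiv.Perm (Fin n)) (γ : Fin n →₀ ℕ) :
    oddSet (γ.equivMapDomain τ) = (oddSet γ).map τ.toEmbedding := by
  ext i
  obtain ⟨j, rfl⟩ := τ.surjective i
  simp [mem_oddSet]

lemma monSign_eq_prod (g : WB n) (γ : Fin n →₀ ℕ) :
    monSign g γ = ∏ j ∈ oddSet γ, g.left (g.right j) := by
  rw [monSign, oddSet, Finset.prod_filter]
  refine Finset.prod_congr rfl fun j _ => ?_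
  split_ifs with h
  · rw [← Nat.div_add_mod (γ j) 2, h, pow_add, pow_mul, Int.units_sq, one_pow, one_mul, pow_one]
  · rw [← Nat.div_add_mod (γ j) 2, Nat.mod_two_ne_one.mp h, pow_add, pow_mul, Int.units_sq,
      one_pow, one_mul, pow_zero]

open Classical in
/-- The linear form on polynomials attached to a fixed point free involution. -/
noncomputable def pairing (w : WB n) : MvPolynomial (Fin n) ℂ →ₗ[ℂ] ℂ :=
  (basisMonomials (Fin n) ℂ).constr ℂ fun γ =>
    if Compat w γ then ((transSign w (oddSet γ) : ℤ) : ℂ) else 0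

open Classical in
lemma pairing_monomial (w : WB n) (γ : Fin n →₀ ℕ) : pairing w (monomial γ 1) =
    if Compat w γ then ((transSign w (oddSet γ) : ℤ) : ℂ) else 0 := by
  have := (basisMonomials (Fin n) ℂ).constr_basis ℂ (fun γ =>
    if Compat w γ then ((transSign w (oddSet γ) : ℤ) : ℂ) else 0) γ
  rwa [coe_basisMonomials] at this

/-- For a compatible monomial the vertices with odd exponent form a transversal, and `g` acts on the
monomial by its signs there. These are the signs in `kap_mul_transSign`. -/
lemma pairing_conj {w : WB n} (hw : w * w = 1) (g : WB n) (f : MvPolynomial (Fin n) ℂ) :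
    pairing (g * w * g⁻¹) (polyRepB n g f) = ((kap g w : ℤ) : ℂ) * pairing w f := by
  classical
  have key : pairing (g * w * g⁻¹) ∘ₗ polyRepB n g = ((kap g w : ℤ) : ℂ) • pairing w := by
    refine (basisMonomials (Fin n) ℂ).ext fun γ => ?_
    have h1 : (monomial (γ.equivMapDomain g.right) (((monSign g γ : ℤˣ) : ℤ) : ℂ)) =
        (((monSign g γ : ℤˣ) : ℤ) : ℂ) • monomial (γ.equivMapDomain g.right) 1 := by
      rw [smul_monomial, smul_eq_mul, mul_one]
    rw [coe_basisMonomials, LinearMap.comp_apply, LinearMap.smul_apply, polyRepB_monomial, mul_one,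
      h1, map_smul, pairing_monomial, pairing_monomial, smul_eq_mul, smul_eq_mul]
    by_cases h : Compat w γ
    · rw [if_pos h, if_pos (compat_conj.mpr h), ← Int.cast_mul, ← Int.cast_mul, ← Units.val_mul,
        ← Units.val_mul, kap_mul_transSign hw h.isTrans, monSign_eq_prod, oddSet_equivMapDomain]
    · rw [if_neg h, if_neg fun h' => h (compat_conj.mp h'), mul_zero, mul_zero]
  exact LinearMap.congr_fun key f

end Pairing

/-! ### Signs of permutations commuting with `σ` -/

section Sign

lemma sign_of_commute_not {ι : Type*} [Fintype ι] [DecidableEq ι] (h : Equiv.Perm (ι × Bool))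
    (hc : ∀ p b, h (p, !b) = ((h (p, b)).1, !(h (p, b)).2)) :
    Equiv.Perm.sign h = ∏ p, if (h (p, true)).2 = true then 1 else -1 := by
  have hinj : Function.Injective fun p => (h (p, true)).1 := by
    intro p q hpq
    have hpq' : (h (p, true)).1 = (h (q, true)).1 := hpq
    by_cases h2 : (h (p, true)).2 = (h (q, true)).2
    · exact (Prod.ext_iff.mp (h.injective (Prod.ext hpq' h2))).1
    · have h3 : h (p, true) = h (q, false) := by
        have := hc q true
        rw [Bool.not_true] at this
        rw [this]
        refine Prod.ext hpq' ?_
        exact Bool.eq_not.mpr h2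
      exact (Prod.ext_iff.mp (h.injective h3)).1
  let q : Equiv.Perm ι := Equiv.ofBijective _ (Finite.injective_iff_bijective.mp hinj)
  -- The factor `q` acts on two copies of `ι` and has sign `1`, so the sign counts the swapped
  -- pairs.
  have key : h = Equiv.prodCongrLeft (fun _ : Bool => q) *
      Equiv.prodCongrRight fun p : ι =>
        if (h (p, true)).2 = true then 1 else Equiv.swap true false := by
    ext1 ⟨p, b⟩
    have hq : q p = (h (p, true)).1 := rfl
    rw [Equiv.Perm.mul_apply, Equiv.prodCongrRight_apply, Equiv.prodCongrLeft_apply, hq]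
    have h1 := hc p true
    rw [Bool.not_true] at h1
    cases b <;> cases h2 : (h (p, true)).2 <;> simp [h1, h2, Prod.ext_iff]
  rw [key, Equiv.Perm.sign_mul, Equiv.Perm.sign_prodCongrLeft, Equiv.Perm.sign_prodCongrRight,
    Fintype.prod_bool, Int.units_mul_self, one_mul, ← key]
  refine Finset.prod_congr rfl fun p _ => ?_
  split_ifs
  · simp
  · exact Equiv.Perm.sign_swap (by simp)

variable {m : ℕ}

lemma sigma_pairEquiv (p : Fin m) (b : Bool) :
    (sigma m : WB (2 * m)).right (pairEquiv m (p, b)) = pairEquiv m (p, !b) := by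
  cases b
  · exact sigma_ev p
  · exact sigma_od p

lemma sign_of_commute_sigma {τ : Equiv.Perm (Fin (2 * m))}
    (h : ∀ i, τ ((sigma m : WB (2 * m)).right i) = (sigma m : WB (2 * m)).right (τ i)) :
    Equiv.Perm.sign τ = ∏ p : Fin m, if τ (od p) ∈ odds m then 1 else -1 := by
  rw [← Equiv.Perm.sign_permCongr (pairEquiv m).symm τ, sign_of_commute_not]
  · refine Finset.prod_congr rfl fun p _ => if_congr ?_ rfl rfl
    have h1 : (pairEquiv m).symm.permCongr τ (p, true) = (pairEquiv m).symm (τ (od p)) := rfl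
    rw [h1]
    rcases ev_or_od (τ (od p)) with ⟨q, hq⟩ | ⟨q, hq⟩
    · rw [iff_false_right (by rw [hq]; exact ev_notMem q), hq]; simp [ev]
    · rw [iff_true_right (by rw [hq]; exact od_mem q), hq]; simp [od]
  · intro p b
    obtain ⟨⟨q, c⟩, hq⟩ := (pairEquiv m).surjective (τ (pairEquiv m (p, b)))
    have h1 : (pairEquiv m).symm.permCongr τ (p, b) = (q, c) := by
      rw [Equiv.permCongr_apply, Equiv.symm_symm, ← hq, Equiv.symm_apply_apply]
    rw [h1, Equiv.permCongr_apply, Equiv.symm_symm, ← sigma_pairEquiv, h, ← hq, sigma_pairEquiv,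
      Equiv.symm_apply_apply]

lemma sign_sigma (m : ℕ) : Equiv.Perm.sign (sigma m : WB (2 * m)).right = (-1) ^ m := by
  have h : ∀ w : WD (2 * m), Equiv.Perm.sign (w : WB (2 * m)).right = (Equiv.Perm.sign.comp
    (SemidirectProduct.rightHom.comp (WD (2 * m)).subtype)) w := fun _ => rfl
  rw [h, sigma, map_list_prod, List.map_map]
  have h1 : ((Equiv.Perm.sign.comp (SemidirectProduct.rightHom.comp (WD (2 * m)).subtype)) ∘
      fun k : Fin m => s (n := 2 * m) (2 * k.val) (by omega)) = fun _ => -1 := by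
    ext1 k
    exact Equiv.Perm.sign_swap (ev_ne_od k k)
  rw [h1, List.map_const', List.prod_replicate, List.length_finRange]

end Sign

/-! ### Pairing the antisymmetrized monomial with the two classes -/

section PairingAnti

open MvPolynomial

variable {n m : ℕ}

lemma IsTrans.map_compl {w : WB n} {A : Finset (Fin n)} (hA : IsTrans w A) :
    Aᶜ = A.map w.right.toEmbedding := by
  ext i
  obtain ⟨j, rfl⟩ := w.right.surjective i
  rw [Finset.mem_compl, hA j, not_not]
  simp

lemma IsTrans.card {w : WB (2 * m)} {A : Finset (Fin (2 * m))} (hA : IsTrans w A) :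
    A.card = m := by
  have h1 := A.card_add_card_compl
  rw [hA.map_compl, Finset.card_map, Fintype.card_fin] at h1
  omega

/-- Moving to the other end of an edge of sign `ε` multiplies the root by `-ε`; there are `m` edges
and the product of their signs is `e`. -/
lemma transSign_compl {w : WB (2 * m)} {e : ℤˣ} (hw : IsGood w e) {A : Finset (Fin (2 * m))}
    (hA : IsTrans w A) : transSign w Aᶜ = (-1) ^ m * e * transSign w A := by
  have h1 : ((-1) ^ m * e : ℤˣ) = ∏ j ∈ A, -1 * w.left j := by
    rw [Finset.prod_mul_distrib, Finset.prod_const, hA.card, hw.2.2 A hA]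
  rw [h1, hA.map_compl, transSign, transSign, Finset.prod_map, ← Finset.prod_mul_distrib]
  refine Finset.prod_congr rfl fun j _ => ?_
  rw [← (isRoot_sub_act (hA.ne j)).sg_smul, Equiv.coe_toEmbedding, act_ee, act_ee,
    right_right hw.1, left_right hw.1]
  congr 1
  have h2 : (w.left j : ℤ) * w.left j = 1 := by
    rw [← Units.val_mul, Int.units_mul_self, Units.val_one]
  rw [Units.val_mul, Units.val_neg, Units.val_one, smul_sub, smul_smul, mul_assoc, h2]
  simp [sub_eq_add_neg, add_comm]

variable (α : m.Partition)

/-- The element `σ` of the Young subgroup. -/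
def sigmaYoung : young α := ⟨sigma m, (mem_young α).mpr ⟨sigma_left m, fun i => by
  rcases ev_or_od i with ⟨p, rfl⟩ | ⟨p, rfl⟩
  · rw [sigma_ev, blk_od]
  · rw [sigma_od, blk_od]⟩⟩

lemma blk_sigma (i : Fin (2 * m)) :
    blk α ((sigma m : WB (2 * m)).right i) = blk α i := blk_right α (sigmaYoung α) i

lemma pos_sigma (i : Fin (2 * m)) :
    pos α ((sigma m : WB (2 * m)).right i) = flip2 (pos α i) := by
  rcases ev_or_od i with ⟨p, rfl⟩ | ⟨p, rfl⟩
  · rw [sigma_ev, pos_od, flip2, if_pos (pos_ev_even α p)]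
  · have := pos_ev_even α p
    rw [sigma_od, pos_od, flip2, if_neg (by omega), Nat.add_sub_cancel]

lemma oddSet_posExp : oddSet (posExp α) = odds m := by
  ext i
  have := fun p => pos_ev_even α p
  rcases ev_or_od i with ⟨p, rfl⟩ | ⟨p, rfl⟩
  · simp [mem_oddSet, this]
  · simp [mem_oddSet, pos_od, Nat.add_mod, this]

/-- The exponents obtained by permuting the positions. -/
noncomputable abbrev permExp (h : young α) : Fin (2 * m) →₀ ℕ :=
  (posExp α).equivMapDomain ((h : WD (2 * m)) : WB (2 * m)).right

open Classical in
lemma pairing_anti (w : WB (2 * m)) : pairing w (anti α) = ∑ h : young α, youngSign α h *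
    if Compat w (permExp α h) then ((transSign w (oddSet (permExp α h)) : ℤ) : ℂ) else 0 := by
  rw [anti, map_sum]
  refine Finset.sum_congr rfl fun h _ => ?_
  rw [map_smul, polyRep_young, pairing_monomial, smul_eq_mul, lam_coe]

lemma permExp_mul_sigma (h : young α) (i : Fin (2 * m)) :
    permExp α (h * sigmaYoung α) i = flip2 (permExp α h i) := by
  obtain ⟨j, rfl⟩ := ((h : WD (2 * m)) : WB (2 * m)).right.surjective i
  obtain ⟨k, rfl⟩ := (sigma m : WB (2 * m)).right.surjective j
  have h1 : ((h : WD (2 * m)) : WB (2 * m)).right ((sigma m : WB (2 * m)).right k) =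
    (((h * sigmaYoung α : young α) : WD (2 * m)) : WB (2 * m)).right k := rfl
  rw [h1, permExp, Finsupp.equivMapDomain_apply, Equiv.symm_apply_apply, ← h1, permExp,
    Finsupp.equivMapDomain_apply, Equiv.symm_apply_apply, posExp_apply, posExp_apply, pos_sigma,
    flip2_flip2]

lemma youngSign_mul_sigma (h : young α) :
    youngSign α (h * sigmaYoung α) = (-1) ^ m * youngSign α h := by
  have h1 : youngSign α (sigmaYoung α) = (-1) ^ m := by
    have := sign_sigma m
    rw [youngSign]
    change ((Equiv.Perm.sign (sigma m : WB (2 * m)).right : ℤ) : ℂ) = _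
    rw [this]
    simp
  rw [← lam_coe, map_mul, Units.val_mul, lam_coe, lam_coe, h1, mul_comm]

/-- The antisymmetrized monomial is orthogonal to the matchings in the twisted class. -/
lemma pairing_anti_eq_zero {w : WB (2 * m)} (hw : IsGood w (-1)) : pairing w (anti α) = 0 := by
  classical
  -- The substitution `h ↦ h σ` contributes `(-1) ^ m` from the sign of `σ`. It also exchanges even
  -- and odd exponents, which contributes `(-1) ^ m * (-1)`.
  have h1 : pairing w (anti α) = - pairing w (anti α) := by
    conv_lhs => rw [pairing_anti]
    rw [pairing_anti, ← Finset.sum_neg_distrib]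
    refine (Fintype.sum_equiv (Equiv.mulRight (sigmaYoung α)) _ _ fun h => ?_).symm
    rw [Equiv.coe_mulRight, youngSign_mul_sigma]
    have h2 : Compat w (permExp α (h * sigmaYoung α)) ↔ Compat w (permExp α h) := by
      refine forall_congr' fun i => ?_
      rw [permExp_mul_sigma, permExp_mul_sigma]
      exact (Function.LeftInverse.injective flip2_flip2).eq_iff
    by_cases hc : Compat w (permExp α h)
    · rw [if_pos hc, if_pos (h2.mpr hc)]
      have h3 : oddSet (permExp α (h * sigmaYoung α)) = (oddSet (permExp α h))ᶜ := by
        ext i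
        rw [mem_oddSet, permExp_mul_sigma, flip2_mod, Finset.mem_compl, mem_oddSet]
      have h4 : ((-1 : ℂ) ^ m) * (-1) ^ m = 1 := by
        rw [← mul_pow]; simp
      rw [h3, transSign_compl hw hc.isTrans]
      push_cast
      linear_combination (youngSign α h *
        ((transSign w (oddSet (permExp α h)) : ℤ) : ℂ)) * h4
    · rw [if_neg hc, if_neg fun h' => hc (h2.mp h')]
      simp
  linear_combination (1 / 2 : ℂ) * h1

lemma sg_sub_sigma (i : Fin (2 * m)) :
    sg (ee i - act (sigma m : WB (2 * m)) (ee i)) = if i ∈ odds m then 1 else -1 := by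
  rw [act_ee, sigma_left]
  rcases ev_or_od i with ⟨p, rfl⟩ | ⟨p, rfl⟩
  · rw [if_neg (ev_notMem p), sigma_ev]
    exact sg_of_neg (by simp [ht_ee])
  · rw [if_pos (od_mem p), sigma_od]
    exact sg_of_pos (by simp [ht_ee])

lemma pairing_sigma_anti_ne_zero : pairing (sigma m : WB (2 * m)) (anti α) ≠ 0 := by
  classical
  -- Compatibility means that `h` commutes with `σ`. The sign of `h` then counts the odd vertices
  -- sent to even ones, exactly as `transSign` does, and the two signs cancel.
  have key : ∀ h : young α, Compat (sigma m : WB (2 * m)) (permExp α h) →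
      youngSign α h *
        ((transSign (sigma m : WB (2 * m)) (oddSet (permExp α h)) : ℤ) : ℂ) = 1 := by
    intro h hc
    have hcomm : ∀ i, ((h : WD (2 * m)) : WB (2 * m)).right ((sigma m : WB (2 * m)).right i) =
        (sigma m : WB (2 * m)).right (((h : WD (2 * m)) : WB (2 * m)).right i) := by
      intro i
      have h1 := hc (((h : WD (2 * m)) : WB (2 * m)).right i)
      simp only [permExp, Finsupp.equivMapDomain_apply, Equiv.symm_apply_apply,
        posExp_apply] at h1
      rw [← pos_sigma] at h1
      have h2 := eq_of_blk_pos α (by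
        rw [blk_right_symm, blk_sigma, blk_right, blk_sigma]) h1
      rw [← h2, Equiv.apply_symm_apply]
    have h3 : transSign (sigma m : WB (2 * m)) (oddSet (permExp α h)) =
        Equiv.Perm.sign ((h : WD (2 * m)) : WB (2 * m)).right := by
      rw [sign_of_commute_sigma hcomm, permExp, oddSet_equivMapDomain, oddSet_posExp, transSign,
        Finset.prod_map, prod_odds]
      exact Finset.prod_congr rfl fun p _ => sg_sub_sigma _
    rw [h3, youngSign, ← Int.cast_mul, ← Units.val_mul, Int.units_mul_self]
    simp
  rw [pairing_anti]
  have h1 : ∀ h : young α, youngSign α h * (if Compat (sigma m : WB (2 * m)) (permExp α h)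
      then ((transSign (sigma m : WB (2 * m)) (oddSet (permExp α h)) : ℤ) : ℂ) else 0) =
      if Compat (sigma m : WB (2 * m)) (permExp α h) then 1 else 0 := by
    intro h
    by_cases hc : Compat (sigma m : WB (2 * m)) (permExp α h)
    · rw [if_pos hc, if_pos hc, key h hc]
    · rw [if_neg hc, if_neg hc, mul_zero]
  rw [Finset.sum_congr rfl fun h _ => h1 h, Finset.sum_boole, Nat.cast_ne_zero]
  -- The pairing is the number of compatible elements, among them the identity.
  refine Finset.card_ne_zero.mpr ⟨1, Finset.mem_filter.mpr ⟨Finset.mem_univ _, fun i => ?_⟩⟩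
  exact pos_sigma α i

end PairingAnti

/-! ### Cyclic representations and a criterion for irreducibility -/

section Cyclic

open Representation

variable {G : Type} [Group G] {V : Type*} [AddCommGroup V] [Module ℂ V]
  (ρ : Representation ℂ G V)

/-- The subrepresentation generated by a vector. -/
def cyc (v : V) : Subrepresentation ρ where
  toSubmodule := Submodule.span ℂ (Set.range fun g => ρ g v)
  apply_mem_toSubmodule g x hx := by
    have h : Submodule.span ℂ (Set.range fun g => ρ g v) ≤
        (Submodule.span ℂ (Set.range fun g => ρ g v)).comap (ρ g) := by
      rw [Submodule.span_le]
      rintro _ ⟨k, rfl⟩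
      refine Submodule.subset_span ⟨g * k, ?_⟩
      simp
    exact h hx

instance [Finite G] (v : V) : FiniteDimensional ℂ (cyc ρ v).toSubmodule :=
  FiniteDimensional.span_of_finite ℂ (Set.finite_range _)

lemma mem_cyc (v : V) : v ∈ (cyc ρ v).toSubmodule :=
  Submodule.subset_span ⟨1, by simp⟩

variable {ρ}

lemma cyc_le {v : V} {U : Subrepresentation ρ} (h : v ∈ U.toSubmodule) :
    (cyc ρ v).toSubmodule ≤ U.toSubmodule := by
  refine Submodule.span_le.mpr ?_
  rintro _ ⟨g, rfl⟩
  exact U.apply_mem_toSubmodule g h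

lemma eq_top_of_mem_cyc {v : V} {U : Subrepresentation (cyc ρ v).toRepresentation}
    (h : (⟨v, mem_cyc ρ v⟩ : (cyc ρ v).toSubmodule) ∈ U.toSubmodule) : U = ⊤ := by
  have h1 : (cyc ρ v).toSubmodule ≤ U.toSubmodule.map (cyc ρ v).toSubmodule.subtype := by
    refine Submodule.span_le.mpr ?_
    rintro _ ⟨g, rfl⟩
    exact ⟨_, U.apply_mem_toSubmodule g h, rfl⟩
  apply Subrepresentation.toSubmodule_injective
  refine eq_top_iff.mpr fun x _ => ?_
  obtain ⟨y, hy, hyx⟩ := h1 x.2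
  rwa [← Subtype.ext (a1 := y) (a2 := x) hyx]

lemma nontrivial_subrepresentation {v : V} (hv : v ≠ 0) : Nontrivial (Subrepresentation ρ) := by
  refine ⟨⊥, ⊤, fun h => hv ?_⟩
  have h' : (⊥ : Submodule ℂ V) = ⊤ := congrArg Subrepresentation.toSubmodule h
  exact (Submodule.mem_bot ℂ).mp (h' ▸ Submodule.mem_top)

/-- The representation generated by a semi-invariant vector is irreducible if there are no further
semi-invariant vectors in it. -/
lemma isIrreducible_cyc [Fintype G] {H : Subgroup G} {lam : H →* ℂˣ} {v : V} (hv0 : v ≠ 0)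
    (hv : IsSemiInv H lam ρ v)
    (huniq : ∀ x ∈ (cyc ρ v).toSubmodule, IsSemiInv H lam ρ x → ∃ c : ℂ, x = c • v) :
    (cyc ρ v).toRepresentation.IsIrreducible := by
  have : NeZero (Nat.card G : ℂ) := ⟨card_ne_zero⟩
  have hnt : Nontrivial (Subrepresentation (cyc ρ v).toRepresentation) :=
    nontrivial_subrepresentation (v := ⟨v, mem_cyc ρ v⟩) fun h => hv0 (congrArg Subtype.val h)
  refine ⟨fun U => ?_⟩
  obtain ⟨U', hU'⟩ := exists_isCompl U
  have hc := isCompl_toSubmodule hU'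
  have h1 : (⟨v, mem_cyc ρ v⟩ : (cyc ρ v).toSubmodule) ∈ U.toSubmodule ⊔ U'.toSubmodule := by
    rw [hc.sup_eq_top]; exact Submodule.mem_top
  obtain ⟨x, hx, y, hy, hxy⟩ := Submodule.mem_sup.mp h1
  -- The defects from semi-invariance of `x` and `y` add up to zero and lie in complementary
  -- subspaces, so both vanish. Then `x` is a multiple of the generator, and the generator lies in
  -- `U` or in `U'`.
  have hsemi : IsSemiInv H lam (cyc ρ v).toRepresentation x := by
    intro h
    have h2 : (cyc ρ v).toRepresentation h x - (lam h : ℂ) • x =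
        -((cyc ρ v).toRepresentation h y - (lam h : ℂ) • y) := by
      rw [eq_neg_iff_add_eq_zero, sub_add_sub_comm, ← map_add, ← smul_add, hxy, sub_eq_zero]
      exact Subtype.ext (hv h)
    have h3 : (cyc ρ v).toRepresentation h x - (lam h : ℂ) • x ∈
        U.toSubmodule ⊓ U'.toSubmodule := by
      refine ⟨sub_mem (U.apply_mem_toSubmodule _ hx) (Submodule.smul_mem _ _ hx), ?_⟩
      rw [h2]
      exact neg_mem (sub_mem (U'.apply_mem_toSubmodule _ hy) (Submodule.smul_mem _ _ hy))
    rw [hc.inf_eq_bot, Submodule.mem_bot, sub_eq_zero] at h3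
    exact h3
  obtain ⟨c, hcx⟩ := huniq x x.2 (hsemi.map (subtypeHom (cyc ρ v)))
  by_cases h0 : c = 0
  · left
    have hx0 : x = 0 := Subtype.ext (by rw [hcx, h0, zero_smul]; rfl)
    rw [hx0, zero_add] at hxy
    have := eq_top_of_mem_cyc (hxy ▸ hy)
    rw [this] at hU'
    simpa using hU'.1.eq_bot
  · right
    refine eq_top_of_mem_cyc ?_
    have : (⟨v, mem_cyc ρ v⟩ : (cyc ρ v).toSubmodule) = c⁻¹ • x := Subtype.ext (by
      rw [Submodule.coe_smul, hcx, smul_smul, inv_mul_cancel₀ h0, one_smul])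
    rw [this]
    exact Submodule.smul_mem _ _ hx

lemma IsIrr.comp_mulEquiv {χ : G → ℂ} (hχ : IsIrr χ) (e : G ≃* G) : IsIrr (χ ∘ e) := by
  obtain ⟨V, _, _, _, ρ, hρ, rfl⟩ := hχ
  refine ⟨V, _, _, inferInstance, ρ.comp e.toMonoidHom, ?_, rfl⟩
  obtain ⟨v, hv⟩ : ∃ v : V, v ≠ 0 := by
    by_contra! hcon
    apply bot_ne_top (α := Subrepresentation ρ)
    apply Subrepresentation.toSubmodule_injective
    ext x
    simp [hcon x]
  have := nontrivial_subrepresentation (ρ := ρ.comp e.toMonoidHom) hv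
  refine ⟨fun U => ?_⟩
  let U' : Subrepresentation ρ := ⟨U.toSubmodule, fun g x hx => by
    have := U.apply_mem_toSubmodule (e.symm g) hx
    simpa using this⟩
  rcases eq_bot_or_eq_top U' with h | h
  · exact Or.inl (Subrepresentation.toSubmodule_injective
      (congrArg (fun X : Subrepresentation ρ => X.toSubmodule) h))
  · exact Or.inr (Subrepresentation.toSubmodule_injective
      (congrArg (fun X : Subrepresentation ρ => X.toSubmodule) h))

end Cyclic

/-! ### Construction and uniqueness of the characters `χ^{α,+1}` -/

section ChiPlus

open Representation MvPolynomial

variable {m : ℕ} (α : m.Partition)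

/-- The representation generated by the antisymmetrized monomial. -/
noncomputable abbrev antiRep : Subrepresentation (polyRep (2 * m)) :=
  cyc (polyRep (2 * m)) (anti α)

lemma antiRep_le : (antiRep α).toSubmodule ≤ homogeneousSubmodule (Fin (2 * m)) ℂ (posSum α) :=
  cyc_le (U := symPow (2 * m) (posSum α)) (isHomogeneous_anti α)

lemma isIrreducible_antiRep : (antiRep α).toRepresentation.IsIrreducible :=
  isIrreducible_cyc (anti_ne_zero α) (isAnti_anti α) fun _ hx hx' =>
    ⟨_, IsAnti.eq_smul hx' (antiRep_le α hx)⟩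

/-- The character `χ^{α,+1}`. -/
noncomputable def chiPlus : WD (2 * m) → ℂ := (antiRep α).toRepresentation.character

lemma isIrr_chiPlus : IsIrr (chiPlus α) :=
  ⟨_, _, _, inferInstance, _, isIrreducible_antiRep α, rfl⟩

lemma ip_chiPlus :
    ip (fun h : young α => chiPlus α h) (fun h => (lam α h : ℂ)) = 1 := by
  refine ip_lam_eq_one _ _ (antiRep α).toRepresentation ⟨_, mem_cyc _ _⟩
    (fun h => anti_ne_zero α (congrArg Subtype.val h))
    (fun h => Subtype.ext (isAnti_anti α h)) fun x hx => ?_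
  have hx' : IsAnti α x.1 := hx.map (subtypeHom (antiRep α))
  exact ⟨_, Subtype.ext (hx'.eq_smul (antiRep_le α x.2))⟩

variable {α}

lemma exists_isAnti_mem {U : Subrepresentation (polyRep (2 * m))} {d : ℕ}
    (hU : U.toSubmodule ≤ homogeneousSubmodule (Fin (2 * m)) ℂ d)
    (h : ip (fun h : young α => U.toRepresentation.character h) (fun h => (lam α h : ℂ)) ≠ 0) :
    ∃ f ∈ U.toSubmodule, f ≠ 0 ∧ IsAnti α f := by
  have : FiniteDimensional ℂ U.toSubmodule := Submodule.finiteDimensional_of_le hU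
  obtain ⟨v, hv, hv'⟩ := (ip_lam_ne_zero_iff _ _ U.toRepresentation).mp h
  exact ⟨v.1, v.2, fun h => hv (Subtype.ext h), hv'.map (subtypeHom U)⟩

lemma posSum_le_of_ip_ne_zero {U : Subrepresentation (polyRep (2 * m))} {d : ℕ}
    (hU : U.toSubmodule ≤ homogeneousSubmodule (Fin (2 * m)) ℂ d)
    (h : ip (fun h : young α => U.toRepresentation.character h) (fun h => (lam α h : ℂ)) ≠ 0) :
    posSum α ≤ d := by
  obtain ⟨f, hf, h0, hf'⟩ := exists_isAnti_mem hU h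
  exact IsAnti.posSum_le hf' h0 (hU hf)

lemma anti_mem_of_ip_ne_zero {U : Subrepresentation (polyRep (2 * m))}
    (hU : U.toSubmodule ≤ homogeneousSubmodule (Fin (2 * m)) ℂ (posSum α))
    (h : ip (fun h : young α => U.toRepresentation.character h) (fun h => (lam α h : ℂ)) ≠ 0) :
    anti α ∈ U.toSubmodule := by
  obtain ⟨f, hf, h0, hf'⟩ := exists_isAnti_mem hU h
  have h1 := IsAnti.eq_smul hf' (hU hf)
  have h2 : coeff (posExp α) f ≠ 0 := fun h2 => h0 (by rw [h1, h2, zero_smul])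
  have h3 : anti α = (coeff (posExp α) f)⁻¹ • f := by
    conv_rhs => rw [h1]
    rw [smul_smul, coeff_smul, coeff_anti, smul_eq_mul, mul_one, inv_mul_cancel₀ h2, one_smul]
  rw [h3]
  exact Submodule.smul_mem _ _ hf

/-- A copy of `ψ` in the minimal degree contains a nonzero antisymmetric polynomial, hence `anti α`
and all of `antiRep α`. -/
lemma eq_chiPlus {ψ : WD (2 * m) → ℂ} (hψ : IsIrr ψ) {U : Subrepresentation (polyRep (2 * m))}
    (hU : U.toSubmodule ≤ homogeneousSubmodule (Fin (2 * m)) ℂ (posSum α))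
    (hUψ : U.toRepresentation.character = ψ)
    (h : ip (fun h : young α => ψ h) (fun h => (lam α h : ℂ)) ≠ 0) : ψ = chiPlus α := by
  have : FiniteDimensional ℂ U.toSubmodule := Submodule.finiteDimensional_of_le hU
  subst hUψ
  have hle := cyc_le (anti_mem_of_ip_ne_zero hU h)
  let f : IntertwiningMap (antiRep α).toRepresentation U.toRepresentation :=
    { toLinearMap := Submodule.inclusion hle
      isIntertwining' := fun _ => rfl }
  have hf : f ≠ 0 := by
    intro h0
    have := DFunLike.congr_fun h0 ⟨_, mem_cyc _ _⟩
    exact anti_ne_zero α (congrArg Subtype.val this)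
  have h1 := ip_ne_zero_of_hom _ _ f hf
  by_contra hne
  exact h1 ((hψ.ip_eq (isIrr_chiPlus α)).trans (if_neg hne))

/-- The infimum defining `b` is attained only because the set of degrees is nonempty; on an empty
set it would take the value `0`. -/
lemma exists_b {n : ℕ} {ψ : WD n → ℂ} (hψ : IsIrr ψ) : ∃ U : Subrepresentation (polyRep n),
    U.toSubmodule ≤ homogeneousSubmodule (Fin n) ℂ (b ψ) ∧ U.toRepresentation.character = ψ :=
  Nat.sInf_mem (s := {d | ∃ U : Subrepresentation (polyRep n),
    U.toSubmodule ≤ homogeneousSubmodule (Fin n) ℂ d ∧ U.toRepresentation.character = ψ})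
    hψ.exists_symPow

lemma posSum_lt_b {ψ : WD (2 * m) → ℂ} (hψ : IsIrr ψ) (hne : ψ ≠ chiPlus α)
    (h : ip (fun h : young α => ψ h) (fun h => (lam α h : ℂ)) ≠ 0) : posSum α < b ψ := by
  obtain ⟨U, hU, hUψ⟩ := exists_b hψ
  refine lt_of_le_of_ne (posSum_le_of_ip_ne_zero hU (by rwa [hUψ])) fun heq => hne ?_
  rw [← heq] at hU
  exact eq_chiPlus hψ hU hUψ h

lemma ip_chiPlus_ne_zero :
    ip (fun h : young α => chiPlus α h) (fun h => (lam α h : ℂ)) ≠ 0 := by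
  rw [ip_chiPlus]; exact one_ne_zero

variable (α)

lemma b_chiPlus : b (chiPlus α) = posSum α := by
  refine le_antisymm (Nat.sInf_le ⟨antiRep α, antiRep_le α, rfl⟩) ?_
  obtain ⟨U, hU, hUψ⟩ := exists_b (isIrr_chiPlus α)
  exact posSum_le_of_ip_ne_zero hU (by rw [hUψ]; exact ip_chiPlus_ne_zero)

lemma isChiPlus_chiPlus (hm : 1 ≤ m) : IsChiPlus α (chiPlus α) := by
  obtain ⟨w₀, hw₀, hmax, hlen⟩ := exists_longest α hm
  obtain ⟨M, hM, hsum⟩ := exists_ind_eq_add (young α) (lam α) (isIrr_chiPlus α) (ip_chiPlus α)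
  refine ⟨w₀, hw₀, hmax, isIrr_chiPlus α, by rw [b_chiPlus, hlen], M, fun ψ hψ => ?_, hsum⟩
  obtain ⟨h1, h2, h3⟩ := hM ψ hψ
  exact ⟨h1, by rw [hlen]; exact posSum_lt_b h1 h2 h3⟩

variable {α}

/-- Both characters lead decompositions of the same induced character. If `chiPlus α` were a
remaining constituent for `χ`, its invariant `b` would exceed `posSum α`. -/
lemma IsChiPlus.eq_chiPlus (hm : 1 ≤ m) {χ : WD (2 * m) → ℂ} (h : IsChiPlus α χ) :
    χ = chiPlus α := by
  obtain ⟨w₀, hw₀, hmax, hirr, -, M, hM, hsum⟩ := h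
  obtain ⟨w₁, hw₁, hmax', -, -, N, hN, hsum'⟩ := isChiPlus_chiPlus α hm
  have h1 : χ ::ₘ M = chiPlus α ::ₘ N := by
    refine eq_of_multiset_sum_eq ?_ ?_ ?_
    · exact Multiset.forall_mem_cons.mpr ⟨hirr, fun ψ hψ => (hM ψ hψ).1⟩
    · exact Multiset.forall_mem_cons.mpr ⟨isIrr_chiPlus α, fun ψ hψ => (hN ψ hψ).1⟩
    · rw [Multiset.sum_cons, Multiset.sum_cons, ← hsum, ← hsum']
  have h2 : chiPlus α ∈ χ ::ₘ M := h1 ▸ Multiset.mem_cons_self _ _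
  rcases Multiset.mem_cons.mp h2 with h3 | h3
  · exact h3.symm
  · have h4 := (hM _ h3).2
    rw [b_chiPlus, len_longest α hm hw₀ hmax] at h4
    exact absurd h4 (lt_irrefl _)

/-- The exponents occurring in the representation generated by the antisymmetrized monomial are
rearrangements of the positions. -/
lemma exists_perm_of_mem_antiRep {f : MvPolynomial (Fin (2 * m)) ℂ}
    (hf : f ∈ (antiRep α).toSubmodule) {γ : Fin (2 * m) →₀ ℕ} (hγ : coeff γ f ≠ 0) :
    ∃ τ : Equiv.Perm (Fin (2 * m)), ∀ i, γ (τ i) = pos α i := by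
  classical
  by_contra! hcon
  have hperm : ∀ τ : Equiv.Perm (Fin (2 * m)), (posExp α).equivMapDomain τ ≠ γ := by
    rintro τ rfl
    obtain ⟨i, hi⟩ := hcon τ
    exact hi (by simp)
  have hle : (antiRep α).toSubmodule ≤ LinearMap.ker (lcoeff ℂ γ) := by
    refine Submodule.span_le.mpr ?_
    rintro _ ⟨g, rfl⟩
    change coeff γ (polyRep (2 * m) g (anti α)) = 0
    rw [anti, map_sum, coeff_sum]
    refine Finset.sum_eq_zero fun h _ => ?_
    have h1 : polyRep (2 * m) g (polyRep (2 * m) h (monomial (posExp α) 1)) =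
        polyRepB (2 * m) ((g * h : WD (2 * m)) : WB (2 * m)) (monomial (posExp α) 1) := by
      rw [← Module.End.mul_apply, ← map_mul]; rfl
    rw [map_smul, coeff_smul, h1, polyRepB_monomial, coeff_monomial, if_neg (hperm _), smul_zero]
  exact hγ (hle hf)

/-- Equal characters have equal `b`, so `antiRep α` contains `anti β`. The group permutes monomials
up to sign, hence both partitions have the same multiset of positions. -/
lemma chiPlus_injective : Function.Injective (chiPlus : m.Partition → WD (2 * m) → ℂ) := by
  intro α β h
  have hs : posSum α = posSum β := by rw [← b_chiPlus, ← b_chiPlus, h]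
  have h1 : anti β ∈ (antiRep α).toSubmodule := by
    refine anti_mem_of_ip_ne_zero (hs ▸ antiRep_le α) ?_
    change ip (fun k : young β => chiPlus α k) _ ≠ 0
    rw [h]
    exact ip_chiPlus_ne_zero
  obtain ⟨τ, hτ⟩ := exists_perm_of_mem_antiRep h1 (γ := posExp β) (by rw [coeff_anti]; simp)
  refine partition_ext fun d => ?_
  refine Finset.card_equiv τ fun i => ?_
  have := hτ i
  rw [posExp_apply] at this
  simp [this]

end ChiPlus

/-! ### Twisting by `θ` and assembling the decomposition -/

section Twist

open Representation MvPolynomial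

variable {n m : ℕ}

lemma polyRep_t (g : WD n) (f : MvPolynomial (Fin n) ℂ) :
    polyRep n g (polyRepB n (t n) f) = polyRepB n (t n) (polyRep n (theta n g) f) := by
  have h : (g : WB n) * t n = t n * (theta n g : WB n) := by
    nth_rewrite 1 [← theta_theta g]
    rw [coe_theta (theta n g), inv_mul_cancel_right]
  change (polyRepB n g * polyRepB n (t n)) f = (polyRepB n (t n) * polyRepB n (theta n g)) f
  rw [← map_mul, ← map_mul, h]

lemma polyRepB_injective (g : WB n) : Function.Injective (polyRepB n g) :=
  ((polyRepB n).apply_bijective g).1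

/-- The twist of a subrepresentation of the polynomials by the reflection `t`. -/
noncomputable def twist (U : Subrepresentation (polyRep n)) : Subrepresentation (polyRep n) where
  toSubmodule := U.toSubmodule.map (polyRepB n (t n))
  apply_mem_toSubmodule g := by
    rintro _ ⟨f, hf, rfl⟩
    exact ⟨_, U.apply_mem_toSubmodule (theta n g) hf, (polyRep_t g f).symm⟩

lemma twist_character (U : Subrepresentation (polyRep n)) :
    (twist U).toRepresentation.character = U.toRepresentation.character ∘ theta n := by
  ext g
  let e : U.toSubmodule ≃ₗ[ℂ] (twist U).toSubmodule :=
    Submodule.equivMapOfInjective (polyRepB n (t n)) (polyRepB_injective _) U.toSubmodule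
  refine Eq.trans ?_ (LinearMap.trace_conj' (U.toRepresentation (theta n g)) e)
  refine congrArg (LinearMap.trace ℂ (twist U).toSubmodule) (LinearMap.ext fun x => ?_)
  obtain ⟨y, rfl⟩ := e.surjective x
  rw [LinearEquiv.conj_apply_apply, LinearEquiv.symm_apply_apply]
  exact Subtype.ext (polyRep_t g y)

lemma twist_le {U : Subrepresentation (polyRep n)} {d : ℕ}
    (hU : U.toSubmodule ≤ homogeneousSubmodule (Fin n) ℂ d) :
    (twist U).toSubmodule ≤ homogeneousSubmodule (Fin n) ℂ d := by
  rintro _ ⟨f, hf, rfl⟩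
  exact isHomogeneous_polyRepB _ (hU hf)

/-- The intertwining map from the polynomials to an involution representation. -/
noncomputable def pairingHom {C : Set (WD n)} (hC : ∀ g w, w ∈ C → g * w * g⁻¹ ∈ C)
    (hC2 : ∀ w ∈ C, (w : WB n) * w = 1) : IntertwiningMap (polyRep n) (invRep ℂ C hC) where
  toFun f := Finsupp.equivFunOnFinite.symm fun w : C => pairing (w.1 : WB n) f
  map_add' _ _ := by ext; simp
  map_smul' _ _ := by ext; simp
  isIntertwining' g := by
    refine LinearMap.ext fun f => Finsupp.ext fun w => ?_
    obtain ⟨x, rfl⟩ : ∃ x : C, w = ⟨g * x.1 * g⁻¹, hC g x.1 x.2⟩ :=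
      ⟨⟨g⁻¹ * w.1 * g⁻¹⁻¹, hC _ _ w.2⟩, Subtype.ext (by group)⟩
    exact (pairing_conj (hC2 _ x.2) g f).trans (invRep_apply ℂ C hC g
      (Finsupp.equivFunOnFinite.symm fun w : C => pairing (w.1 : WB n) f) x).symm

/-- The restriction to `antiRep α` of the map to the representation on the class of `σ`. -/
noncomputable def antiHom (α : m.Partition) :
    IntertwiningMap (antiRep α).toRepresentation (sigmaRep m) :=
  compHom (pairingHom conj_mem_C₀ fun _ hw => (isGood_of_mem hw).1) (subtypeHom (antiRep α))

lemma antiHom_ne_zero (α : m.Partition) : antiHom α ≠ 0 := by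
  intro h
  have := DFunLike.congr_fun (DFunLike.congr_fun h ⟨_, mem_cyc _ (anti α)⟩)
    (⟨sigma m, IsConj.refl _⟩ : C₀ m)
  exact pairing_sigma_anti_ne_zero α this

lemma antiHom_injective (α : m.Partition) : Function.Injective (antiHom α) :=
  have := isIrreducible_antiRep α
  (IsIrreducible.injective_or_eq_zero (antiHom α)).resolve_right (antiHom_ne_zero α)

/-- If `anti β = t f` with `f` in `antiRep α`, then `f` pairs with `C₀` as `anti β` does with
`θ(C₀)` up to sign, that is, to zero. But the pairing is injective on `antiRep α`. -/
lemma anti_notMem_twist (hm : 1 ≤ m) (α β : m.Partition) :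
    anti β ∉ (twist (antiRep α)).toSubmodule := by
  rintro ⟨f, hf, hfβ⟩
  have h0 : antiHom α ⟨f, hf⟩ = 0 := by
    ext w
    change pairing (w.1 : WB (2 * m)) f = 0
    have h1 := pairing_conj (isGood_of_mem w.2).1 (t (2 * m)) f
    have h2 : pairing (t (2 * m) * (w.1 : WB (2 * m)) * (t (2 * m))⁻¹) (anti β) = 0 :=
      pairing_anti_eq_zero β (isGood_of_mem_theta hm (Set.mem_image_of_mem _ w.2))
    rw [hfβ, h2] at h1
    refine (mul_eq_zero.mp h1.symm).resolve_left ?_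
    exact Int.cast_ne_zero.mpr (Units.ne_zero _)
  have h1 : (⟨f, hf⟩ : (antiRep α).toSubmodule) = 0 :=
    antiHom_injective α (h0.trans (map_zero _).symm)
  have h2 : f = 0 := congrArg Subtype.val h1
  exact anti_ne_zero β (by rw [← hfβ, h2, map_zero])

lemma posSum_le_of_comp_theta_eq {α β : m.Partition}
    (h : chiPlus α ∘ theta (2 * m) = chiPlus β) : posSum β ≤ posSum α := by
  refine posSum_le_of_ip_ne_zero (twist_le (antiRep_le α)) ?_
  rw [twist_character]
  change ip (fun k : young β => (chiPlus α ∘ theta (2 * m)) k) _ ≠ 0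
  rw [h]
  exact ip_chiPlus_ne_zero

/-- Equality would force equal minimal degrees, since `theta` is an involution. The twist of
`antiRep α` would then contain `anti β`. -/
lemma comp_theta_ne (hm : 1 ≤ m) (α β : m.Partition) :
    chiPlus α ∘ theta (2 * m) ≠ chiPlus β := by
  intro h
  have h' : chiPlus β ∘ theta (2 * m) = chiPlus α := by
    ext g
    rw [← h, Function.comp_apply, Function.comp_apply, theta_theta]
  have hs : posSum α = posSum β :=
    le_antisymm (posSum_le_of_comp_theta_eq h') (posSum_le_of_comp_theta_eq h)
  refine anti_notMem_twist hm α β (anti_mem_of_ip_ne_zero (hs ▸ twist_le (antiRep_le α)) ?_)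
  rw [twist_character]
  change ip (fun k : young β => (chiPlus α ∘ theta (2 * m)) k) _ ≠ 0
  rw [h]
  exact ip_chiPlus_ne_zero

lemma sigmaRep_character (m : ℕ) : (sigmaRep m).character = ∑ α : m.Partition, chiPlus α :=
  character_eq_sum_of_finrank_le (sigmaRep m) chiPlus isIrr_chiPlus chiPlus_injective
    (fun α => ip_ne_zero_of_hom _ _ (antiHom α) (antiHom_ne_zero α)) (finrank_commutant_le m)

lemma signs_eq_one (hm : 1 ≤ m) (ν : m.Partition → ℤˣ)
    (h : ∑ α : m.Partition, chiPlus α = ∑ α, signed (chiPlus α) (ν α)) (α : m.Partition) :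
    ν α = 1 := by
  have h1 : Finset.univ.val.map (chiPlus : m.Partition → WD (2 * m) → ℂ) =
      Finset.univ.val.map fun α => signed (chiPlus α) (ν α) := by
    refine eq_of_multiset_sum_eq ?_ ?_ h
    · intro ψ hψ
      obtain ⟨β, -, rfl⟩ := Multiset.mem_map.mp hψ
      exact isIrr_chiPlus β
    · intro ψ hψ
      obtain ⟨β, -, rfl⟩ := Multiset.mem_map.mp hψ
      unfold signed
      split_ifs
      · exact isIrr_chiPlus β
      · exact (isIrr_chiPlus β).comp_mulEquiv (theta (2 * m))
  -- A wrong sign puts some `chiPlus α ∘ theta` among the constituents `chiPlus β`.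
  by_contra hne
  have h2 : signed (chiPlus α) (ν α) ∈
      Finset.univ.val.map (chiPlus : m.Partition → WD (2 * m) → ℂ) := by
    rw [h1]
    exact Multiset.mem_map_of_mem (fun α => signed (chiPlus α) (ν α)) (Finset.mem_univ α)
  obtain ⟨β, -, hβ⟩ := Multiset.mem_map.mp h2
  rw [signed, if_neg hne] at hβ
  exact comp_theta_ne hm α β hβ.symm

end Twist

end TypeD

theorem mainTheorem4 (m : ℕ) (hm : 1 ≤ m) :
    TypeD.theta (2 * m) '' TypeD.C₀ m ≠ TypeD.C₀ m ∧
    (∃! ρ, TypeD.IsInvolutionRep (TypeD.C₀ m) ρ) ∧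
    (∃! ρ, TypeD.IsInvolutionRep (TypeD.theta (2 * m) '' TypeD.C₀ m) ρ) ∧
    (∀ α : m.Partition, ∃! χ, TypeD.IsChiPlus α χ) ∧
    ∀ (ρ : Representation ℝ (TypeD.WD (2 * m)) (TypeD.C₀ m →₀ ℝ))
      (ρ' : Representation ℝ (TypeD.WD (2 * m)) ((TypeD.theta (2 * m) '' TypeD.C₀ m) →₀ ℝ))
      (χ : m.Partition → TypeD.WD (2 * m) → ℂ),
      TypeD.IsInvolutionRep (TypeD.C₀ m) ρ →
      TypeD.IsInvolutionRep (TypeD.theta (2 * m) '' TypeD.C₀ m) ρ' →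
      (∀ α, TypeD.IsChiPlus α (χ α)) →
        (∀ w, (ρ.character w : ℂ) = ∑ α, TypeD.signed (χ α) 1 w) ∧
        (∀ w, (ρ'.character w : ℂ) = ∑ α, TypeD.signed (χ α) (-1) w) ∧
        ∀ ν : m.Partition → ℤˣ,
          (∀ w, (ρ.character w : ℂ) = ∑ α, TypeD.signed (χ α) (ν α) w) → ∀ α, ν α = 1 := by
  have hn : 1 < 2 * m := by omega
  have hconj := TypeD.conj_mem_theta (TypeD.C₀ m) TypeD.conj_mem_C₀
  have hinv := TypeD.isInvolutionRep_invRep (TypeD.C₀ m) TypeD.conj_mem_C₀ hn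
    fun w hw => TypeD.mul_self_of_isGood (TypeD.isGood_of_mem hw)
  have hinv' := TypeD.isInvolutionRep_invRep (TypeD.theta (2 * m) '' TypeD.C₀ m) hconj hn
    fun w hw => TypeD.mul_self_of_isGood (TypeD.isGood_of_mem_theta hm hw)
  refine ⟨TypeD.theta_ne hm,
    ⟨_, hinv, fun ρ hρ => TypeD.IsInvolutionRep.unique _ TypeD.conj_mem_C₀ hn hρ hinv⟩,
    ⟨_, hinv', fun ρ hρ => TypeD.IsInvolutionRep.unique _ hconj hn hρ hinv'⟩,
    fun α => ⟨_, TypeD.isChiPlus_chiPlus α hm, fun χ hχ => hχ.eq_chiPlus hm⟩, ?_⟩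
  intro ρ ρ' χ hρ hρ' hχ
  obtain rfl : χ = TypeD.chiPlus := funext fun α => (hχ α).eq_chiPlus hm
  obtain rfl := TypeD.IsInvolutionRep.unique _ TypeD.conj_mem_C₀ hn hρ hinv
  obtain rfl := TypeD.IsInvolutionRep.unique _ hconj hn hρ' hinv'
  -- The real and complex representations share their monomial matrices, so the complex
  -- decomposition applies.
  have hchar : ∀ w, ((TypeD.invRep ℝ (TypeD.C₀ m) TypeD.conj_mem_C₀).character w : ℂ) =
      (∑ α : m.Partition, TypeD.chiPlus α) w := fun w => by
    rw [TypeD.invRep_character_ofReal, ← TypeD.sigmaRep_character]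
  refine ⟨fun w => ?_, fun w => ?_, fun ν hν => ?_⟩
  · rw [hchar, Finset.sum_apply]
    rfl
  · rw [TypeD.invRep_character_theta _ TypeD.conj_mem_C₀, hchar, Finset.sum_apply]
    refine Finset.sum_congr rfl fun α _ => ?_
    rw [TypeD.signed, if_neg (by decide)]
    rfl
  · refine TypeD.signs_eq_one hm ν (funext fun w => ?_)
    rw [← hchar, hν, Finset.sum_apply]
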